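/- **Setting.** Let $n,f,\lambda\in\mathbb N$ with $3f<n$ and $n^3\le 2^\lambda$ (that is, $\lambda\ge 3\log_2 n$). There are $n$ parties joined by authenticated asynchronous point-to-point channels: messages between nonfaulty parties arrive in finite but unbounded time. An adaptive Byzantine adversary schedules all steps and message deliveries, starts the parties, chooses their inputs, and may corrupt at most $f$ parties; all nonfaulty parties eventually start, and with inputs that are externally valid (there is a set $V$ of proposals with $\mathsf{validate}:V\to\{0,1\}$, and $x$ is externally valid if $\mathsf{validate}(x)=1$). A message from a nonfaulty party was sent by it; messages from faulty parties are arbitrary. Enabled local steps of nonfaulty parties are eventually made. **Cryptography (perfect black boxes).** (i) A vector commitment that is correct and perfectly binding. (ii) A threshold VRF with its DKG, with finitely many possible transcripts. DKG shares $\mathsf{DKGSh}(\mathsf{sk}_i)$ verify under $\mathsf{pk}_i$; the aggregate of verifying shares of at least $2f+1$ parties is a transcript $d$ with $\mathsf{DKGVerify}(d)=1$. For verifying $d$: evaluation shares $\mathsf{EvalSh}(d,\mathsf{sk}_i,k)$ verify under $\mathsf{pk}_i$; $\mathsf{Eval}$ on verifying shares of at least $f+1$ parties gives a value with a verifying proof;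 and $\phi(d,k)\in\{0,\dots,2^\lambda-1\}$ is the only value with a verifying proof. Unbiasability: $\phi$ is a uniformly random function of (transcript, party index), and the adversary, which otherwise sees all messages and all local states, learns $\phi(d,k)$ only once a nonfaulty party has computed its share $\mathsf{EvalSh}(d,\cdot,k)$. **Broadcast.** "Broadcast" means the Bracha-type reliable broadcast with erasure coding: the message is encoded as a polynomial over a field, with $\lceil(\ell+1)/(f+1)\rceil$ evaluations per party if there are $\ell+1$ coefficients; the dealer commits to the vector of the parties' fragments and sends each party its opened fragment; parties forward it in an *echo* message; they send one *ready* message with their own recomputed fragment after $n-f$ verified echoes whose interpolation recommits to the same commitment, or after $f+1$ verified readies, and decode and output after $n-f$ verified readies (in a validated broadcast, only if the result is externally valid). **Protocol $\mathsf{PE}_i(\mathsf{prop}_i)$.** Party $i$ sends a fresh share $\mathsf{DKGSh}(\mathsf{sk}_i)$ to every party; after $n-f$ verifying shares it aggregates them into $d_i$ and calls $\mathsf{Gather}_i(\mathsf{prop}_i,d_i)$: * it broadcasts $\langle 1,(\mathsf{prop}_i,d_i)\rangle$, validated by $\mathsf{validate}(\mathsf{prop})=1\wedge\mathsf{DKGVerify}(d)=1$;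 on receiving $\langle 1,(\mathsf{prop}_j,d_j)\rangle$ from $j$ it adds $(j,\mathsf{prop}_j,d_j)$ to $R_i$ and $j$ to $S_i$, and broadcasts $\langle 2,S_i\rangle$ when $|S_i|=n-f$; * on $\langle 2,S_j\rangle$ from $j$ with $|S_j|\ge n-f$, once $S_j\subseteq S_i$, it adds $j$ to $T_i$, and broadcasts $\langle 3,T_i\rangle$ when $|T_i|=n-f$; * on $\langle 3,T_j\rangle$ from $j$ with $|T_j|\ge n-f$, once $T_j\subseteq T_i$, it adds $(j,\bigcup_{k\in T_j}S_k)$ to $U_i$, and when $|U_i|=n-f$ it outputs $X_i:=R_i$ from $\mathsf{Gather}$. $\mathsf{GatherVerify}_i(I)$ terminates when $|\{j:\exists (j,V_j)\in U_i,\ V_j\subseteq I\}|\ge n-f$ and $I\subseteq S_i$, with output $\{(j,x,d)\in R_i: j\in I\}$. After the output $X_i$ of $\mathsf{Gather}$, party $i$ broadcasts $\langle \mathit{indices},\mathrm{Indices}(X_i)\rangle$. When it has received an index set $I_j$ from $j$, $\mathsf{GatherVerify}_i(I_j)$ has terminated with output $X$, and $\mathsf{Gather}_i$ has given an output, it sends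 its evaluation share of $d_k$ on $k$ to all parties for each $(k,\mathsf{prop}_k,d_k)\in X\setminus\mathsf{start\_eval}_i$, and then adds $X$ to $\mathsf{start\_eval}_i$. For each $(k,\mathsf{prop}_k,d_k)\in\mathsf{start\_eval}_i$ it collects verifying evaluation shares (the first for $k$ from each party); with $n-f$ of them it computes $\mathsf{Eval}$ and adds $(k,\mathsf{evaluation}_k)$ to $\mathsf{evals}_i$. When $X_i\ne\emptyset$ and all evaluations for $X_i$ are in $\mathsf{evals}_i$, it outputs $(\mathsf{prop}_l,\pi_i)$, where $\pi_i=\mathrm{Indices}(X_i)$ and $l$ maximizes $\mathsf{evaluation}_l$ over $\pi_i$ (ties are broken by the smallest index). Parties keep updating their state afterwards. **$\mathsf{PEVerify}_i(x,\pi)$** terminates when for all $k\in\pi$ there are an evaluation of $k$ in $\mathsf{evals}_i$ and a tuple of $k$ in $\mathsf{start\_eval}_i$, $\mathsf{GatherVerify}_i(\pi)$ has terminated, and $x=\mathsf{prop}_l$ for the index $l\in\pi$ of maximal evaluation (same tie-breaking). **Theorem.** $(\mathsf{PE},\mathsf{PEVerify})$ is a verifiable proposal election protocol with $\alpha=\frac13$.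 That is, for every adversary strategy of the above kind and every value of the coins other than $\phi$: * *Termination of Output.* For every $\phi$, every party that is never corrupted outputs some pair $(x,\pi)$. * *Completeness.* If a party that is nonfaulty at that time has output $(x,\pi)$, then $\mathsf{PEVerify}_i(x,\pi)$ eventually terminates for every never corrupted $i$. * *Agreement on Verification.* If $\mathsf{PEVerify}_i(x,\pi)$ terminates for a party $i$ that is nonfaulty at that time, then $\mathsf{PEVerify}_j(x,\pi)$ eventually terminates for every never corrupted $j$. * *External Validity.* If $\mathsf{PEVerify}_i(x,\pi)$ terminates for a party $i$ nonfaulty at that time, then $\mathsf{validate}(x)=1$. * *Binding.* There is a random variable $x^*\in V\cup\{\bot\}$ (a function of $\phi$) such that (*Binding Verification*) whenever $x^*\neq\bot$ and $\mathsf{PEVerify}_i(x,\pi)$ terminates for a party $i$ nonfaulty at that time, $x=x^*$; and (*$\frac13$-Binding*) with probability at least $\frac13$ over $\phi$, $x^*$ is the input of a party that was nonfaulty when it started $\mathsf{PE}$. -/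

import Mathlib

/-!
Proposal election in an asynchronous network of `n` parties, an adaptive Byzantine adversary
corrupting at most `f` of them, and ideal ("perfect black box") cryptography.

Contents: the cryptographic interfaces (vector commitment, threshold VRF with its DKG), the
reliable broadcast protocol, the protocol `PE` (with `Gather` inside it), the verification
protocols, the execution model, and the properties of verifiable proposal election.
-/

noncomputable section

namespace ProposalElection

/-! ### Cryptographic interfaces -/

/-- A (perfectly binding) commitment scheme for vectors of length `n` with entries in `E`. -/
structure VectorCommitment (n : ℕ) (E : Type) where
  Com : Type
  Prf : Type
  commit : (Fin n → E) → Com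
  openProve : Com → (Fin n → E) → Fin n → Prf
  openVerify : Com → E → Fin n → Prf → Bool
  correct : ∀ v i, openVerify (commit v) (v i) i (openProve (commit v) v i) = true
  binding : ∀ c i v w p q, openVerify c v i p = true → openVerify c w i q = true → v = w

/-- A threshold VRF together with its (aggregatable) DKG and the key pairs of the PKI.

* Shares carry a description of the party that made them, so a set of shares is a finite set of
  pairs (party, share).
* Evaluations are `lam`-bit strings, read as numbers below `2 ^ lam`. The messages on which the
  function is evaluated are the party indices.
* The random function `φ` is not a field. It is an argument of the algorithms that compute or
  check full evaluations, and it is drawn uniformly at random; see `prob`, `Adversary`, `reveal`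
  for what the adversary learns about it (unbiasability). -/
structure ThresholdVRF (n f lam : ℕ) where
  SK : Type
  PK : Type
  /-- random coins of the probabilistic algorithms -/
  Coin : Type
  DkgShare : Type
  Dkg : Type
  EvalShare : Type
  ProofShare : Type
  Proof : Type
  /-- transcripts are strings of bounded length -/
  finiteDkg : Finite Dkg
  sk : Fin n → SK
  pk : Fin n → PK
  dkgSh : SK → Coin → DkgShare
  dkgShVerify : PK → DkgShare → Bool
  dkgAggregate : Finset (Fin n × DkgShare) → Dkg
  dkgVerify : Dkg → Bool
  evalSh : Dkg → SK → Fin n → Coin → EvalShare × ProofShare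
  evalShVerify : Dkg → PK → Fin n → EvalShare → ProofShare → Bool
  eval : (Dkg → Fin n → Fin (2 ^ lam)) → Dkg → Fin n →
    Finset (Fin n × EvalShare × ProofShare) → Fin (2 ^ lam) × Proof
  evalVerify : (Dkg → Fin n → Fin (2 ^ lam)) → Dkg → Fin n → Fin (2 ^ lam) → Proof → Bool
  /-- correctness of DKG shares -/
  dkgSh_correct : ∀ i r, dkgShVerify (pk i) (dkgSh (sk i) r) = true
  /-- correctness of aggregation: at least `2f+1` verifying shares give a verifying transcript -/
  dkgAggregate_correct : ∀ D : Finset (Fin n × DkgShare), 2 * f + 1 ≤ (D.image Prod.fst).card →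
    (∀ q ∈ D, dkgShVerify (pk q.1) q.2 = true) → dkgVerify (dkgAggregate D) = true
  /-- correctness of evaluation shares -/
  evalSh_correct : ∀ d i m r, dkgVerify d = true →
    evalShVerify d (pk i) m (evalSh d (sk i) m r).1 (evalSh d (sk i) m r).2 = true
  /-- correctness of evaluation from verifying shares of at least `f+1` parties -/
  eval_correct : ∀ φ d m (S : Finset (Fin n × EvalShare × ProofShare)), dkgVerify d = true →
    f + 1 ≤ (S.image Prod.fst).card →
    (∀ q ∈ S, evalShVerify d (pk q.1) m q.2.1 q.2.2 = true) →
    evalVerify φ d m (eval φ d m S).1 (eval φ d m S).2 = true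
  /-- uniqueness: the value of the function is the only one that has a verifying proof -/
  uniqueness : ∀ φ d m v, dkgVerify d = true →
    ((∃ p, evalVerify φ d m v p = true) ↔ v = φ d m)

/-! ### Reliable broadcast

Bracha's echo/ready protocol on Reed-Solomon fragments of the message, with a vector commitment
to the vector of all fragments. -/

/-- What the broadcast protocol needs in order to send messages from `M`: a field `F`, messages
encoded as the `len + 1` coefficients of a polynomial over `F`, for each of the `n` parties
`⌈(len+1)/(f+1)⌉` evaluation points (all points are distinct), and a vector commitment for the
vectors of the parties' fragments. -/
structure BroadcastCode (n f : ℕ) (M : Type) where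
  F : Type
  field : Field F
  len : ℕ
  enc : M → Fin (len + 1) → F
  enc_injective : Function.Injective enc
  point : Fin n × Fin ((len + 1) ⌈/⌉ (f + 1)) → F
  point_injective : Function.Injective point
  vc : VectorCommitment n (Fin ((len + 1) ⌈/⌉ (f + 1)) → F)

attribute [instance] BroadcastCode.field

section Broadcast

open Classical Polynomial

variable {n f : ℕ} {M : Type}

/-- A fragment: the values of a polynomial at the points of one party. -/
abbrev BroadcastCode.Frag (B : BroadcastCode n f M) : Type :=
  Fin ((B.len + 1) ⌈/⌉ (f + 1)) → B.F

/-- The polynomial whose coefficients are the encoded message. -/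
def BroadcastCode.poly (B : BroadcastCode n f M) (m : M) : B.F[X] :=
  ∑ k : Fin (B.len + 1), C (B.enc m k) * X ^ (k : ℕ)

def BroadcastCode.fragments (B : BroadcastCode n f M) (p : B.F[X]) : Fin n → B.Frag :=
  fun j k => p.eval (B.point (j, k))

/-- Some subset with `k` elements (the set itself if it is too small). -/
def pick {α : Type} (k : ℕ) (s : Finset α) : Finset α :=
  if h : k ≤ s.card then (Finset.exists_subset_card_eq h).choose else s

/-- Interpolate `len + 1` of the points in a collection of fragments. -/
def BroadcastCode.interpolate (B : BroadcastCode n f M) (g : Fin n → Option B.Frag) : B.F[X] :=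
  Lagrange.interpolate
    (pick (B.len + 1) (Finset.univ.filter
      fun q : Fin n × Fin ((B.len + 1) ⌈/⌉ (f + 1)) => (g q.1).isSome = true))
    B.point (fun q => ((g q.1).getD 0) q.2)

/-- The message with the coefficients of `p` as its encoding, if there is one. -/
def BroadcastCode.decode (B : BroadcastCode n f M) (p : B.F[X]) : Option M :=
  if h : ∃ m, ∀ k : Fin (B.len + 1), B.enc m k = p.coeff k then some h.choose else none

inductive RBMsg (B : BroadcastCode n f M) where
  | value (com : B.vc.Com) (frag : B.Frag) (prf : B.vc.Prf)
  | echo (com : B.vc.Com) (frag : B.Frag) (prf : B.vc.Prf)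
  | ready (com : B.vc.Com) (frag : B.Frag) (prf : B.vc.Prf)

/-- Local state of one party in one instance of the broadcast protocol. `echoes j` is the
commitment and fragment of the (first, verified) echo message from `j`; likewise `readies j`. -/
structure RBState (B : BroadcastCode n f M) where
  valueSeen : Bool
  echoSeen : Finset (Fin n)
  echoes : Fin n → Option (B.vc.Com × B.Frag)
  readySeen : Finset (Fin n)
  readies : Fin n → Option (B.vc.Com × B.Frag)
  readySent : Bool
  output : Option M

def RBState.init (B : BroadcastCode n f M) : RBState B where
  valueSeen := false
  echoSeen := ∅
  echoes := fun _ => none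
  readySeen := ∅
  readies := fun _ => none
  readySent := false
  output := none

/-- The fragments in `g` that came with the commitment `com`. -/
def fragsFor (B : BroadcastCode n f M) (g : Fin n → Option (B.vc.Com × B.Frag))
    (com : B.vc.Com) : Fin n → Option B.Frag :=
  fun j => (g j).bind fun q => if q.1 = com then some q.2 else none

/-- The number of parties whose fragment is present. -/
def countFrags {B : BroadcastCode n f M} (g : Fin n → Option B.Frag) : ℕ :=
  (Finset.univ.filter fun j => (g j).isSome = true).card

/-- The message that the dealer sends to party `j` in order to broadcast `m`. -/
def rbValue (B : BroadcastCode n f M) (m : M) (j : Fin n) : RBMsg B :=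
  let P := B.fragments (B.poly m)
  let com := B.vc.commit P
  .value com (P j) (B.vc.openProve com P j)

/-- Party `i` receives a message from `src` in the instance with dealer `dealer` and external
validity function `valid`. Returns the new state and the message, if any, that `i` sends to every
party. -/
def rbReceive (B : BroadcastCode n f M) (valid : M → Bool) (i dealer src : Fin n)
    (st : RBState B) : RBMsg B → RBState B × Option (RBMsg B)
  | .value com P prf =>
    if st.output.isSome = true ∨ src ≠ dealer ∨ st.valueSeen = true then (st, none) else
      ({ st with valueSeen := true },
        if B.vc.openVerify com P i prf = true then some (.echo com P prf) else none)
  | .echo com P prf =>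
    if st.output.isSome = true ∨ src ∈ st.echoSeen then (st, none) else
      let st₁ := { st with echoSeen := insert src st.echoSeen }
      if B.vc.openVerify com P src prf = true then
        let st₂ := { st₁ with echoes := Function.update st.echoes src (some (com, P)) }
        let g := fragsFor B st₂.echoes com
        let P' := B.fragments (B.interpolate g)
        if st.readySent = false ∧ n - f ≤ countFrags g ∧ B.vc.commit P' = com then
          ({ st₂ with readySent := true }, some (.ready com (P' i) (B.vc.openProve com P' i)))
        else (st₂, none)
      else (st₁, none)
  | .ready com P prf =>
    if st.output.isSome = true ∨ src ∈ st.readySeen then (st, none) else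
      let st₁ := { st with readySeen := insert src st.readySeen }
      if B.vc.openVerify com P src prf = true then
        let st₂ := { st₁ with readies := Function.update st.readies src (some (com, P)) }
        let g := fragsFor B st₂.readies com
        let p := B.interpolate g
        let P' := B.fragments p
        let send : Prop := st.readySent = false ∧ f + 1 ≤ countFrags g
        ({ st₂ with
            readySent := if send then true else st.readySent
            output := if n - f ≤ countFrags g then (B.decode p).filter valid else none },
          if send then some (.ready com (P' i) (B.vc.openProve com P' i)) else none)
      else (st₁, none)

end Broadcast

/-! ### The protocol -/

/-- The broadcasts that a party makes: its `Gather` input (validated), the sets of the second and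
third round of `Gather`, and the index set of its gather-set. -/
inductive Tag where
  | input
  | second
  | third
  | indices

/-- Contents of broadcasts: a proposal with a DKG transcript, or a set of parties. -/
inductive Payload (n : ℕ) (V D : Type) where
  | proposal (x : V) (d : D)
  | set (I : Finset (Fin n))

/-- The fixed data of the protocol: the external validity function on the domain `V` of
proposals, the threshold VRF, the coding used by the broadcasts, and the coins that nonfaulty
parties use in the probabilistic algorithms (party `i` uses `dkgCoin i j` for the DKG share it
sends to `j`, and `evalCoin i d k` for its evaluation share of `d` on the message `k`). -/
structure Setup (n f lam : ℕ) (V : Type) where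
  validate : V → Bool
  vrf : ThresholdVRF n f lam
  code : BroadcastCode n f (Payload n V vrf.Dkg)
  dkgCoin : Fin n → Fin n → vrf.Coin
  evalCoin : Fin n → vrf.Dkg → Fin n → vrf.Coin

section Protocol

open Classical

variable {n f lam : ℕ} {V : Type}

abbrev Setup.Load (P : Setup n f lam V) : Type := Payload n V P.vrf.Dkg

/-- A random function (one possible outcome). -/
abbrev Setup.Phi (P : Setup n f lam V) : Type := P.vrf.Dkg → Fin n → Fin (2 ^ lam)

/-- `(k, prop_k, vrf_dkg_k)` -/
abbrev Setup.Tuple (P : Setup n f lam V) : Type := Fin n × V × P.vrf.Dkg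

def checkValidity (P : Setup n f lam V) (x : V) (d : P.vrf.Dkg) : Bool :=
  P.validate x && P.vrf.dkgVerify d

/-- External validity function (and message domain) of the broadcasts with a given tag. -/
def loadValid (P : Setup n f lam V) : Tag → P.Load → Bool
  | .input, .proposal x d => checkValidity P x d
  | .input, .set _ => false
  | _, .proposal _ _ => false
  | _, .set _ => true

/-- Messages on the point-to-point channels: DKG shares, messages of the broadcast with dealer
`d` and tag `tag`, and evaluation shares. -/
inductive Msg (P : Setup n f lam V) where
  | dkg (s : P.vrf.DkgShare)
  | rb (d : Fin n) (tag : Tag) (m : RBMsg P.code)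
  | eval (k : Fin n) (es : P.vrf.EvalShare) (ps : P.vrf.ProofShare)

/-- Local state of a party. -/
structure PartyState (P : Setup n f lam V) where
  /-- the input to `PE`; `none` as long as the party has not started -/
  input : Option V
  dkgShares : Finset (Fin n × P.vrf.DkgShare)
  /-- has the party called `Gather`? -/
  gatherCalled : Bool
  rb : Fin n → Tag → RBState P.code
  R : Finset P.Tuple
  S : Finset (Fin n)
  T : Finset (Fin n)
  U : Finset (Fin n × Finset (Fin n))
  /-- the gather-set `X_i` output by `Gather` -/
  gatherOut : Option (Finset P.Tuple)
  /-- the parties whose index set has been handled -/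
  indicesDone : Finset (Fin n)
  startEval : Finset P.Tuple
  /-- `evalMsg j k`: the first evaluation share for `k` received from `j` -/
  evalMsg : Fin n → Fin n → Option (P.vrf.EvalShare × P.vrf.ProofShare)
  /-- the pairs `(j, k)` for which that share has been handled -/
  evalDone : Finset (Fin n × Fin n)
  evalShares : Fin n → Finset (Fin n × P.vrf.EvalShare × P.vrf.ProofShare)
  evals : Finset (Fin n × Fin (2 ^ lam))
  /-- the output of `PE` -/
  out : Option (V × Finset (Fin n))

def PartyState.init (P : Setup n f lam V) : PartyState P where
  input := none
  dkgShares := ∅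
  gatherCalled := false
  rb := fun _ _ => RBState.init P.code
  R := ∅
  S := ∅
  T := ∅
  U := ∅
  gatherOut := none
  indicesDone := ∅
  startEval := ∅
  evalMsg := fun _ _ => none
  evalDone := ∅
  evalShares := fun _ => ∅
  evals := ∅
  out := none

/-- The index set of a gather-set. -/
def indexSet {P : Setup n f lam V} (X : Finset P.Tuple) : Finset (Fin n) := X.image Prod.fst

/-- The condition on which `GatherVerify_i(I)` terminates. -/
def GatherVerify {P : Setup n f lam V} (st : PartyState P) (I : Finset (Fin n)) : Prop :=
  n - f ≤ ((st.U.filter fun q => q.2 ⊆ I).image Prod.fst).card ∧ I ⊆ st.S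

/-- The output of `GatherVerify_i(I)` on termination. -/
def gatherVerifyOut {P : Setup n f lam V} (st : PartyState P) (I : Finset (Fin n)) :
    Finset P.Tuple :=
  st.R.filter fun q => q.1 ∈ I

/-- `l = argmax {evaluation_k | k ∈ I}`; ties are broken in favour of the smallest index. -/
def IsArgmax (evals : Finset (Fin n × Fin (2 ^ lam))) (I : Finset (Fin n)) (l : Fin n) : Prop :=
  l ∈ I ∧ ∃ e, (l, e) ∈ evals ∧
    ∀ k ∈ I, ∀ e', (k, e') ∈ evals → e' < e ∨ (e' = e ∧ l ≤ k)

/-- The condition on which `PEVerify_i(x, π)` terminates. Conditions that have become true at a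
nonfaulty party stay true, so the nested waiting of the protocol is a conjunction. -/
def PEVerify {P : Setup n f lam V} (st : PartyState P) (x : V) (π : Finset (Fin n)) : Prop :=
  (∀ k ∈ π, (∃ e, (k, e) ∈ st.evals) ∧ ∃ y d, (k, y, d) ∈ st.startEval) ∧
  GatherVerify st π ∧
  ∃ l, IsArgmax st.evals π l ∧ ∃ d, (l, x, d) ∈ st.startEval

/-- What an atomic step of a party does: its new state, the messages it sends (with their
destinations), and the points `(d, k)` for which it computes its evaluation share. -/
structure Effect (P : Setup n f lam V) where
  state : PartyState P
  sends : Set (Fin n × Msg P) := ∅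
  evaluates : Set (P.vrf.Dkg × Fin n) := ∅

def toAll {P : Setup n f lam V} (m : Msg P) : Set (Fin n × Msg P) := {q | q.2 = m}

/-- Party `i` starts its broadcast with the given tag. -/
def rbStart {P : Setup n f lam V} (i : Fin n) (tag : Tag) (m : P.Load) : Set (Fin n × Msg P) :=
  {q | q.2 = .rb i tag (rbValue P.code m q.1)}

/-- Party `i` starts `PE` with input `x`: it sends a DKG share to every party. -/
def startEffect {P : Setup n f lam V} (i : Fin n) (x : V) (st : PartyState P) : Effect P where
  state := { st with input := some x }
  sends := {q | q.2 = .dkg (P.vrf.dkgSh (P.vrf.sk i) (P.dkgCoin i q.1))}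

/-- Party `i` receives a message from `src`. -/
def receiveEffect {P : Setup n f lam V} (i src : Fin n) (st : PartyState P) : Msg P → Effect P
  | .dkg s =>
    if src ∈ st.dkgShares.image Prod.fst ∨ P.vrf.dkgShVerify (P.vrf.pk src) s = false then
      { state := st }
    else
      let D := insert (src, s) st.dkgShares
      match st.input with
      | none => { state := st }
      | some x =>
        if D.card = n - f then
          { state := { st with dkgShares := D, gatherCalled := true }
            sends := rbStart i .input (.proposal x (P.vrf.dkgAggregate D)) }
        else { state := { st with dkgShares := D } }
  | .rb d tag m =>
    let r := rbReceive P.code (loadValid P tag) i d src (st.rb d tag) m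
    { state := { st with rb := Function.update st.rb d (Function.update (st.rb d) tag r.1) }
      sends := match r.2 with
        | none => ∅
        | some m' => toAll (.rb d tag m') }
  | .eval k es ps =>
    if st.evalMsg src k = none then
      let msgs := Function.update (st.evalMsg src) k (some (es, ps))
      { state := { st with evalMsg := Function.update st.evalMsg src msgs } }
    else { state := st }

/-- The set broadcast by `k` in the second round of `Gather`, as received by the party. -/
def secondSet {P : Setup n f lam V} (st : PartyState P) (k : Fin n) : Finset (Fin n) :=
  match (st.rb k .second).output with
  | some (.set A) => A
  | _ => ∅

/-- The internal steps of a party (the bodies of its `upon` clauses). -/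
inductive Rule (P : Setup n f lam V) where
  /-- `⟨1, (x, d)⟩` is received from `j` -/
  | gatherInput (j : Fin n) (x : V) (d : P.vrf.Dkg)
  /-- `⟨2, A⟩` is received from `j`, and `A ⊆ S_i` -/
  | gatherSecond (j : Fin n) (A : Finset (Fin n))
  /-- `⟨3, A⟩` is received from `j`, and `A ⊆ T_i` -/
  | gatherThird (j : Fin n) (A : Finset (Fin n))
  /-- `⟨indices, I⟩` is received from `j`, `GatherVerify_i(I)` has terminated and `Gather_i` has
  given an output -/
  | evaluate (j : Fin n) (I : Finset (Fin n))
  /-- an evaluation share for `k` is received from `j`, and `(k, x, d)` is in `startEval` -/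
  | addShare (j k : Fin n) (x : V) (d : P.vrf.Dkg)
  /-- all evaluations for `X_i` are known; `x` is the proposal of the maximal index `l` -/
  | output (l : Fin n) (x : V)

/-- When is an internal step enabled? -/
def Enabled {P : Setup n f lam V} (st : PartyState P) : Rule P → Prop
  | .gatherInput j x d => st.gatherCalled = true ∧
      (st.rb j .input).output = some (.proposal x d) ∧ j ∉ st.S
  | .gatherSecond j A => st.gatherCalled = true ∧
      (st.rb j .second).output = some (.set A) ∧ n - f ≤ A.card ∧ A ⊆ st.S ∧ j ∉ st.T
  | .gatherThird j A => st.gatherCalled = true ∧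
      (st.rb j .third).output = some (.set A) ∧ n - f ≤ A.card ∧ A ⊆ st.T ∧
      j ∉ st.U.image Prod.fst
  | .evaluate j I => (st.rb j .indices).output = some (.set I) ∧ GatherVerify st I ∧
      st.gatherOut ≠ none ∧ j ∉ st.indicesDone
  | .addShare j k x d => st.evalMsg j k ≠ none ∧ (k, x, d) ∈ st.startEval ∧ (j, k) ∉ st.evalDone
  | .output l x => st.out = none ∧ ∃ X, st.gatherOut = some X ∧ X ≠ ∅ ∧
      (∀ q ∈ X, ∃ e, (q.1, e) ∈ st.evals) ∧ IsArgmax st.evals (indexSet X) l ∧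
      ∃ d, (l, x, d) ∈ X

/-- Party `i` executes an enabled internal step. -/
def ruleEffect {P : Setup n f lam V} (φ : P.Phi) (i : Fin n) (st : PartyState P) :
    Rule P → Effect P
  | .gatherInput j x d =>
    let S' := insert j st.S
    { state := { st with R := insert (j, x, d) st.R, S := S' }
      sends := if S'.card = n - f then rbStart i .second (.set S') else ∅ }
  | .gatherSecond j _ =>
    let T' := insert j st.T
    { state := { st with T := T' }
      sends := if T'.card = n - f then rbStart i .third (.set T') else ∅ }
  | .gatherThird j A =>
    let U' := insert (j, A.biUnion (secondSet st)) st.U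
    if U'.card = n - f then
      { state := { st with U := U', gatherOut := some st.R }
        sends := rbStart i .indices (.set (indexSet st.R)) }
    else { state := { st with U := U' } }
  | .evaluate j I =>
    let X := gatherVerifyOut st I
    let new := X \ st.startEval
    { state := { st with startEval := st.startEval ∪ X, indicesDone := insert j st.indicesDone }
      sends := {q | ∃ k x d, (k, x, d) ∈ new ∧ q.2 = .eval k
        (P.vrf.evalSh d (P.vrf.sk i) k (P.evalCoin i d k)).1
        (P.vrf.evalSh d (P.vrf.sk i) k (P.evalCoin i d k)).2}
      evaluates := {q | ∃ x, (q.2, x, q.1) ∈ new} }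
  | .addShare j k _ d =>
    let st₁ := { st with evalDone := insert (j, k) st.evalDone }
    match st.evalMsg j k with
    | none => { state := st₁ }
    | some (es, ps) =>
      if P.vrf.evalShVerify d (P.vrf.pk j) k es ps = true then
        let F := insert (j, es, ps) (st.evalShares k)
        { state := { st₁ with
            evalShares := Function.update st.evalShares k F
            evals := if F.card = n - f then insert (k, (P.vrf.eval φ d k F).1) st.evals
              else st.evals } }
      else { state := st₁ }
  | .output _ x =>
    match st.gatherOut with
    | none => { state := st }
    | some X => { state := { st with out := some (x, indexSet X) } }

/-! ### Executions -/

/-- A global configuration. Channels are modelled by the set of all messages `(src, dst, m)` sent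
so far by parties following the protocol; `opened` is the set of all points `(d, k)` for which
some party has computed its evaluation share while it was nonfaulty. -/
structure Config (P : Setup n f lam V) where
  party : Fin n → PartyState P
  faulty : Finset (Fin n)
  sent : Set (Fin n × Fin n × Msg P)
  opened : Set (P.vrf.Dkg × Fin n)

def Config.init (P : Setup n f lam V) : Config P where
  party := fun _ => PartyState.init P
  faulty := ∅
  sent := ∅
  opened := ∅

/-- The possible actions of the adversary, which schedules everything. -/
inductive Action (P : Setup n f lam V) where
  | corrupt (i : Fin n)
  | start (i : Fin n) (x : V)
  | deliver (src dst : Fin n) (m : Msg P)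
  | local (i : Fin n) (r : Rule P)

/-- Which actions are possible in a configuration? At most `f` parties can be corrupted. A
nonfaulty party is started at most once, with an externally valid input. Messages are delivered to
nonfaulty parties that have started; a message from a nonfaulty party must have been sent by it,
and messages from faulty parties are arbitrary. -/
def Legal {P : Setup n f lam V} (c : Config P) : Action P → Prop
  | .corrupt _ => c.faulty.card < f
  | .start i x => i ∉ c.faulty ∧ (c.party i).input = none ∧ P.validate x = true
  | .deliver src dst m => dst ∉ c.faulty ∧ (c.party dst).input ≠ none ∧
      (src ∈ c.faulty ∨ (src, dst, m) ∈ c.sent)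
  | .local i r => i ∉ c.faulty ∧ Enabled (c.party i) r

/-- Party `i` makes an atomic step. -/
def Config.apply {P : Setup n f lam V} (c : Config P) (i : Fin n) (e : Effect P) : Config P where
  party := Function.update c.party i e.state
  faulty := c.faulty
  sent := c.sent ∪ {q | q.1 = i ∧ q.2 ∈ e.sends}
  opened := c.opened ∪ e.evaluates

/-- The next configuration. Actions that are not legal have no effect. -/
def Config.step {P : Setup n f lam V} (φ : P.Phi) (c : Config P) (a : Action P) : Config P :=
  if Legal c a then
    match a with
    | .corrupt i => { c with faulty := insert i c.faulty }
    | .start i x => c.apply i (startEffect i x (c.party i))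
    | .deliver src dst m => c.apply dst (receiveEffect dst src (c.party dst) m)
    | .local i r => c.apply i (ruleEffect φ i (c.party i) r)
  else c

/-- What the adversary knows about the random function: its values at the points for which some
nonfaulty party has computed an evaluation share, and nothing else. -/
def reveal {P : Setup n f lam V} (φ : P.Phi) (c : Config P) :
    P.vrf.Dkg → Fin n → Option (Fin (2 ^ lam)) :=
  fun d k => if (d, k) ∈ c.opened then some (φ d k) else none

/-- An adversary strategy. It sees the whole history of configurations (latest first), hence all
messages and all local states, and the values of the random function revealed so far. -/
abbrev Adversary (P : Setup n f lam V) : Type :=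
  List (Config P) → (P.vrf.Dkg → Fin n → Option (Fin (2 ^ lam))) → Action P

/-- The configuration at time `t`, and the list of the earlier ones. -/
def exec {P : Setup n f lam V} (A : Adversary P) (φ : P.Phi) : ℕ → Config P × List (Config P)
  | 0 => (Config.init P, [])
  | t + 1 =>
    let c := (exec A φ t).1
    let h := c :: (exec A φ t).2
    (c.step φ (A h (reveal φ c)), h)

/-- The configuration at time `t` when the random function is `φ`. -/
def config {P : Setup n f lam V} (A : Adversary P) (φ : P.Phi) (t : ℕ) : Config P :=
  (exec A φ t).1

/-- The action chosen at time `t`. -/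
def action {P : Setup n f lam V} (A : Adversary P) (φ : P.Phi) (t : ℕ) : Action P :=
  A (config A φ t :: (exec A φ t).2) (reveal φ (config A φ t))

/-- Party `i` is never corrupted. -/
def Nonfaulty {P : Setup n f lam V} (A : Adversary P) (φ : P.Phi) (i : Fin n) : Prop :=
  ∀ t, i ∉ (config A φ t).faulty

/-- The asynchronous network: all nonfaulty parties start, every message between nonfaulty parties
arrives in finite time, and nonfaulty parties do not postpone an enabled step forever. -/
structure Fair {P : Setup n f lam V} (A : Adversary P) (φ : P.Phi) : Prop where
  starts : ∀ i, Nonfaulty A φ i → ∃ t, ((config A φ t).party i).input ≠ none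
  delivers : ∀ i j m t, Nonfaulty A φ i → Nonfaulty A φ j → (i, j, m) ∈ (config A φ t).sent →
    ∃ t', action A φ t' = .deliver i j m ∧ Legal (config A φ t') (.deliver i j m)
  progress : ∀ i r t, Nonfaulty A φ i → Enabled ((config A φ t).party i) r →
    ∃ t', t ≤ t' ∧ (action A φ t' = .local i r ∨ ¬ Enabled ((config A φ t').party i) r)

/-- `PEVerify_i(x, π)` terminates at party `i`, nonfaulty at that time. -/
def VerifiedAt {P : Setup n f lam V} (A : Adversary P) (φ : P.Phi) (t : ℕ) (i : Fin n) (x : V)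
    (π : Finset (Fin n)) : Prop :=
  i ∉ (config A φ t).faulty ∧ PEVerify ((config A φ t).party i) x π

/-- Party `i` was nonfaulty when it started `PE`, and started it with input `x`. -/
def StartedWith {P : Setup n f lam V} (A : Adversary P) (φ : P.Phi) (i : Fin n) (x : V) : Prop :=
  ∃ t, i ∉ (config A φ t).faulty ∧ ((config A φ t).party i).input = none ∧
    ((config A φ (t + 1)).party i).input = some x

instance (P : Setup n f lam V) : Finite P.vrf.Dkg := P.vrf.finiteDkg

instance (P : Setup n f lam V) : Fintype P.Phi := Fintype.ofFinite _

/-- Probability of an event when the random function is drawn uniformly. All other coins (those in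
`P`, and those of a randomized adversary) are fixed; a lower bound that holds for all values of
these coins holds for every distribution of them that is independent of the random function. -/
def prob (P : Setup n f lam V) (E : Set P.Phi) : ENNReal :=
  (PMF.uniformOfFintype P.Phi).toOuterMeasure E

/-- The properties of a verifiable proposal election protocol with parameter `α`, for the protocol
`(PE, PEVerify)` run against the adversary strategy `A`. -/
structure IsVerifiableProposalElection {P : Setup n f lam V} (A : Adversary P) (α : ENNReal) :
    Prop where
  /-- Termination of Output -/
  termination : ∀ φ i, Nonfaulty A φ i → ∃ t x π, ((config A φ t).party i).out = some (x, π)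
  /-- Completeness -/
  completeness : ∀ φ i j t x π, Nonfaulty A φ i → j ∉ (config A φ t).faulty →
    ((config A φ t).party j).out = some (x, π) → ∃ t', VerifiedAt A φ t' i x π
  /-- Agreement on Verification -/
  agreement : ∀ φ i j t x π, VerifiedAt A φ t i x π → Nonfaulty A φ j →
    ∃ t', VerifiedAt A φ t' j x π
  /-- External Validity -/
  externalValidity : ∀ φ i t x π, VerifiedAt A φ t i x π → P.validate x = true
  /-- Binding: there is a binding value `xstar` (`none` stands for `⊥`) that satisfies Binding
  Verification and `α`-Binding -/
  binding : ∃ xstar : P.Phi → Option V,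
    (∀ φ y, xstar φ = some y → ∀ i t x π, VerifiedAt A φ t i x π → x = y) ∧
    α ≤ prob P {φ | ∃ i y, xstar φ = some y ∧ StartedWith A φ i y}

end Protocol

end ProposalElection

end

/-!
Why `PE` is a verifiable proposal election protocol.

*Broadcast.* A ready message of a party following the protocol is backed by `n - f` echoes for its
commitment: directly, or through an earlier ready message. Two sets of `n - f` parties share a
party that is not corrupted and echoes once, so all ready messages carry the same commitment
(`RBSafe.certified_unique`), and because the commitment is binding, it determines the polynomial
(`Committed.unique`). This gives agreement, integrity and, together with the amplification of ready
messages, totality and validity of every broadcast (`RBRun`). Each pair of a dealer and a tag,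
seen inside an execution of the protocol, is such a broadcast (`rbRun`).

*Termination, completeness, agreement.* What a party has received by broadcast is therefore the
same for all parties, and what one party has received everybody receives. The sets `S`, `T`, `U`,
`startEval` and `evals` are built from such data only, so whatever one party has put into them,
every never corrupted party puts into them eventually. By the uniqueness of the threshold VRF the
evaluations found are the values of the random function `φ`, and `PEVerify` becomes a condition
that is transferred from one party to all others (`EvalInv.peVerify_iff`, `eventually_verifies`).

*Binding.* When `Gather` gives an output, double counting yields a set `B` of `n - f` indices,
the core, that is contained in the sets of `f + 1` pairs in `U` (`exists_isCore`). By quorum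
intersection `B` is contained in every index set that ever passes `GatherVerify`
(`IsCore.subset`). At the first time when some evaluation share has been computed, a core exists,
but the execution up to that time does not depend on `φ` (`exists_time`). So the core, and the set
`L` of its at least `n - 2 * f` indices that are nonfaulty at that time, are fixed in advance.

The execution depends only on the values of `φ` at opened points (`exec_succ_congr`), and in each
column `k` at most one point `(d, k)` is ever opened (`opened_unique`). Which point this is may
depend on other values of `φ`, but the selected values are uniformly distributed all the same: a
vector `w` occurs exactly if `φ` agrees with `w` at the points selected in the run where the
values in column `k` are all `w k`, and these are fixed points (`card_selected`).
Hence the event that the largest selected value is attained only once, at an index `l` in `L`, has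
probability `|L| * ∑ v < N, v ^ (n - 1) / N ^ n` with `N = 2 ^ lam`, which is at least `1/3`
because `N ≥ n ^ 3` and `3 * |L| ≥ n + 2` (`pow_le_three_mul`). In this event every verified index
set contains `l`, so every verified proposal is that of `l`, which is the input of a party that was
nonfaulty when it started (`IsCore.eq_of_verifiedAt`, `input_eq_of_mem_R`).
-/

noncomputable section

namespace ProposalElection

open Classical Polynomial Filter

/-! ### Interpolation of fragments -/

section Fragments

variable {n f : ℕ} {M : Type} {B : BroadcastCode n f M}

/-- `com` is the commitment to the fragments of `p`, a polynomial of admissible degree. -/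
def Committed (B : BroadcastCode n f M) (com : B.vc.Com) (p : B.F[X]) : Prop :=
  p.degree < ((B.len + 1 : ℕ) : WithBot ℕ) ∧ B.vc.commit (B.fragments p) = com

lemma Committed.openVerify {com : B.vc.Com} {p : B.F[X]} (h : Committed B com p) (j : Fin n) :
    B.vc.openVerify com (B.fragments p j) j (B.vc.openProve com (B.fragments p) j) = true := by
  have := B.vc.correct (B.fragments p) j
  rwa [h.2] at this

lemma Committed.frag_eq {com : B.vc.Com} {p : B.F[X]} (h : Committed B com p) {j : Fin n}
    {P : B.Frag} {prf : B.vc.Prf} (hv : B.vc.openVerify com P j prf = true) :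
    P = B.fragments p j :=
  B.vc.binding _ _ _ _ _ _ hv (h.openVerify j)

lemma coeff_poly (m : M) (k : Fin (B.len + 1)) : (B.poly m).coeff k = B.enc m k := by
  unfold BroadcastCode.poly
  rw [finsetSum_coeff, Finset.sum_eq_single k]
  · simp
  · intro b _ hb
    rw [coeff_C_mul, coeff_X_pow, if_neg (fun h => hb (Fin.ext h.symm)), mul_zero]
  · simp

lemma degree_poly_lt (m : M) : (B.poly m).degree < ((B.len + 1 : ℕ) : WithBot ℕ) := by
  unfold BroadcastCode.poly
  refine (degree_sum_le _ _).trans_lt ((Finset.sup_lt_iff (WithBot.bot_lt_coe _)).2 fun k _ => ?_)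
  exact (degree_C_mul_X_pow_le _ _).trans_lt (by exact_mod_cast k.2)

lemma committed_poly (m : M) : Committed B (B.vc.commit (B.fragments (B.poly m))) (B.poly m) :=
  ⟨degree_poly_lt m, rfl⟩

lemma decode_poly (m : M) : B.decode (B.poly m) = some m := by
  unfold BroadcastCode.decode
  have h : ∃ m', ∀ k : Fin (B.len + 1), B.enc m' k = (B.poly m).coeff k :=
    ⟨m, fun k => (coeff_poly m k).symm⟩
  rw [dif_pos h]
  exact congrArg some (B.enc_injective (funext fun k => (h.choose_spec k).trans (coeff_poly m k)))

lemma pick_subset {α : Type} (k : ℕ) (s : Finset α) : pick k s ⊆ s := by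
  unfold pick
  split
  · next h => exact (Finset.exists_subset_card_eq h).choose_spec.1
  · exact subset_rfl

lemma card_pick {α : Type} {k : ℕ} {s : Finset α} (h : k ≤ s.card) : (pick k s).card = k := by
  unfold pick
  rw [dif_pos h]
  exact (Finset.exists_subset_card_eq h).choose_spec.2

/-- The fragments of `f + 1` parties contain at least `len + 1` evaluations. -/
lemma le_card_points {g : Fin n → Option B.Frag} (h : f + 1 ≤ countFrags g) :
    B.len + 1 ≤ (Finset.univ.filter
      fun q : Fin n × Fin ((B.len + 1) ⌈/⌉ (f + 1)) => (g q.1).isSome = true).card := by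
  have e : (Finset.univ.filter
      fun q : Fin n × Fin ((B.len + 1) ⌈/⌉ (f + 1)) => (g q.1).isSome = true) =
      (Finset.univ.filter fun j => (g j).isSome = true) ×ˢ Finset.univ := by
    ext q; simp
  rw [e, Finset.card_product, Finset.card_univ, Fintype.card_fin]
  calc B.len + 1 ≤ (f + 1) * ((B.len + 1) ⌈/⌉ (f + 1)) := by
        simpa using le_smul_ceilDiv (a := f + 1) (b := B.len + 1) (Nat.succ_pos f)
    _ ≤ _ := Nat.mul_le_mul_right _ h

lemma degree_interpolate_lt {g : Fin n → Option B.Frag} (h : f + 1 ≤ countFrags g) :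
    (B.interpolate g).degree < ((B.len + 1 : ℕ) : WithBot ℕ) := by
  have := Lagrange.degree_interpolate_lt (s := pick (B.len + 1) (Finset.univ.filter
      fun q : Fin n × Fin ((B.len + 1) ⌈/⌉ (f + 1)) => (g q.1).isSome = true))
    (v := B.point) (fun q => ((g q.1).getD 0) q.2) B.point_injective.injOn
  rwa [card_pick (le_card_points h)] at this

/-- A polynomial of admissible degree is recovered from its fragments for any `f + 1` parties. -/
lemma interpolate_eq {g : Fin n → Option B.Frag} {p : B.F[X]}
    (hp : p.degree < ((B.len + 1 : ℕ) : WithBot ℕ)) (h : f + 1 ≤ countFrags g)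
    (hg : ∀ j P, g j = some P → P = B.fragments p j) : B.interpolate g = p := by
  refine (Lagrange.eq_interpolate_of_eval_eq _ B.point_injective.injOn ?_ ?_).symm
  · rwa [card_pick (le_card_points h)]
  · intro q hq
    have hq' := (Finset.mem_filter.1 (pick_subset _ _ hq)).2
    obtain ⟨P, hP⟩ := Option.isSome_iff_exists.1 hq'
    rw [hP, Option.getD_some, hg _ _ hP]
    rfl

lemma fragsFor_eq_some {g : Fin n → Option (B.vc.Com × B.Frag)} {com : B.vc.Com} {j : Fin n}
    {P : B.Frag} : fragsFor B g com j = some P ↔ g j = some (com, P) := by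
  unfold fragsFor
  rcases g j with _ | ⟨c, Q⟩
  · simp
  · by_cases h : c = com <;> simp [h]

lemma fragsFor_update_of_ne {g : Fin n → Option (B.vc.Com × B.Frag)} {com com' : B.vc.Com}
    {j : Fin n} {P : B.Frag} (hj : g j = none) (h : com ≠ com') :
    fragsFor B (Function.update g j (some (com, P))) com' = fragsFor B g com' := by
  funext k
  by_cases hk : k = j
  · subst hk; simp [fragsFor, hj, h]
  · simp [fragsFor, hk]

lemma card_le_countFrags {g : Fin n → Option B.Frag} (Q : Finset (Fin n))
    (h : ∀ j ∈ Q, ∃ P, g j = some P) : Q.card ≤ countFrags g := by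
  refine Finset.card_le_card fun j hj => ?_
  obtain ⟨P, hP⟩ := h j hj
  simp [hP]

/-- If `f + 1` opened fragments belong to the commitment of `p`, they interpolate to `p`. -/
lemma Committed.interpolate_eq {com : B.vc.Com} {p : B.F[X]} (hc : Committed B com p)
    {g : Fin n → Option (B.vc.Com × B.Frag)} (h : f + 1 ≤ countFrags (fragsFor B g com))
    (hg : ∀ j P, g j = some (com, P) → ∃ prf, B.vc.openVerify com P j prf = true) :
    B.interpolate (fragsFor B g com) = p :=
  ProposalElection.interpolate_eq hc.1 h fun j P hP => by
    obtain ⟨prf, hv⟩ := hg j P (fragsFor_eq_some.1 hP)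
    exact hc.frag_eq hv

/-- Because commitments are binding, a commitment determines the polynomial. -/
lemma Committed.unique {com : B.vc.Com} {p q : B.F[X]} (hfn : f < n) (hp : Committed B com p)
    (hq : Committed B com q) : p = q := by
  let g : Fin n → Option B.Frag := fun j => some (B.fragments p j)
  have hcount : f + 1 ≤ countFrags g := by simpa [countFrags, g] using hfn
  rw [← ProposalElection.interpolate_eq hp.1 hcount (fun j P h => by simpa [g] using h.symm)]
  refine ProposalElection.interpolate_eq hq.1 hcount fun j P h => ?_
  have h' : P = B.fragments p j := by simpa [g] using h.symm
  rw [h', ← hq.frag_eq (hp.openVerify j)]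

end Fragments

/-! ### One party in one broadcast -/

section Local

variable {n f : ℕ} {M : Type} {B : BroadcastCode n f M}

/-- Invariants of the local state of a party in a broadcast: the thresholds for sending a ready
message and for giving an output have not been passed without doing so, and an output is backed
by `n - f` ready messages. -/
structure RBInv (valid : M → Bool) (st : RBState B) : Prop where
  echo_seen : ∀ j, j ∉ st.echoSeen → st.echoes j = none
  ready_seen : ∀ j, j ∉ st.readySeen → st.readies j = none
  echo_quorum : ∀ com, n - f ≤ countFrags (fragsFor B st.echoes com) →
    B.vc.commit (B.fragments (B.interpolate (fragsFor B st.echoes com))) = com →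
    st.readySent = true
  ready_amplify : ∀ com, f + 1 ≤ countFrags (fragsFor B st.readies com) → st.readySent = true
  ready_output : ∀ com m, n - f ≤ countFrags (fragsFor B st.readies com) →
    B.decode (B.interpolate (fragsFor B st.readies com)) = some m → valid m = true →
    st.output.isSome = true
  output_ready : ∀ m, st.output = some m → st.readySent = true ∧ valid m = true ∧
    ∃ com, n - f ≤ countFrags (fragsFor B st.readies com) ∧
      B.decode (B.interpolate (fragsFor B st.readies com)) = some m

lemma countFrags_fragsFor_none (com : B.vc.Com) :
    countFrags (fragsFor B (fun _ => none) com) = 0 := by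
  simp [countFrags, fragsFor]

lemma RBInv.init (hf : f < n) (valid : M → Bool) : RBInv valid (RBState.init B) where
  echo_seen _ _ := rfl
  ready_seen _ _ := rfl
  echo_quorum com h _ := by
    rw [RBState.init, countFrags_fragsFor_none] at h; omega
  ready_amplify com h := by
    rw [RBState.init, countFrags_fragsFor_none] at h; omega
  ready_output com m h _ _ := by
    rw [RBState.init, countFrags_fragsFor_none] at h; omega
  output_ready m h := by simp [RBState.init] at h

lemma RBInv.receive (hf : 3 * f < n) {valid : M → Bool} {st : RBState B} (h : RBInv valid st)
    (i d src : Fin n) (m : RBMsg B) : RBInv valid (rbReceive B valid i d src st m).1 := by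
  cases m with
  | value com P prf =>
    simp only [rbReceive]
    split
    · exact h
    · exact ⟨h.1, h.2, h.3, h.4, h.5, h.6⟩
  | echo com P prf =>
    simp only [rbReceive]
    split
    · exact h
    rename_i hn
    push Not at hn
    have hnone := h.echo_seen src hn.2
    have hout : st.output = none := by simpa using hn.1
    have hs : ∀ j, j ∉ insert src st.echoSeen → j ≠ src ∧ j ∉ st.echoSeen := by
      intro j hj; simpa using hj
    split
    -- For a commitment other than `com` the collection of fragments has not changed.
    · have key : ∀ com', com ≠ com' →
          n - f ≤ countFrags (fragsFor B (Function.update st.echoes src (some (com, P))) com') →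
          B.vc.commit (B.fragments (B.interpolate
            (fragsFor B (Function.update st.echoes src (some (com, P))) com'))) = com' →
          st.readySent = true := by
        intro com' hc h1 h2
        rw [fragsFor_update_of_ne hnone hc] at h1 h2
        exact h.echo_quorum com' h1 h2
      have hseen : ∀ j, j ∉ insert src st.echoSeen →
          Function.update st.echoes src (some (com, P)) j = none := by
        intro j hj
        rw [Function.update_of_ne (hs j hj).1]
        exact h.echo_seen j (hs j hj).2
      split
      · exact ⟨hseen, h.2, fun _ _ _ => rfl, fun _ _ => rfl, h.5,
          fun m hm => by simp [hout] at hm⟩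
      · rename_i hns
        refine ⟨hseen, h.2, fun com' h1 h2 => ?_, h.4, h.5, h.6⟩
        by_cases hc : com = com'
        · subst hc
          by_contra hr
          exact hns ⟨by simpa using hr, h1, h2⟩
        · exact key com' hc h1 h2
    · exact ⟨fun j hj => h.1 j (hs j hj).2, h.2, h.3, h.4, h.5, h.6⟩
  | ready com P prf =>
    simp only [rbReceive]
    split
    · exact h
    rename_i hn
    push Not at hn
    have hnone := h.ready_seen src hn.2
    have hout : st.output = none := by simpa using hn.1
    have hs : ∀ j, j ∉ insert src st.readySeen → j ≠ src ∧ j ∉ st.readySeen := by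
      intro j hj; simpa using hj
    split
    · have hsent : f + 1 ≤ countFrags
          (fragsFor B (Function.update st.readies src (some (com, P))) com) →
          (if st.readySent = false ∧ f + 1 ≤ countFrags
            (fragsFor B (Function.update st.readies src (some (com, P))) com) then true
            else st.readySent) = true := by
        intro hc
        split
        · rfl
        · rename_i hh
          by_contra hr
          exact hh ⟨by simpa using hr, hc⟩
      have hmono : st.readySent = true →
          (if st.readySent = false ∧ f + 1 ≤ countFrags
            (fragsFor B (Function.update st.readies src (some (com, P))) com) then true
            else st.readySent) = true := by
        intro hc; simp [hc]
      refine ⟨h.1, ?_, fun com' h1 h2 => hmono (h.3 com' h1 h2), ?_, ?_, ?_⟩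
      · intro j hj
        dsimp only
        rw [Function.update_of_ne (hs j hj).1]
        exact h.ready_seen j (hs j hj).2
      · intro com' h1
        by_cases hc : com = com'
        · subst hc; exact hsent h1
        · refine hmono (h.4 com' ?_)
          rwa [fragsFor_update_of_ne hnone hc] at h1
      · intro com' m h1 h2 hv
        by_cases hc : com = com'
        · subst hc
          dsimp only at h1 h2 ⊢
          rw [if_pos h1, h2]
          simp [Option.filter, hv]
        -- Otherwise the output would have been given before.
        · exfalso
          dsimp only at h1 h2
          rw [fragsFor_update_of_ne hnone hc] at h1 h2
          have := h.5 com' m h1 h2 hv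
          simp [hout] at this
      · intro m hm
        dsimp only at hm ⊢
        split at hm
        · rename_i hq
          obtain ⟨h1, h2⟩ := Option.filter_eq_some_iff.1 hm
          exact ⟨hsent (by omega), h2, com, hq, h1⟩
        · simp at hm
    · exact ⟨h.1, fun j hj => h.2 j (hs j hj).2, h.3, h.4, h.5, h.6⟩

/-- The information in the state of a party in a broadcast only grows. -/
structure RBLe (st st' : RBState B) : Prop where
  valueSeen : st.valueSeen = true → st'.valueSeen = true
  echoSeen : st.echoSeen ⊆ st'.echoSeen
  readySeen : st.readySeen ⊆ st'.readySeen
  echoes : ∀ j q, st.echoes j = some q → st'.echoes j = some q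
  readies : ∀ j q, st.readies j = some q → st'.readies j = some q
  readySent : st.readySent = true → st'.readySent = true
  output : ∀ m, st.output = some m → st'.output = some m

lemma RBLe.refl (st : RBState B) : RBLe st st :=
  ⟨id, subset_rfl, subset_rfl, fun _ _ => id, fun _ _ => id, id, fun _ => id⟩

lemma RBLe.trans {a b c : RBState B} (h : RBLe a b) (k : RBLe b c) : RBLe a c :=
  ⟨k.1 ∘ h.1, h.2.trans k.2, h.3.trans k.3, fun j q => k.4 j q ∘ h.4 j q,
    fun j q => k.5 j q ∘ h.5 j q, k.6 ∘ h.6, fun m => k.7 m ∘ h.7 m⟩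

lemma update_of_eq_none {α β : Type} [DecidableEq α] {g : α → Option β} {a : α} {b : β}
    (ha : g a = none) {x : α} {y : β} (h : g x = some y) :
    Function.update g a (some b) x = some y := by
  rw [Function.update_of_ne, h]
  rintro rfl
  simp [ha] at h

lemma RBInv.le_receive {valid : M → Bool} {st : RBState B} (h : RBInv valid st)
    (i d src : Fin n) (m : RBMsg B) : RBLe st (rbReceive B valid i d src st m).1 := by
  cases m with
  | value com P prf =>
    simp only [rbReceive]
    split
    · exact .refl _
    · exact ⟨fun _ => rfl, subset_rfl, subset_rfl, fun _ _ => id, fun _ _ => id, id, fun _ => id⟩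
  | echo com P prf =>
    simp only [rbReceive]
    split
    · exact .refl _
    rename_i hn
    push Not at hn
    have hnone := h.echo_seen src hn.2
    split
    · split
      · exact ⟨id, Finset.subset_insert _ _, subset_rfl, fun _ _ => update_of_eq_none hnone,
          fun _ _ => id, fun _ => rfl, fun _ => id⟩
      · exact ⟨id, Finset.subset_insert _ _, subset_rfl, fun _ _ => update_of_eq_none hnone,
          fun _ _ => id, id, fun _ => id⟩
    · exact ⟨id, Finset.subset_insert _ _, subset_rfl, fun _ _ => id, fun _ _ => id, id,
        fun _ => id⟩
  | ready com P prf =>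
    simp only [rbReceive]
    split
    · exact .refl _
    rename_i hn
    push Not at hn
    have hnone := h.ready_seen src hn.2
    have hout : st.output = none := by simpa using hn.1
    split
    · exact ⟨id, subset_rfl, Finset.subset_insert _ _, fun _ _ => id,
        fun _ _ => update_of_eq_none hnone, fun hs => by simp [hs],
        fun m hm => by simp [hout] at hm⟩
    · exact ⟨id, subset_rfl, Finset.subset_insert _ _, fun _ _ => id, fun _ _ => id, id,
        fun _ => id⟩

end Local

/-! ### The broadcast network -/

section Net

variable {n f : ℕ} {M : Type} {B : BroadcastCode n f M}

section Receive

variable {valid : M → Bool} {i d src : Fin n} {st : RBState B} {m : RBMsg B}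

lemma rbReceive_ne_value {com : B.vc.Com} {P : B.Frag} {prf : B.vc.Prf} :
    (rbReceive B valid i d src st m).2 ≠ some (.value com P prf) := by
  cases m <;> simp only [rbReceive] <;> (repeat' split) <;> simp

lemma rbReceive_echo {com : B.vc.Com} {P : B.Frag} {prf : B.vc.Prf}
    (h : (rbReceive B valid i d src st m).2 = some (.echo com P prf)) :
    m = .value com P prf ∧ src = d ∧ st.valueSeen = false ∧
      B.vc.openVerify com P i prf = true ∧ (rbReceive B valid i d src st m).1.valueSeen = true := by
  cases m <;> simp only [rbReceive] at h ⊢ <;> (repeat' split at h) <;> simp_all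

/-- A ready message is sent after `n - f` echoes or after `f + 1` ready messages. -/
lemma rbReceive_ready {com : B.vc.Com} {P : B.Frag} {prf : B.vc.Prf}
    (h : (rbReceive B valid i d src st m).2 = some (.ready com P prf)) :
    st.readySent = false ∧ (rbReceive B valid i d src st m).1.readySent = true ∧
    ∃ p : B.F[X], P = B.fragments p i ∧ prf = B.vc.openProve com (B.fragments p) i ∧
      ((p = B.interpolate (fragsFor B (rbReceive B valid i d src st m).1.echoes com) ∧
        n - f ≤ countFrags (fragsFor B (rbReceive B valid i d src st m).1.echoes com) ∧
        B.vc.commit (B.fragments p) = com) ∨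
      (p = B.interpolate (fragsFor B (rbReceive B valid i d src st m).1.readies com) ∧
        f + 1 ≤ countFrags (fragsFor B (rbReceive B valid i d src st m).1.readies com))) := by
  cases m with
  | value c Q r =>
    simp only [rbReceive] at h
    repeat' split at h
    all_goals simp at h
  | echo c Q r =>
    simp only [rbReceive] at h ⊢
    by_cases h1 : st.output.isSome = true ∨ src ∈ st.echoSeen
    · rw [if_pos h1] at h; simp at h
    rw [if_neg h1] at h ⊢
    by_cases h2 : B.vc.openVerify c Q src r = true
    swap
    · rw [if_neg h2] at h; simp at h
    rw [if_pos h2] at h ⊢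
    split at h
    swap
    · simp at h
    rename_i h3
    rw [if_pos h3]
    simp only [Option.some.injEq, RBMsg.ready.injEq] at h
    obtain ⟨rfl, hP, hp⟩ := h
    exact ⟨h3.1, rfl, _, hP.symm, hp.symm, .inl ⟨rfl, h3.2.1, h3.2.2⟩⟩
  | ready c Q r =>
    simp only [rbReceive] at h ⊢
    by_cases h1 : st.output.isSome = true ∨ src ∈ st.readySeen
    · rw [if_pos h1] at h; simp at h
    rw [if_neg h1] at h ⊢
    by_cases h2 : B.vc.openVerify c Q src r = true
    swap
    · rw [if_neg h2] at h; simp at h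
    rw [if_pos h2] at h ⊢
    dsimp only at h
    split at h
    swap
    · simp at h
    rename_i h3
    rw [if_pos h3]
    simp only [Option.some.injEq, RBMsg.ready.injEq] at h
    obtain ⟨rfl, hP, hp⟩ := h
    exact ⟨h3.1, rfl, _, hP.symm, hp.symm, .inr ⟨rfl, h3.2⟩⟩

lemma rbReceive_readySent (h : (rbReceive B valid i d src st m).1.readySent = true) :
    st.readySent = true ∨
      ∃ com P prf, (rbReceive B valid i d src st m).2 = some (.ready com P prf) := by
  cases m <;> simp only [rbReceive] at h ⊢ <;> (repeat' split at h) <;> simp_all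

lemma rbReceive_valueSeen (h : (rbReceive B valid i d src st m).1.valueSeen = true) :
    st.valueSeen = true ∨ ∃ com P prf, m = .value com P prf ∧ src = d ∧
      (B.vc.openVerify com P i prf = true →
        (rbReceive B valid i d src st m).2 = some (.echo com P prf)) := by
  cases m <;> simp only [rbReceive] at h ⊢ <;> (repeat' split at h) <;> simp_all

lemma rbReceive_echoes {j : Fin n} {com : B.vc.Com} {P : B.Frag}
    (h : (rbReceive B valid i d src st m).1.echoes j = some (com, P)) :
    st.echoes j = some (com, P) ∨
      (j = src ∧ ∃ prf, m = .echo com P prf ∧ B.vc.openVerify com P src prf = true) := by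
  by_cases hj : j = src
  · subst hj
    cases m <;> simp only [rbReceive] at h ⊢ <;> (repeat' split at h) <;> simp_all
  · cases m <;> simp only [rbReceive] at h ⊢ <;> (repeat' split at h) <;> simp_all

lemma rbReceive_readies {j : Fin n} {com : B.vc.Com} {P : B.Frag}
    (h : (rbReceive B valid i d src st m).1.readies j = some (com, P)) :
    st.readies j = some (com, P) ∨
      (j = src ∧ ∃ prf, m = .ready com P prf ∧ B.vc.openVerify com P src prf = true) := by
  by_cases hj : j = src
  · subst hj
    cases m <;> simp only [rbReceive] at h ⊢ <;> (repeat' split at h) <;> simp_all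
  · cases m <;> simp only [rbReceive] at h ⊢ <;> (repeat' split at h) <;> simp_all

lemma rbReceive_echoSeen {j : Fin n} (h : j ∈ (rbReceive B valid i d src st m).1.echoSeen) :
    j ∈ st.echoSeen ∨ (j = src ∧ ∃ com P prf, m = .echo com P prf ∧
      (B.vc.openVerify com P src prf = true →
        (rbReceive B valid i d src st m).1.echoes j = some (com, P))) := by
  cases m with
  | echo c Q r =>
    simp only [rbReceive] at h ⊢
    by_cases h1 : st.output.isSome = true ∨ src ∈ st.echoSeen
    · rw [if_pos h1] at h; exact .inl h
    · rw [if_neg h1] at h ⊢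
      have hj : j = src ∨ j ∈ st.echoSeen := by
        split at h
        · split at h <;> exact Finset.mem_insert.1 h
        · exact Finset.mem_insert.1 h
      refine hj.symm.imp_right fun e => ⟨e, c, Q, r, rfl, fun hv => ?_⟩
      subst e
      rw [if_pos hv]
      split <;> simp
  | value c Q r =>
    simp only [rbReceive] at h
    split at h <;> exact .inl h
  | ready c Q r =>
    simp only [rbReceive] at h
    split at h
    · exact .inl h
    · split at h <;> exact .inl h

lemma rbReceive_readySeen {j : Fin n} (h : j ∈ (rbReceive B valid i d src st m).1.readySeen) :
    j ∈ st.readySeen ∨ (j = src ∧ ∃ com P prf, m = .ready com P prf ∧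
      (B.vc.openVerify com P src prf = true →
        (rbReceive B valid i d src st m).1.readies j = some (com, P))) := by
  cases m with
  | ready c Q r =>
    simp only [rbReceive] at h ⊢
    by_cases h1 : st.output.isSome = true ∨ src ∈ st.readySeen
    · rw [if_pos h1] at h; exact .inl h
    · rw [if_neg h1] at h ⊢
      have hj : j = src ∨ j ∈ st.readySeen := by
        split at h <;> exact Finset.mem_insert.1 h
      refine hj.symm.imp_right fun e => ⟨e, c, Q, r, rfl, fun hv => ?_⟩
      subst e
      rw [if_pos hv]
      simp
  | value c Q r =>
    simp only [rbReceive] at h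
    split at h <;> exact .inl h
  | echo c Q r =>
    simp only [rbReceive] at h
    split at h
    · exact .inl h
    · split at h
      · split at h <;> exact .inl h
      · exact .inl h

lemma mem_echoSeen_rbReceive {com : B.vc.Com} {P : B.Frag} {prf : B.vc.Prf} :
    (rbReceive B valid i d src st (.echo com P prf)).1.output.isSome = true ∨
      src ∈ (rbReceive B valid i d src st (.echo com P prf)).1.echoSeen := by
  simp only [rbReceive]
  split
  · assumption
  · split
    · split <;> simp
    · simp

lemma mem_readySeen_rbReceive {com : B.vc.Com} {P : B.Frag} {prf : B.vc.Prf} :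
    (rbReceive B valid i d src st (.ready com P prf)).1.output.isSome = true ∨
      src ∈ (rbReceive B valid i d src st (.ready com P prf)).1.readySeen := by
  simp only [rbReceive]
  split
  · assumption
  · split <;> simp

lemma valueSeen_rbReceive {com : B.vc.Com} {P : B.Frag} {prf : B.vc.Prf} :
    (rbReceive B valid i d d st (.value com P prf)).1.output.isSome = true ∨
      (rbReceive B valid i d d st (.value com P prf)).1.valueSeen = true := by
  simp only [rbReceive]
  split
  · simp_all
  · simp

end Receive

/-- One broadcast seen in isolation: the local states of the parties, the messages sent so far
by parties following the protocol, as triples (source, destination, message), and the parties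
corrupted so far. -/
structure RBNet (B : BroadcastCode n f M) where
  state : Fin n → RBState B
  sent : Set (Fin n × Fin n × RBMsg B)
  faulty : Finset (Fin n)

/-- No party has received anything, and nobody is corrupted. -/
def RBNet.init (B : BroadcastCode n f M) : RBNet B where
  state := fun _ => RBState.init B
  sent := ∅
  faulty := ∅

/-- Party `i` receives `m` from `src` in the broadcast with dealer `d`. -/
def RBNet.receive (valid : M → Bool) (d : Fin n) (c : RBNet B) (i src : Fin n) (m : RBMsg B) :
    RBNet B where
  state := Function.update c.state i (rbReceive B valid i d src (c.state i) m).1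
  sent := c.sent ∪ {q | q.1 = i ∧ (rbReceive B valid i d src (c.state i) m).2 = some q.2.2}
  faulty := c.faulty

/-- The steps of the network. A dealer following the protocol starts at most once. -/
inductive RBStep (valid : M → Bool) (d : Fin n) (c : RBNet B) : RBNet B → Prop
  | idle : RBStep valid d c c
  | corrupt (i : Fin n) (h : c.faulty.card < f) :
      RBStep valid d c { c with faulty := insert i c.faulty }
  | start (m : M) (h : ∀ j com P prf, (d, j, RBMsg.value com P prf) ∉ c.sent) :
      RBStep valid d c
        { c with sent := c.sent ∪ {q | q.1 = d ∧ q.2.2 = rbValue B m q.2.1} }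
  | receive (i src : Fin n) (m : RBMsg B) (h : src ∈ c.faulty ∨ (src, i, m) ∈ c.sent) :
      RBStep valid d c (c.receive valid d i src m)

/-- The commitment `com` to `p` is backed by the echoes of `n - f` parties. -/
def Certified (c : RBNet B) (com : B.vc.Com) (p : B.F[X]) : Prop :=
  Committed B com p ∧ ∃ Q : Finset (Fin n), n - f ≤ Q.card ∧
    ∀ j ∈ Q, j ∈ c.faulty ∨ ∃ k P prf, (j, k, RBMsg.echo com P prf) ∈ c.sent

lemma Certified.mono {c c' : RBNet B} (hf : c.faulty ⊆ c'.faulty) (hs : c.sent ⊆ c'.sent)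
    {com : B.vc.Com} {p : B.F[X]} (h : Certified c com p) : Certified c' com p := by
  obtain ⟨h1, Q, h2, h3⟩ := h
  exact ⟨h1, Q, h2, fun j hj => (h3 j hj).imp (fun h => hf h)
    fun ⟨k, P, prf, h⟩ => ⟨k, P, prf, hs h⟩⟩

/-- The safety invariants of a broadcast. -/
structure RBSafe (valid : M → Bool) (d : Fin n) (c : RBNet B) : Prop where
  card_faulty : c.faulty.card ≤ f
  inv : ∀ i, RBInv valid (c.state i)
  value_sent : ∀ i j com P prf, (i, j, RBMsg.value com P prf) ∈ c.sent → i = d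
  value_unique : (∀ j com P prf, (d, j, RBMsg.value com P prf) ∉ c.sent) ∨
    ∃ m : M, ∀ j com P prf, (d, j, RBMsg.value com P prf) ∈ c.sent →
      RBMsg.value com P prf = rbValue B m j
  echo_sent : ∀ i j com P prf, (i, j, RBMsg.echo com P prf) ∈ c.sent →
    (c.state i).valueSeen = true ∧ B.vc.openVerify com P i prf = true ∧
    (∀ k, (i, k, RBMsg.echo com P prf) ∈ c.sent) ∧
    (d ∈ c.faulty ∨ (d, i, RBMsg.value com P prf) ∈ c.sent)
  echo_unique : ∀ i j k com P prf com' P' prf', (i, j, RBMsg.echo com P prf) ∈ c.sent →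
    (i, k, RBMsg.echo com' P' prf') ∈ c.sent → com = com' ∧ P = P'
  value_seen : ∀ i, (c.state i).valueSeen = true → d ∈ c.faulty ∨
    ∃ com P prf, (d, i, RBMsg.value com P prf) ∈ c.sent ∧
      (B.vc.openVerify com P i prf = true → ∀ k, (i, k, RBMsg.echo com P prf) ∈ c.sent)
  echoes : ∀ i j com P, (c.state i).echoes j = some (com, P) →
    ∃ prf, B.vc.openVerify com P j prf = true ∧
      (j ∈ c.faulty ∨ (j, i, RBMsg.echo com P prf) ∈ c.sent)
  echo_seen : ∀ i j, j ∈ (c.state i).echoSeen → j ∈ c.faulty ∨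
    ∃ com P prf, (j, i, RBMsg.echo com P prf) ∈ c.sent ∧ (c.state i).echoes j = some (com, P)
  ready_sent : ∀ i j com P prf, (i, j, RBMsg.ready com P prf) ∈ c.sent →
    (c.state i).readySent = true ∧ B.vc.openVerify com P i prf = true ∧
    (∀ k, (i, k, RBMsg.ready com P prf) ∈ c.sent) ∧ ∃ p, Certified c com p
  ready_of_readySent : ∀ i, (c.state i).readySent = true →
    ∃ com P prf, ∀ k, (i, k, RBMsg.ready com P prf) ∈ c.sent
  readies : ∀ i j com P, (c.state i).readies j = some (com, P) →
    ∃ prf, B.vc.openVerify com P j prf = true ∧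
      (j ∈ c.faulty ∨ (j, i, RBMsg.ready com P prf) ∈ c.sent)
  ready_seen : ∀ i j, j ∈ (c.state i).readySeen → j ∈ c.faulty ∨
    ∃ com P prf, (j, i, RBMsg.ready com P prf) ∈ c.sent ∧ (c.state i).readies j = some (com, P)

lemma RBSafe.init (hf : f < n) (valid : M → Bool) (d : Fin n) :
    RBSafe valid d (RBNet.init B) := by
  constructor
  case inv => exact fun _ => RBInv.init hf valid
  all_goals simp [RBNet.init, RBState.init]

/-- Two quorums of `n - f` parties have a party outside the faulty set in common. -/
lemma exists_mem_inter_notMem (hf : 3 * f < n) {Q Q' F : Finset (Fin n)} (hQ : n - f ≤ Q.card)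
    (hQ' : n - f ≤ Q'.card) (hF : F.card ≤ f) : ∃ j, j ∈ Q ∧ j ∈ Q' ∧ j ∉ F := by
  have h1 := Finset.card_union_add_card_inter Q Q'
  have h2 : (Q ∪ Q').card ≤ n := by simpa using Finset.card_le_univ (Q ∪ Q')
  obtain ⟨j, hj, hj'⟩ := Finset.exists_mem_notMem_of_card_lt_card
    (show F.card < (Q ∩ Q').card by omega)
  exact ⟨j, (Finset.mem_inter.1 hj).1, (Finset.mem_inter.1 hj).2, hj'⟩

/-- Two quorums of echoes have a party in common that follows the protocol, and such a party sends
echoes for one commitment only. -/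
lemma RBSafe.certified_unique (hf : 3 * f < n) {valid : M → Bool} {d : Fin n} {c : RBNet B}
    (h : RBSafe valid d c) {com com' : B.vc.Com} {p p' : B.F[X]} (hc : Certified c com p)
    (hc' : Certified c com' p') : com = com' ∧ p = p' := by
  obtain ⟨h1, Q, hQ, hq⟩ := hc
  obtain ⟨h1', Q', hQ', hq'⟩ := hc'
  obtain ⟨j, hj, hj', hjf⟩ := exists_mem_inter_notMem hf hQ hQ' h.card_faulty
  obtain ⟨k, P, prf, hs⟩ := (hq j hj).resolve_left hjf
  obtain ⟨k', P', prf', hs'⟩ := (hq' j hj').resolve_left hjf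
  obtain ⟨rfl, -⟩ := h.echo_unique _ _ _ _ _ _ _ _ _ hs hs'
  exact ⟨rfl, h1.unique (by omega) h1'⟩

/-- `f + 1` ready messages for the same commitment certify it. -/
lemma RBSafe.certified_of_readies {valid : M → Bool} {d : Fin n} {c : RBNet B}
    (h : RBSafe valid d c) {i : Fin n} {com : B.vc.Com}
    (hc : f + 1 ≤ countFrags (fragsFor B (c.state i).readies com)) :
    ∃ p, Certified c com p ∧ B.interpolate (fragsFor B (c.state i).readies com) = p := by
  obtain ⟨j, hj, hjf⟩ := Finset.exists_mem_notMem_of_card_lt_card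
    (lt_of_le_of_lt h.card_faulty hc)
  obtain ⟨P, hP⟩ := Option.isSome_iff_exists.1 (Finset.mem_filter.1 hj).2
  obtain ⟨prf, -, hs⟩ := h.readies i j com P (fragsFor_eq_some.1 hP)
  obtain ⟨-, -, -, p, hp⟩ := h.ready_sent _ _ _ _ _ (hs.resolve_left hjf)
  exact ⟨p, hp, hp.1.interpolate_eq hc fun k Q hQ =>
    (h.readies i k com Q hQ).imp fun _ => And.left⟩

lemma RBSafe.receive (hf : 3 * f < n) {valid : M → Bool} {d : Fin n} {c : RBNet B}
    (h : RBSafe valid d c) (i src : Fin n) (m : RBMsg B)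
    (hm : src ∈ c.faulty ∨ (src, i, m) ∈ c.sent) : RBSafe valid d (c.receive valid d i src m) := by
  set c' := c.receive valid d i src m with hc'
  have hst : c'.state i = (rbReceive B valid i d src (c.state i) m).1 := by
    simp [hc', RBNet.receive]
  have hst' : ∀ j, j ≠ i → c'.state j = c.state j := fun j hj => by
    simp [hc', RBNet.receive, hj]
  have hfa : c'.faulty = c.faulty := rfl
  have hs : ∀ a b x, (a, b, x) ∈ c'.sent ↔ (a, b, x) ∈ c.sent ∨
      (a = i ∧ (rbReceive B valid i d src (c.state i) m).2 = some x) := fun _ _ _ => Iff.rfl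
  have hsub : c.sent ⊆ c'.sent := Set.subset_union_left
  have hle : ∀ j, RBLe (c.state j) (c'.state j) := fun j => by
    by_cases hj : j = i
    · subst hj; rw [hst]; exact (h.inv j).le_receive _ _ _ _
    · rw [hst' j hj]; exact .refl _
  -- Where the messages and the recorded fragments of `c'` come from. For `hready` it matters that
  -- the ready messages are in `c` already, because the invariant is known for these only.
  have hval : ∀ a b com P prf, (a, b, RBMsg.value com P prf) ∈ c'.sent →
      (a, b, RBMsg.value com P prf) ∈ c.sent := fun a b com P prf hx =>
    ((hs _ _ _).1 hx).resolve_right fun hx => rbReceive_ne_value hx.2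
  have hsrc : ∀ {x}, m = x → src ∈ c'.faulty ∨ (src, i, x) ∈ c'.sent := fun e => by
    subst e; exact hm.imp id fun h => hsub h
  have hecho : ∀ j k com P, (c'.state j).echoes k = some (com, P) →
      ∃ prf, B.vc.openVerify com P k prf = true ∧
        (k ∈ c'.faulty ∨ (k, j, RBMsg.echo com P prf) ∈ c'.sent) := by
    intro j k com P hx
    have old : (c.state j).echoes k = some (com, P) → ∃ prf, B.vc.openVerify com P k prf = true ∧
        (k ∈ c'.faulty ∨ (k, j, RBMsg.echo com P prf) ∈ c'.sent) := fun hx =>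
      (h.echoes j k com P hx).imp fun _ => And.imp_right (Or.imp id fun h => hsub h)
    by_cases hj : j = i
    · subst hj
      rw [hst] at hx
      rcases rbReceive_echoes hx with hx | ⟨rfl, prf, e, hv⟩
      · exact old hx
      · exact ⟨prf, hv, hsrc e⟩
    · rw [hst' j hj] at hx; exact old hx
  have hready : ∀ j k com P, (c'.state j).readies k = some (com, P) →
      ∃ prf, B.vc.openVerify com P k prf = true ∧
        (k ∈ c.faulty ∨ (k, j, RBMsg.ready com P prf) ∈ c.sent) := by
    intro j k com P hx
    by_cases hj : j = i
    · subst hj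
      rw [hst] at hx
      rcases rbReceive_readies hx with hx | ⟨rfl, prf, e, hv⟩
      · exact h.readies j k com P hx
      · subst e; exact ⟨prf, hv, hm⟩
    · rw [hst' j hj] at hx; exact h.readies j k com P hx
  refine ⟨h.card_faulty, fun j => ?_,
    fun a b com P prf hx => h.value_sent a b com P prf (hval _ _ _ _ _ hx), ?_, ?_, ?_, ?_, hecho,
    ?_, ?_, ?_, fun j k com P hx => (hready j k com P hx).imp fun _ =>
      And.imp_right (Or.imp id fun h => hsub h), ?_⟩
  · by_cases hj : j = i
    · subst hj; rw [hst]; exact (h.inv j).receive hf _ _ _ _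
    · rw [hst' j hj]; exact h.inv j
  · exact h.value_unique.imp (fun hn j com P prf hx => hn _ _ _ _ (hval _ _ _ _ _ hx))
      fun ⟨m, hm⟩ => ⟨m, fun j com P prf hx => hm _ _ _ _ (hval _ _ _ _ _ hx)⟩
  · intro a b com P prf hx
    rcases (hs _ _ _).1 hx with hx | ⟨rfl, hx⟩
    · obtain ⟨h1, h2, h3, h4⟩ := h.echo_sent a b com P prf hx
      exact ⟨(hle a).valueSeen h1, h2, fun k => hsub (h3 k), h4.imp id fun h => hsub h⟩
    · obtain ⟨e, rfl, -, hv, hs'⟩ := rbReceive_echo hx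
      exact ⟨hst ▸ hs', hv, fun k => (hs _ _ _).2 (.inr ⟨rfl, hx⟩), hsrc e⟩
  · intro a b k com P prf com' P' prf' hx₀ hy
    rcases (hs _ _ _).1 hx₀ with hx | ⟨rfl, hx⟩
    · rcases (hs _ _ _).1 hy with hy | ⟨rfl, hy⟩
      · exact h.echo_unique _ _ _ _ _ _ _ _ _ hx hy
      · have h1 := (h.echo_sent _ _ _ _ _ hx).1
        rw [(rbReceive_echo hy).2.2.1] at h1
        simp at h1
    · rcases (hs _ _ _).1 hy with hy | ⟨-, hy⟩
      · have h1 := (h.echo_sent _ _ _ _ _ hy).1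
        rw [(rbReceive_echo hx).2.2.1] at h1
        simp at h1
      · rw [hx] at hy
        simp only [Option.some.injEq, RBMsg.echo.injEq] at hy
        exact ⟨hy.1, hy.2.1⟩
  · intro j hx
    have old : (c.state j).valueSeen = true → d ∈ c'.faulty ∨
        ∃ com P prf, (d, j, RBMsg.value com P prf) ∈ c'.sent ∧
          (B.vc.openVerify com P j prf = true →
            ∀ k, (j, k, RBMsg.echo com P prf) ∈ c'.sent) := fun hx =>
      (h.value_seen j hx).imp id fun ⟨com, P, prf, h1, h2⟩ =>
        ⟨com, P, prf, hsub h1, fun hv k => hsub (h2 hv k)⟩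
    by_cases hj : j = i
    · subst hj
      rw [hst] at hx
      rcases rbReceive_valueSeen hx with hx | ⟨com, P, prf, e, rfl, hv⟩
      · exact old hx
      · exact (hsrc e).imp id fun h1 =>
          ⟨com, P, prf, h1, fun h2 k => (hs _ _ _).2 (.inr ⟨rfl, hv h2⟩)⟩
    · rw [hst' j hj] at hx; exact old hx
  · intro j k hx
    have old : k ∈ (c.state j).echoSeen → k ∈ c'.faulty ∨
        ∃ com P prf, (k, j, RBMsg.echo com P prf) ∈ c'.sent ∧
          (c'.state j).echoes k = some (com, P) := fun hx =>
      (h.echo_seen j k hx).imp id fun ⟨com, P, prf, h1, h2⟩ =>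
        ⟨com, P, prf, hsub h1, (hle j).echoes _ _ h2⟩
    by_cases hj : j = i
    · subst hj
      have hx' := hx
      rw [hst] at hx'
      rcases rbReceive_echoSeen hx' with hx' | ⟨rfl, com, P, prf, e, hv⟩
      · exact old hx'
      · subst e
        exact hm.imp id fun h1 => ⟨com, P, prf, hsub h1, by
          rw [hst]; exact hv (h.echo_sent _ _ _ _ _ h1).2.1⟩
    · rw [hst' j hj] at hx; exact old hx
  · intro a b com P prf hx
    rcases (hs _ _ _).1 hx with hx | ⟨rfl, hx⟩
    · obtain ⟨h1, h2, h3, p, h4⟩ := h.ready_sent a b com P prf hx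
      exact ⟨(hle a).readySent h1, h2, fun k => hsub (h3 k), p,
        h4.mono (by exact subset_rfl) (by exact hsub)⟩
    · obtain ⟨-, hs', p, hP, hprf, hcase⟩ := rbReceive_ready hx
      rw [← hst] at hs' hcase
      suffices hp : Certified c' com p by
        refine ⟨hs', ?_, fun k => (hs _ _ _).2 (.inr ⟨rfl, hx⟩), p, hp⟩
        rw [hP, hprf]
        exact hp.1.openVerify _
      -- A ready message sent after `n - f` echoes is certified by them. One sent after `f + 1`
      -- ready messages inherits the certificate of one of these that was sent by a party following
      -- the protocol.
      rcases hcase with ⟨e, hq, hcom⟩ | ⟨e, hq⟩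
      · refine ⟨⟨e ▸ degree_interpolate_lt (by omega), hcom⟩, _, hq, fun j hj => ?_⟩
        obtain ⟨Q, hQ⟩ := Option.isSome_iff_exists.1 (Finset.mem_filter.1 hj).2
        obtain ⟨prf', -, h1⟩ := hecho _ _ _ _ (fragsFor_eq_some.1 hQ)
        exact h1.imp id fun h1 => ⟨_, _, _, h1⟩
      · obtain ⟨j, hj, hjf⟩ := Finset.exists_mem_notMem_of_card_lt_card
          (lt_of_le_of_lt h.card_faulty hq)
        obtain ⟨Q, hQ⟩ := Option.isSome_iff_exists.1 (Finset.mem_filter.1 hj).2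
        obtain ⟨prf', -, h1⟩ := hready _ _ _ _ (fragsFor_eq_some.1 hQ)
        obtain ⟨-, -, -, p', hp'⟩ := h.ready_sent _ _ _ _ _ (h1.resolve_left hjf)
        have : p = p' := e.trans (hp'.1.interpolate_eq hq fun k R hR =>
          (hready _ k com R hR).imp fun _ => And.left)
        exact this ▸ hp'.mono (by exact subset_rfl) (by exact hsub)
  · intro j hx
    have old : (c.state j).readySent = true →
        ∃ com P prf, ∀ k, (j, k, RBMsg.ready com P prf) ∈ c'.sent := fun hx =>
      let ⟨com, P, prf, h1⟩ := h.ready_of_readySent j hx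
      ⟨com, P, prf, fun k => hsub (h1 k)⟩
    by_cases hj : j = i
    · subst hj
      rw [hst] at hx
      rcases rbReceive_readySent hx with hx | ⟨com, P, prf, e⟩
      · exact old hx
      · exact ⟨com, P, prf, fun k => (hs _ _ _).2 (.inr ⟨rfl, e⟩)⟩
    · rw [hst' j hj] at hx; exact old hx
  · intro j k hx
    have old : k ∈ (c.state j).readySeen → k ∈ c'.faulty ∨
        ∃ com P prf, (k, j, RBMsg.ready com P prf) ∈ c'.sent ∧
          (c'.state j).readies k = some (com, P) := fun hx =>
      (h.ready_seen j k hx).imp id fun ⟨com, P, prf, h1, h2⟩ =>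
        ⟨com, P, prf, hsub h1, (hle j).readies _ _ h2⟩
    by_cases hj : j = i
    · subst hj
      have hx' := hx
      rw [hst] at hx'
      rcases rbReceive_readySeen hx' with hx' | ⟨rfl, com, P, prf, e, hv⟩
      · exact old hx'
      · subst e
        exact hm.imp id fun h1 => ⟨com, P, prf, hsub h1, by
          rw [hst]; exact hv (h.ready_sent _ _ _ _ _ h1).2.1⟩
    · rw [hst' j hj] at hx; exact old hx

lemma RBSafe.corrupt {valid : M → Bool} {d : Fin n} {c : RBNet B} (h : RBSafe valid d c)
    (i : Fin n) (hc : c.faulty.card < f) :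
    RBSafe valid d { c with faulty := insert i c.faulty } := by
  have hsub : ∀ j, j ∈ c.faulty → j ∈ insert i c.faulty := fun j => Finset.mem_insert_of_mem
  exact {
    card_faulty := (Finset.card_insert_le _ _).trans hc
    inv := h.inv
    value_sent := h.value_sent
    value_unique := h.value_unique
    echo_sent := fun a b com P prf hx => by
      obtain ⟨h1, h2, h3, h4⟩ := h.echo_sent a b com P prf hx
      exact ⟨h1, h2, h3, h4.imp_left (hsub _)⟩
    echo_unique := h.echo_unique
    value_seen := fun a hx => (h.value_seen a hx).imp_left (hsub _)
    echoes := fun a j com P hx =>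
      (h.echoes a j com P hx).imp fun _ => And.imp_right (Or.imp_left (hsub _))
    echo_seen := fun a j hx => (h.echo_seen a j hx).imp_left (hsub _)
    ready_sent := fun a b com P prf hx => by
      obtain ⟨h1, h2, h3, p, h4⟩ := h.ready_sent a b com P prf hx
      exact ⟨h1, h2, h3, p, h4.mono (by exact hsub) (by exact subset_rfl)⟩
    ready_of_readySent := h.ready_of_readySent
    readies := fun a j com P hx =>
      (h.readies a j com P hx).imp fun _ => And.imp_right (Or.imp_left (hsub _))
    ready_seen := fun a j hx => (h.ready_seen a j hx).imp_left (hsub _) }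

lemma RBSafe.start {valid : M → Bool} {d : Fin n} {c : RBNet B} (h : RBSafe valid d c) (m : M)
    (hm : ∀ j com P prf, (d, j, RBMsg.value com P prf) ∉ c.sent) :
    RBSafe valid d { c with sent := c.sent ∪ {q | q.1 = d ∧ q.2.2 = rbValue B m q.2.1} } := by
  have hsub : c.sent ⊆ c.sent ∪ {q | q.1 = d ∧ q.2.2 = rbValue B m q.2.1} :=
    Set.subset_union_left
  have hecho : ∀ {a b com P prf}, (a, b, RBMsg.echo com P prf) ∈
      c.sent ∪ {q | q.1 = d ∧ q.2.2 = rbValue B m q.2.1} →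
      (a, b, RBMsg.echo com P prf) ∈ c.sent := fun hx => by simpa [rbValue] using hx
  have hready : ∀ {a b com P prf}, (a, b, RBMsg.ready com P prf) ∈
      c.sent ∪ {q | q.1 = d ∧ q.2.2 = rbValue B m q.2.1} →
      (a, b, RBMsg.ready com P prf) ∈ c.sent := fun hx => by simpa [rbValue] using hx
  exact {
    card_faulty := h.card_faulty
    inv := h.inv
    value_sent := fun a b com P prf hx =>
      hx.elim (fun hx => h.value_sent _ _ _ _ _ hx) fun hx => hx.1
    value_unique := .inr ⟨m, fun j com P prf hx =>
      hx.elim (fun hx => absurd hx (hm _ _ _ _)) fun hx => hx.2⟩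
    echo_sent := fun a b com P prf hx => by
      obtain ⟨h1, h2, h3, h4⟩ := h.echo_sent a b com P prf (hecho hx)
      exact ⟨h1, h2, fun k => hsub (h3 k), h4.imp id fun h => hsub h⟩
    echo_unique := fun a b k com P prf com' P' prf' hx hy =>
      h.echo_unique _ _ _ _ _ _ _ _ _ (hecho hx) (hecho hy)
    value_seen := fun a hx => (h.value_seen a hx).imp id fun ⟨com, P, prf, h1, h2⟩ =>
        ⟨com, P, prf, hsub h1, fun hv k => hsub (h2 hv k)⟩
    echoes := fun a j com P hx =>
      (h.echoes a j com P hx).imp fun _ => And.imp_right (Or.imp id fun h => hsub h)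
    echo_seen := fun a j hx => (h.echo_seen a j hx).imp id fun ⟨com, P, prf, h1, h2⟩ =>
        ⟨com, P, prf, hsub h1, h2⟩
    ready_sent := fun a b com P prf hx => by
      obtain ⟨h1, h2, h3, p, h4⟩ := h.ready_sent a b com P prf (hready hx)
      exact ⟨h1, h2, fun k => hsub (h3 k), p, h4.mono (by exact subset_rfl) (by exact hsub)⟩
    ready_of_readySent := fun a hx =>
      let ⟨com, P, prf, h1⟩ := h.ready_of_readySent a hx
      ⟨com, P, prf, fun k => hsub (h1 k)⟩
    readies := fun a j com P hx =>
      (h.readies a j com P hx).imp fun _ => And.imp_right (Or.imp id fun h => hsub h)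
    ready_seen := fun a j hx => (h.ready_seen a j hx).imp id fun ⟨com, P, prf, h1, h2⟩ =>
        ⟨com, P, prf, hsub h1, h2⟩ }

lemma RBSafe.step (hf : 3 * f < n) {valid : M → Bool} {d : Fin n} {c c' : RBNet B}
    (h : RBSafe valid d c) (hs : RBStep valid d c c') : RBSafe valid d c' := by
  cases hs with
  | idle => exact h
  | corrupt i hi => exact h.corrupt i hi
  | start m hm => exact h.start m hm
  | receive i src m hm => exact h.receive hf i src m hm

lemma RBStep.le {valid : M → Bool} {d : Fin n} {c c' : RBNet B} (h : RBSafe valid d c)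
    (hs : RBStep valid d c c') :
    (∀ i, RBLe (c.state i) (c'.state i)) ∧ c.sent ⊆ c'.sent ∧ c.faulty ⊆ c'.faulty := by
  cases hs with
  | idle => exact ⟨fun _ => .refl _, subset_rfl, subset_rfl⟩
  | corrupt i hi => exact ⟨fun _ => .refl _, subset_rfl, Finset.subset_insert _ _⟩
  | start m hm => exact ⟨fun _ => .refl _, Set.subset_union_left, subset_rfl⟩
  | receive i src m hm =>
    refine ⟨fun j => ?_, Set.subset_union_left, subset_rfl⟩
    by_cases hj : j = i
    · subst hj
      simpa [RBNet.receive] using (h.inv j).le_receive _ _ _ _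
    · simpa [RBNet.receive, hj] using RBLe.refl _

/-- An output is the message encoded by a certified polynomial. -/
lemma RBSafe.output_certified (hf : 3 * f < n) {valid : M → Bool} {d : Fin n} {c : RBNet B}
    (h : RBSafe valid d c) {i : Fin n} {m : M} (hm : (c.state i).output = some m) :
    valid m = true ∧ ∃ com p, Certified c com p ∧ B.decode p = some m ∧
      n - f ≤ countFrags (fragsFor B (c.state i).readies com) := by
  obtain ⟨-, hv, com, hq, hd⟩ := (h.inv i).output_ready m hm
  obtain ⟨p, hp, e⟩ := h.certified_of_readies (i := i) (com := com) (by omega)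
  exact ⟨hv, com, p, hp, e ▸ hd, hq⟩

lemma RBSafe.agreement (hf : 3 * f < n) {valid : M → Bool} {d : Fin n} {c : RBNet B}
    (h : RBSafe valid d c) {i j : Fin n} {m m' : M} (hm : (c.state i).output = some m)
    (hm' : (c.state j).output = some m') : m = m' := by
  obtain ⟨-, com, p, hp, hd, -⟩ := h.output_certified hf hm
  obtain ⟨-, com', p', hp', hd', -⟩ := h.output_certified hf hm'
  obtain ⟨-, rfl⟩ := h.certified_unique hf hp hp'
  exact Option.some_injective _ (hd.symm.trans hd')

/-- As long as the dealer follows the protocol, only the message that it has started to broadcast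
can be output. -/
lemma RBSafe.integrity (hf : 3 * f < n) {valid : M → Bool} {d : Fin n} {c : RBNet B}
    (h : RBSafe valid d c) (hd : d ∉ c.faulty) {i : Fin n} {m : M}
    (hm : (c.state i).output = some m) :
    ∃ j com P prf, (d, j, RBMsg.value com P prf) ∈ c.sent ∧
      ∀ m', RBMsg.value com P prf = rbValue B m' j → m' = m := by
  obtain ⟨-, com, p, hp, hdec, -⟩ := h.output_certified hf hm
  obtain ⟨hc, Q, hQ, hq⟩ := hp
  obtain ⟨j, hj, hjf⟩ := Finset.exists_mem_notMem_of_card_lt_card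
    (show c.faulty.card < Q.card by have := h.card_faulty; omega)
  obtain ⟨k, P, prf, hs⟩ := (hq j hj).resolve_left hjf
  refine ⟨j, com, P, prf, (h.echo_sent _ _ _ _ _ hs).2.2.2.resolve_left hd, fun m' e => ?_⟩
  simp only [rbValue, RBMsg.value.injEq] at e
  obtain ⟨rfl, -, -⟩ := e
  have := hc.unique (by omega) (committed_poly m')
  rw [this, decode_poly] at hdec
  exact Option.some_injective _ hdec

end Net

/-! ### Runs of the broadcast network -/

lemma eventually_of_stable {p : ℕ → Prop} (hs : ∀ t, p t → p (t + 1)) {t₀ : ℕ} (h : p t₀) :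
    ∀ᶠ t in atTop, p t :=
  eventually_atTop.2 ⟨t₀, fun _ ht => Nat.le_induction h (fun t _ => hs t) _ ht⟩

/-- The parties that never enter the growing sets `F t`. -/
def neverIn {n : ℕ} (F : ℕ → Finset (Fin n)) : Finset (Fin n) :=
  Finset.univ.filter fun i => ∀ t, i ∉ F t

lemma mem_neverIn {n : ℕ} {F : ℕ → Finset (Fin n)} {i : Fin n} :
    i ∈ neverIn F ↔ ∀ t, i ∉ F t := by
  simp [neverIn]

lemma le_card_neverIn {n f : ℕ} {F : ℕ → Finset (Fin n)} (hF : ∀ t, F t ⊆ F (t + 1))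
    (hc : ∀ t, (F t).card ≤ f) : n - f ≤ (neverIn F).card := by
  have : ∀ᶠ t in atTop, ∀ i, i ∈ neverIn F ∨ i ∈ F t := by
    refine eventually_all.2 fun i => ?_
    by_cases hi : i ∈ neverIn F
    · simp [hi]
    · simp only [mem_neverIn, not_forall, not_not] at hi
      obtain ⟨t, ht⟩ := hi
      exact (eventually_of_stable (fun t h => hF t h) ht).mono fun _ => .inr
  obtain ⟨t, ht⟩ := this.exists
  have h1 : (Finset.univ : Finset (Fin n)) ⊆ neverIn F ∪ F t := fun i _ =>
    Finset.mem_union.2 (ht i)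
  have h2 := (Finset.card_le_card h1).trans (Finset.card_union_le _ _)
  have := hc t
  simp at h2
  omega

section Run

variable {n f : ℕ} {M : Type} {B : BroadcastCode n f M}

/-- A fair run of the broadcast network: messages between never corrupted parties arrive. -/
structure RBRun (valid : M → Bool) (d : Fin n) (net : ℕ → RBNet B) : Prop where
  init : net 0 = RBNet.init B
  step : ∀ t, RBStep valid d (net t) (net (t + 1))
  fair : ∀ i j m t, (∀ s, i ∉ (net s).faulty) → (∀ s, j ∉ (net s).faulty) →
    (i, j, m) ∈ (net t).sent → ∃ t', net (t' + 1) = (net t').receive valid d j i m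

lemma rbValue_injective (hfn : f < n) {m m' : M} {j : Fin n} (h : rbValue B m j = rbValue B m' j) :
    m = m' := by
  simp only [rbValue, RBMsg.value.injEq] at h
  have h1 := committed_poly (B := B) m
  rw [h.1] at h1
  have := decode_poly (B := B) m
  rw [h1.unique hfn (committed_poly m'), decode_poly] at this
  exact (Option.some_injective _ this).symm

namespace RBRun

variable {valid : M → Bool} {d : Fin n} {net : ℕ → RBNet B}

lemma safe (hf : 3 * f < n) (h : RBRun valid d net) (t : ℕ) : RBSafe valid d (net t) := by
  induction t with
  | zero => rw [h.init]; exact RBSafe.init (by omega) valid d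
  | succ t ih => exact ih.step hf (h.step t)

lemma le (hf : 3 * f < n) (h : RBRun valid d net) {s t : ℕ} (hst : s ≤ t) :
    (∀ i, RBLe ((net s).state i) ((net t).state i)) ∧ (net s).sent ⊆ (net t).sent ∧
      (net s).faulty ⊆ (net t).faulty := by
  induction t, hst using Nat.le_induction with
  | base => exact ⟨fun _ => .refl _, subset_rfl, subset_rfl⟩
  | succ t _ ih =>
    obtain ⟨h1, h2, h3⟩ := (h.step t).le (h.safe hf t)
    exact ⟨fun i => (ih.1 i).trans (h1 i), ih.2.1.trans h2, ih.2.2.trans h3⟩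

lemma agreement (hf : 3 * f < n) (h : RBRun valid d net) {s t : ℕ} {i j : Fin n} {m m' : M}
    (hm : ((net s).state i).output = some m) (hm' : ((net t).state j).output = some m') :
    m = m' :=
  (h.safe hf (max s t)).agreement hf (((h.le hf (le_max_left s t)).1 i).output _ hm)
    (((h.le hf (le_max_right s t)).1 j).output _ hm')

/-- The never corrupted parties. -/
abbrev honest (net : ℕ → RBNet B) : Finset (Fin n) := neverIn fun t => (net t).faulty

lemma le_card_honest (hf : 3 * f < n) (h : RBRun valid d net) : n - f ≤ (honest net).card :=
  le_card_neverIn (fun t => (h.le hf (Nat.le_succ t)).2.2) fun t => (h.safe hf t).card_faulty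

lemma eventually_output (hf : 3 * f < n) (h : RBRun valid d net) {i : Fin n} {m : M} {t₀ : ℕ}
    (hm : ((net t₀).state i).output = some m) :
    ∀ᶠ t in atTop, ((net t).state i).output = some m :=
  eventually_of_stable (p := fun t => ((net t).state i).output = some m)
    (fun t => ((h.le hf (Nat.le_succ t)).1 i).output m) hm

/-- An echo message that arrives is recorded, unless the receiver has given an output and ignores
it. -/
lemma echo_arrives (hf : 3 * f < n) (h : RBRun valid d net) {i j : Fin n} (hi : i ∈ honest net)
    (hj : j ∈ honest net) {t₀ : ℕ} {com : B.vc.Com} {P : B.Frag} {prf : B.vc.Prf}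
    (hs : (i, j, RBMsg.echo com P prf) ∈ (net t₀).sent) :
    ∀ᶠ t in atTop, (∃ m, ((net t).state j).output = some m) ∨
      ((net t).state j).echoes i = some (com, P) := by
  obtain ⟨t, ht⟩ := h.fair i j _ t₀ (mem_neverIn.1 hi) (mem_neverIn.1 hj) hs
  have hst : (net (t + 1)).state j =
      (rbReceive B valid j d i ((net t).state j) (.echo com P prf)).1 := by
    simp [ht, RBNet.receive]
  have hseen := mem_echoSeen_rbReceive (B := B) (valid := valid) (i := j) (d := d) (src := i)
    (st := (net t).state j) (com := com) (P := P) (prf := prf)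
  rw [← hst] at hseen
  rcases hseen with ho | ho
  · obtain ⟨m, hm⟩ := Option.isSome_iff_exists.1 ho
    exact (h.eventually_output hf hm).mono fun _ h => .inl ⟨m, h⟩
  · obtain ⟨com', P', prf', hs', he⟩ :=
      ((h.safe hf (t + 1)).echo_seen j i ho).resolve_left (mem_neverIn.1 hi _)
    obtain ⟨rfl, rfl⟩ := (h.safe hf (max t₀ (t + 1))).echo_unique _ _ _ _ _ _ _ _ _
      ((h.le hf (le_max_left _ _)).2.1 hs) ((h.le hf (le_max_right _ _)).2.1 hs')
    exact (eventually_of_stable (p := fun t => ((net t).state j).echoes i = some (com, P))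
      (fun t => ((h.le hf (Nat.le_succ t)).1 j).echoes i _) he).mono fun _ => .inr

/-- A ready message that arrives is recorded, unless the receiver has given an output and ignores
it. The recorded one may be another message of the same sender, but it has the same
commitment, because certified commitments are unique. -/
lemma ready_arrives (hf : 3 * f < n) (h : RBRun valid d net) {i j : Fin n} (hi : i ∈ honest net)
    (hj : j ∈ honest net) {t₀ : ℕ} {com : B.vc.Com} {P : B.Frag} {prf : B.vc.Prf}
    (hs : (i, j, RBMsg.ready com P prf) ∈ (net t₀).sent) :
    ∀ᶠ t in atTop, (∃ m, ((net t).state j).output = some m) ∨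
      ∃ P, ((net t).state j).readies i = some (com, P) := by
  obtain ⟨t, ht⟩ := h.fair i j _ t₀ (mem_neverIn.1 hi) (mem_neverIn.1 hj) hs
  have hst : (net (t + 1)).state j =
      (rbReceive B valid j d i ((net t).state j) (.ready com P prf)).1 := by
    simp [ht, RBNet.receive]
  have hseen := mem_readySeen_rbReceive (B := B) (valid := valid) (i := j) (d := d) (src := i)
    (st := (net t).state j) (com := com) (P := P) (prf := prf)
  rw [← hst] at hseen
  rcases hseen with ho | ho
  · obtain ⟨m, hm⟩ := Option.isSome_iff_exists.1 ho
    exact (h.eventually_output hf hm).mono fun _ h => .inl ⟨m, h⟩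
  · obtain ⟨com', P', prf', hs', he⟩ :=
      ((h.safe hf (t + 1)).ready_seen j i ho).resolve_left (mem_neverIn.1 hi _)
    have hsafe := h.safe hf (max t₀ (t + 1))
    obtain ⟨-, -, -, p, hp⟩ := hsafe.ready_sent _ _ _ _ _ ((h.le hf (le_max_left _ _)).2.1 hs)
    obtain ⟨-, -, -, p', hp'⟩ := hsafe.ready_sent _ _ _ _ _ ((h.le hf (le_max_right _ _)).2.1 hs')
    obtain ⟨rfl, -⟩ := hsafe.certified_unique hf hp hp'
    exact (eventually_of_stable (p := fun t => ((net t).state j).readies i = some (com, P'))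
      (fun t => ((h.le hf (Nat.le_succ t)).1 j).readies i _) he).mono fun _ h => .inr ⟨P', h⟩

/-- Once `f + 1` never corrupted parties are ready for a decodable message, every never corrupted
party is ready for it, and hence outputs it. -/
lemma eventually_output_of_ready (hf : 3 * f < n) (h : RBRun valid d net) {t₀ : ℕ}
    {com : B.vc.Com} {p : B.F[X]} {m : M} (hp : Certified (net t₀) com p)
    (hd : B.decode p = some m) (hv : valid m = true) {Q : Finset (Fin n)} (hQ : Q ⊆ honest net)
    (hc : f + 1 ≤ Q.card)
    (hs : ∀ j ∈ Q, ∃ P prf, ∀ k, (j, k, RBMsg.ready com P prf) ∈ (net t₀).sent) {i : Fin n}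
    (hi : i ∈ honest net) : ∀ᶠ t in atTop, ((net t).state i).output = some m := by
  have hcert : ∀ t, t₀ ≤ t → Certified (net t) com p := fun t ht =>
    hp.mono (h.le hf ht).2.2 (h.le hf ht).2.1
  have all : ∀ {Q : Finset (Fin n)} {t₁ : ℕ}, Q ⊆ honest net →
      (∀ j ∈ Q, ∃ P prf, ∀ k, (j, k, RBMsg.ready com P prf) ∈ (net t₁).sent) →
      ∀ i ∈ honest net, ∀ᶠ t in atTop, (∃ m, ((net t).state i).output = some m) ∨
        Q.card ≤ countFrags (fragsFor B ((net t).state i).readies com) := by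
    intro Q t₁ hQ hs i hi
    have h1 : ∀ᶠ t in atTop, ∀ j ∈ Q, (∃ m, ((net t).state i).output = some m) ∨
        ∃ P, ((net t).state i).readies j = some (com, P) := by
      refine (eventually_all_finset Q).2 fun j hj => ?_
      obtain ⟨P, prf, hs⟩ := hs j hj
      exact h.ready_arrives hf (hQ hj) hi (hs i)
    filter_upwards [h1] with t ht
    by_cases ho : ∃ m, ((net t).state i).output = some m
    · exact .inl ho
    · exact .inr (card_le_countFrags Q fun j hj =>
        ((ht j hj).resolve_left ho).imp fun P hP => fragsFor_eq_some.2 hP)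
  -- The `f + 1` ready messages make everybody ready, and then there are `n - f` of them.
  have h1 : ∀ᶠ t in atTop, ∀ i ∈ honest net, ((net t).state i).readySent = true := by
    refine (eventually_all_finset _).2 fun i hi => ?_
    filter_upwards [all hQ hs i hi] with t ht
    rcases ht with ⟨m, hm⟩ | ht
    · exact (((h.safe hf t).inv i).output_ready m hm).1
    · exact ((h.safe hf t).inv i).ready_amplify com (hc.trans ht)
  obtain ⟨t₁, ht₁, h2⟩ := (h1.and (eventually_ge_atTop t₀)).exists
  have h3 : ∀ j ∈ honest net, ∃ P prf, ∀ k, (j, k, RBMsg.ready com P prf) ∈ (net t₁).sent := by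
    intro j hj
    obtain ⟨com', P, prf, hs'⟩ := (h.safe hf t₁).ready_of_readySent j (ht₁ j hj)
    obtain ⟨-, -, -, p', hp'⟩ := (h.safe hf t₁).ready_sent _ _ _ _ _ (hs' j)
    obtain ⟨rfl, -⟩ := (h.safe hf t₁).certified_unique hf (hcert t₁ h2) hp'
    exact ⟨P, prf, hs'⟩
  filter_upwards [all subset_rfl h3 i hi, eventually_ge_atTop t₀] with t ht htt
  have : ∃ m, ((net t).state i).output = some m := by
    rcases ht with ht | ht
    · exact ht
    · have hq := (h.le_card_honest hf).trans ht
      obtain ⟨p', hp', e⟩ := (h.safe hf t).certified_of_readies (i := i) (com := com) (by omega)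
      obtain ⟨-, rfl⟩ := (h.safe hf t).certified_unique hf (hcert t htt) hp'
      exact Option.isSome_iff_exists.1
        (((h.safe hf t).inv i).ready_output com m hq (e ▸ hd) hv)
  obtain ⟨m', hm'⟩ := this
  obtain ⟨-, com', p', hp', hd', -⟩ := (h.safe hf t).output_certified hf hm'
  obtain ⟨-, rfl⟩ := (h.safe hf t).certified_unique hf (hcert t htt) hp'
  rw [hm', ← hd, hd']

/-- If one party has given an output, every never corrupted party eventually gives the same. -/
theorem totality (hf : 3 * f < n) (h : RBRun valid d net) {t₀ : ℕ} {j : Fin n} {m : M}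
    (hm : ((net t₀).state j).output = some m) {i : Fin n} (hi : i ∈ honest net) :
    ∀ᶠ t in atTop, ((net t).state i).output = some m := by
  obtain ⟨hv, com, p, hp, hd, hq⟩ := (h.safe hf t₀).output_certified hf hm
  let Q₀ := Finset.univ.filter fun k => (fragsFor B ((net t₀).state j).readies com k).isSome = true
  have hcard : f + 1 ≤ (Q₀ ∩ honest net).card := by
    have h1 := Finset.card_union_add_card_inter Q₀ (honest net)
    have h2 : (Q₀ ∪ honest net).card ≤ n := by
      simpa using Finset.card_le_univ (Q₀ ∪ honest net)
    have h3 := h.le_card_honest hf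
    have h4 : n - f ≤ Q₀.card := hq
    omega
  refine h.eventually_output_of_ready hf hp hd hv Finset.inter_subset_right hcard
    (fun k hk => ?_) hi
  obtain ⟨hk1, hk2⟩ := Finset.mem_inter.1 hk
  obtain ⟨P, hP⟩ := Option.isSome_iff_exists.1 (Finset.mem_filter.1 hk1).2
  obtain ⟨prf, -, hs⟩ := (h.safe hf t₀).readies j k com P (fragsFor_eq_some.1 hP)
  exact ⟨P, prf, ((h.safe hf t₀).ready_sent _ _ _ _ _
    (hs.resolve_left (mem_neverIn.1 hk2 _))).2.2.1⟩

/-- The message that a dealer following the protocol has started to broadcast is the only one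
that can be output. -/
lemma output_eq (hf : 3 * f < n) (h : RBRun valid d net) {t t₀ : ℕ} (hd : d ∉ (net t).faulty)
    {m m' : M} {k : Fin n} (hs : (d, k, rbValue B m k) ∈ (net t₀).sent) {i : Fin n}
    (hm : ((net t).state i).output = some m') : m' = m := by
  obtain ⟨j, com, P, prf, hs', hu⟩ := (h.safe hf t).integrity hf hd hm
  obtain ⟨m₁, hm₁⟩ := ((h.safe hf (max t₀ t)).value_unique).resolve_left
    (fun hn => hn _ _ _ _ ((h.le hf (le_max_right _ _)).2.1 hs'))
  have e1 := hu m₁ (hm₁ _ _ _ _ ((h.le hf (le_max_right _ _)).2.1 hs'))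
  have e2 := hm₁ _ _ _ _ ((h.le hf (le_max_left _ _)).2.1 hs)
  exact e1 ▸ (rbValue_injective (by omega) e2).symm

/-- The broadcast of a never corrupted dealer reaches every never corrupted party. -/
theorem validity (hf : 3 * f < n) (h : RBRun valid d net) (hd : d ∈ honest net) {t₀ : ℕ} {m : M}
    (hv : valid m = true) (hs : ∀ k, (d, k, rbValue B m k) ∈ (net t₀).sent) {i : Fin n}
    (hi : i ∈ honest net) : ∀ᶠ t in atTop, ((net t).state i).output = some m := by
  -- If some never corrupted party gives an output, all do by totality. If none does, no message is
  -- ignored, so everybody collects the echoes of all never corrupted parties and gets ready.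
  by_cases hout : ∃ j ∈ honest net, ∃ t m', ((net t).state j).output = some m'
  · obtain ⟨j, hj, t, m', hm'⟩ := hout
    rw [← h.output_eq hf (mem_neverIn.1 hd t) (hs j) hm']
    exact h.totality hf hm' hi
  push Not at hout
  set com := B.vc.commit (B.fragments (B.poly m)) with hcom
  have hecho : ∀ᶠ t in atTop, ∀ j ∈ honest net, ∃ P prf, ∀ k,
      (j, k, RBMsg.echo com P prf) ∈ (net t).sent := by
    refine (eventually_all_finset _).2 fun j hj => ?_
    obtain ⟨t, ht⟩ := h.fair d j _ t₀ (mem_neverIn.1 hd) (mem_neverIn.1 hj) (hs j)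
    have hst : (net (t + 1)).state j =
        (rbReceive B valid j d d ((net t).state j) (rbValue B m j)).1 := by
      simp [ht, RBNet.receive]
    have hseen := valueSeen_rbReceive (B := B) (valid := valid) (i := j) (d := d)
      (st := (net t).state j) (com := com) (P := B.fragments (B.poly m) j)
      (prf := B.vc.openProve com (B.fragments (B.poly m)) j)
    change (rbReceive B valid j d d ((net t).state j) (rbValue B m j)).1.output.isSome = true ∨
      (rbReceive B valid j d d ((net t).state j) (rbValue B m j)).1.valueSeen = true at hseen
    rw [← hst] at hseen
    have hseen' := hseen.resolve_left fun ho => by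
      obtain ⟨m', hm'⟩ := Option.isSome_iff_exists.1 ho
      exact hout j hj _ _ hm'
    obtain ⟨com', P, prf, h1, h2⟩ :=
      ((h.safe hf (t + 1)).value_seen j hseen').resolve_left (mem_neverIn.1 hd _)
    obtain ⟨m₁, hm₁⟩ := ((h.safe hf (max t₀ (t + 1))).value_unique).resolve_left
      (fun hn => hn _ _ _ _ ((h.le hf (le_max_right _ _)).2.1 h1))
    have e1 := hm₁ _ _ _ _ ((h.le hf (le_max_right _ _)).2.1 h1)
    have e2 := hm₁ _ _ _ _ ((h.le hf (le_max_left _ _)).2.1 (hs j))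
    rw [← rbValue_injective (by omega) e2] at e1
    simp only [rbValue, RBMsg.value.injEq] at e1
    obtain ⟨rfl, rfl, rfl⟩ := e1
    have h3 := h2 ((committed_poly m).openVerify j)
    refine eventually_of_stable (t₀ := t + 1) (fun s hs => ?_) ⟨_, _, h3⟩
    obtain ⟨P, prf, hs⟩ := hs
    exact ⟨P, prf, fun k => (h.le hf (Nat.le_succ s)).2.1 (hs k)⟩
  have hcert : ∀ᶠ t in atTop, Certified (net t) com (B.poly m) := by
    filter_upwards [hecho] with t ht
    exact ⟨committed_poly m, honest net, h.le_card_honest hf, fun j hj => .inr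
      (let ⟨P, prf, h1⟩ := ht j hj; ⟨j, P, prf, h1 j⟩)⟩
  have hready : ∀ᶠ t in atTop, ∀ j ∈ honest net, ((net t).state j).readySent = true := by
    obtain ⟨t₁, ht₁⟩ := hecho.exists
    refine (eventually_all_finset _).2 fun j hj => ?_
    have h1 : ∀ᶠ t in atTop, ∀ k ∈ honest net,
        ∃ P, ((net t).state j).echoes k = some (com, P) := by
      refine (eventually_all_finset _).2 fun k hk => ?_
      obtain ⟨P, prf, h1⟩ := ht₁ k hk
      filter_upwards [h.echo_arrives hf hk hj (h1 j)] with t ht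
      exact ⟨P, ht.resolve_left fun ⟨m', hm'⟩ => hout j hj _ _ hm'⟩
    filter_upwards [h1] with t ht
    have hq : n - f ≤ countFrags (fragsFor B ((net t).state j).echoes com) :=
      (h.le_card_honest hf).trans (card_le_countFrags _ fun k hk =>
        (ht k hk).imp fun P hP => fragsFor_eq_some.2 hP)
    refine ((h.safe hf t).inv j).echo_quorum com hq ?_
    rw [(committed_poly m).interpolate_eq (le_trans (by omega) hq) fun k P hP =>
      ((h.safe hf t).echoes j k com P hP).imp fun _ => And.left]
  obtain ⟨t₁, ht₁, hc₁⟩ := (hready.and hcert).exists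
  refine h.eventually_output_of_ready hf hc₁ (decode_poly m) hv subset_rfl
    (le_trans (by omega) (h.le_card_honest hf)) (fun j hj => ?_) hi
  obtain ⟨com', P, prf, hs'⟩ := (h.safe hf t₁).ready_of_readySent j (ht₁ j hj)
  obtain ⟨-, -, -, p', hp'⟩ := (h.safe hf t₁).ready_sent _ _ _ _ _ (hs' j)
  obtain ⟨rfl, -⟩ := (h.safe hf t₁).certified_unique hf hc₁ hp'
  exact ⟨P, prf, hs'⟩

end RBRun

end Run

section Protocol

variable {n f lam : ℕ} {V : Type} {P : Setup n f lam V}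

/-! ### Steps of the protocol -/

/-- The steps of a single party. -/
inductive PStep (φ : P.Phi) (i : Fin n) (st : PartyState P) : PartyState P → Prop
  | start (x : V) (h : st.input = none) (hx : P.validate x = true) :
      PStep φ i st (startEffect i x st).state
  | receive (src : Fin n) (m : Msg P) (h : st.input ≠ none) :
      PStep φ i st (receiveEffect i src st m).state
  | rule (r : Rule P) (h : Enabled st r) : PStep φ i st (ruleEffect φ i st r).state

/-- The steps of the whole system. -/
inductive GStep (φ : P.Phi) (c : Config P) : Config P → Prop
  | idle : GStep φ c c
  | corrupt (i : Fin n) (h : c.faulty.card < f) :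
      GStep φ c { c with faulty := insert i c.faulty }
  | start (i : Fin n) (x : V) (hi : i ∉ c.faulty) (h : (c.party i).input = none)
      (hx : P.validate x = true) : GStep φ c (c.apply i (startEffect i x (c.party i)))
  | deliver (src dst : Fin n) (m : Msg P) (hd : dst ∉ c.faulty) (h : (c.party dst).input ≠ none)
      (hm : src ∈ c.faulty ∨ (src, dst, m) ∈ c.sent) :
      GStep φ c (c.apply dst (receiveEffect dst src (c.party dst) m))
  | rule (i : Fin n) (r : Rule P) (hi : i ∉ c.faulty) (h : Enabled (c.party i) r) :
      GStep φ c (c.apply i (ruleEffect φ i (c.party i) r))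

lemma gstep_step (φ : P.Phi) (c : Config P) (a : Action P) : GStep φ c (c.step φ a) := by
  unfold Config.step
  split
  · rename_i h
    rcases a with i | ⟨i, x⟩ | ⟨src, dst, m⟩ | ⟨i, r⟩
    · exact .corrupt i h
    · exact .start i x h.1 h.2.1 h.2.2
    · exact .deliver src dst m h.1 h.2.1 h.2.2
    · exact .rule i r h.1 h.2
  · exact .idle

lemma config_succ (A : Adversary P) (φ : P.Phi) (t : ℕ) :
    config A φ (t + 1) = (config A φ t).step φ (action A φ t) := rfl

lemma gstep_config (A : Adversary P) (φ : P.Phi) (t : ℕ) :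
    GStep φ (config A φ t) (config A φ (t + 1)) := by
  rw [config_succ]; exact gstep_step _ _ _

lemma apply_party_self (c : Config P) (i : Fin n) (e : Effect P) :
    (c.apply i e).party i = e.state := by simp [Config.apply]

lemma apply_party_of_ne (c : Config P) {i j : Fin n} (h : j ≠ i) (e : Effect P) :
    (c.apply i e).party j = c.party j := by simp [Config.apply, h]

lemma GStep.party {φ : P.Phi} {c c' : Config P} (h : GStep φ c c') (j : Fin n) :
    c'.party j = c.party j ∨ PStep φ j (c.party j) (c'.party j) := by
  cases h with
  | idle => exact .inl rfl
  | corrupt i h => exact .inl rfl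
  | start i x hi h hx =>
    by_cases hj : j = i
    · subst hj; rw [apply_party_self]; exact .inr (.start x h hx)
    · exact .inl (apply_party_of_ne c hj _)
  | deliver src i m hi h hm =>
    by_cases hj : j = i
    · subst hj; rw [apply_party_self]; exact .inr (.receive src m h)
    · exact .inl (apply_party_of_ne c hj _)
  | rule i r hi h =>
    by_cases hj : j = i
    · subst hj; rw [apply_party_self]; exact .inr (.rule r h)
    · exact .inl (apply_party_of_ne c hj _)

lemma GStep.le {φ : P.Phi} {c c' : Config P} (h : GStep φ c c') :
    c.faulty ⊆ c'.faulty ∧ c.sent ⊆ c'.sent ∧ c.opened ⊆ c'.opened := by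
  cases h with
  | idle => exact ⟨subset_rfl, subset_rfl, subset_rfl⟩
  | corrupt i h => exact ⟨Finset.subset_insert _ _, subset_rfl, subset_rfl⟩
  | start | deliver | rule =>
    exact ⟨subset_rfl, Set.subset_union_left, Set.subset_union_left⟩

/-- An invariant of single parties holds throughout every execution. -/
lemma party_induction {Q : Fin n → PartyState P → Prop} (A : Adversary P) (φ : P.Phi)
    (h₀ : ∀ i, Q i (PartyState.init P)) (hs : ∀ i st st', PStep φ i st st' → Q i st → Q i st')
    (t : ℕ) (i : Fin n) : Q i ((config A φ t).party i) := by
  induction t with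
  | zero => exact h₀ i
  | succ t ih =>
    rcases (gstep_config A φ t).party i with e | h
    · rw [e]; exact ih
    · exact hs _ _ _ h ih

/-! ### Invariants of a party -/

/-- What a party has received in the broadcast with dealer `d` and a given tag. -/
def PartyState.received (st : PartyState P) (d : Fin n) (tag : Tag) : Option P.Load :=
  (st.rb d tag).output

lemma received_update (st : PartyState P) (i src d : Fin n) (tag : Tag) (m : RBMsg P.code)
    (d' : Fin n) (tag' : Tag) :
    ((receiveEffect i src st (.rb d tag m)).state.rb d' tag') =
      if d' = d ∧ tag' = tag then
        (rbReceive P.code (loadValid P tag) i d src (st.rb d tag) m).1 else st.rb d' tag' := by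
  simp only [receiveEffect]
  by_cases hd : d' = d
  · subst hd
    by_cases ht : tag' = tag
    · subst ht; simp
    · simp [ht]
  · simp [hd]

/-- The invariants of the local states of all broadcasts. -/
def BroadcastInv (st : PartyState P) : Prop :=
  ∀ d tag, RBInv (loadValid P tag) (st.rb d tag)

lemma PStep.rb {φ : P.Phi} {i : Fin n} {st st' : PartyState P} (h : PStep φ i st st') :
    st'.rb = st.rb ∨ ∃ src d tag m, st' = (receiveEffect i src st (.rb d tag m)).state := by
  cases h with
  | start x h hx => exact .inl rfl
  | receive src m h =>
    cases m with
    | dkg s =>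
      refine .inl ?_
      simp only [receiveEffect]
      split
      · rfl
      · split
        · rfl
        · split <;> rfl
    | rb d tag m => exact .inr ⟨_, _, _, _, rfl⟩
    | eval k es ps =>
      refine .inl ?_
      simp only [receiveEffect]
      split <;> rfl
  | rule r h =>
    refine .inl ?_
    cases r with
    | gatherInput | gatherSecond | evaluate => rfl
    | gatherThird =>
      simp only [ruleEffect]
      split <;> rfl
    | addShare =>
      simp only [ruleEffect]
      split
      · rfl
      · split <;> rfl
    | output =>
      simp only [ruleEffect]
      split <;> rfl

lemma BroadcastInv.step (hf : 3 * f < n) {φ : P.Phi} {i : Fin n} {st st' : PartyState P}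
    (h : BroadcastInv st) (hs : PStep φ i st st') : BroadcastInv st' := by
  rcases hs.rb with e | ⟨src, d, tag, m, rfl⟩
  · intro d tag; rw [e]; exact h d tag
  · intro d' tag'
    rw [received_update]
    split
    · rename_i h'
      rw [h'.2]
      exact (h d tag).receive hf _ _ _ _
    · exact h d' tag'

lemma BroadcastInv.rbLe {φ : P.Phi} {i : Fin n} {st st' : PartyState P}
    (h : BroadcastInv st) (hs : PStep φ i st st') (d : Fin n) (tag : Tag) :
    RBLe (st.rb d tag) (st'.rb d tag) := by
  rcases hs.rb with e | ⟨src, d', tag', m, rfl⟩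
  · rw [e]; exact .refl _
  · rw [received_update]
    split
    · rename_i h'
      obtain ⟨rfl, rfl⟩ := h'
      exact (h d tag).le_receive _ _ _ _
    · exact .refl _

/-- Invariants of the DKG phase. -/
structure DkgInv (input : Option V) (D : Finset (Fin n × P.vrf.DkgShare)) (called : Bool) :
    Prop where
  validate : ∀ x, input = some x → P.validate x = true
  verify : ∀ q ∈ D, P.vrf.dkgShVerify (P.vrf.pk q.1) q.2 = true
  inj : Set.InjOn Prod.fst (D : Set (Fin n × P.vrf.DkgShare))
  called : called = true ↔ n - f ≤ D.card

/-- `I` contains the sets `V_j` of `n - f` pairs `(j, V_j)` in `U`. -/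
def Covers (f : ℕ) (U : Finset (Fin n × Finset (Fin n))) (I : Finset (Fin n)) : Prop :=
  ∃ Q : Finset (Fin n), n - f ≤ Q.card ∧ ∀ j ∈ Q, ∃ W, (j, W) ∈ U ∧ W ⊆ I

lemma Covers.mono {U U' : Finset (Fin n × Finset (Fin n))} {I : Finset (Fin n)}
    (h : Covers f U I) (hU : U ⊆ U') : Covers f U' I :=
  let ⟨Q, h1, h2⟩ := h
  ⟨Q, h1, fun j hj => let ⟨W, h3, h4⟩ := h2 j hj; ⟨W, hU h3, h4⟩⟩

lemma gatherVerify_iff {st : PartyState P} {I : Finset (Fin n)} :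
    GatherVerify st I ↔ Covers f st.U I ∧ I ⊆ st.S := by
  unfold GatherVerify Covers
  refine and_congr_left fun _ => ⟨fun h => ⟨_, h, fun j hj => ?_⟩, fun ⟨Q, h1, h2⟩ => ?_⟩
  · obtain ⟨⟨j', W⟩, hq, rfl⟩ := Finset.mem_image.1 hj
    exact ⟨W, (Finset.mem_filter.1 hq).1, (Finset.mem_filter.1 hq).2⟩
  · refine h1.trans (Finset.card_le_card fun j hj => ?_)
    obtain ⟨W, h3, h4⟩ := h2 j hj
    exact Finset.mem_image.2 ⟨(j, W), Finset.mem_filter.2 ⟨h3, h4⟩, rfl⟩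

/-- Invariants of `Gather`, where `O` describes what has been received by broadcast. -/
structure GatherInv (O : Fin n → Tag → Option P.Load) (R : Finset P.Tuple)
    (S T : Finset (Fin n)) (U : Finset (Fin n × Finset (Fin n)))
    (g : Option (Finset P.Tuple)) : Prop where
  received_of_mem_R : ∀ j x d, (j, x, d) ∈ R → O j .input = some (.proposal x d)
  mem_S : ∀ j, j ∈ S ↔ ∃ x d, (j, x, d) ∈ R
  received_of_mem_T : ∀ j ∈ T, ∃ A, O j .second = some (.set A) ∧ n - f ≤ A.card ∧ A ⊆ S
  received_of_mem_U : ∀ j W, (j, W) ∈ U → ∃ A, O j .third = some (.set A) ∧ n - f ≤ A.card ∧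
    A ⊆ T ∧ ∀ a, a ∈ W ↔ ∃ k ∈ A, ∃ B, O k .second = some (.set B) ∧ a ∈ B
  inj_U : Set.InjOn Prod.fst (U : Set (Fin n × Finset (Fin n)))
  gatherOut : g ≠ none ↔ n - f ≤ U.card
  gatherOut_eq : ∀ X, g = some X → X ⊆ R ∧ Covers f U (indexSet X)

lemma GatherInv.mono {O O' : Fin n → Tag → Option P.Load} {R : Finset P.Tuple}
    {S T : Finset (Fin n)} {U : Finset (Fin n × Finset (Fin n))} {g : Option (Finset P.Tuple)}
    (h : GatherInv O R S T U g) (hO : ∀ j tag m, O j tag = some m → O' j tag = some m) :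
    GatherInv O' R S T U g where
  received_of_mem_R j x d hm := hO _ _ _ (h.received_of_mem_R j x d hm)
  mem_S := h.mem_S
  received_of_mem_T j hj := (h.received_of_mem_T j hj).imp fun A => And.imp_left (hO _ _ _)
  received_of_mem_U j W hj := by
    obtain ⟨A, h1, h2, h3, h4⟩ := h.received_of_mem_U j W hj
    refine ⟨A, hO _ _ _ h1, h2, h3, fun a => (h4 a).trans ?_⟩
    -- The second sets of the parties in `A ⊆ T` are determined by `O` already.
    refine ⟨fun ⟨k, hk, B, hB, ha⟩ => ⟨k, hk, B, hO _ _ _ hB, ha⟩, fun ⟨k, hk, B, hB, ha⟩ => ?_⟩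
    obtain ⟨B', hB', -⟩ := h.received_of_mem_T k (h3 hk)
    have := (hO _ _ _ hB').symm.trans hB
    simp only [Option.some.injEq, Payload.set.injEq] at this
    exact ⟨k, hk, B', hB', this ▸ ha⟩
  inj_U := h.inj_U
  gatherOut := h.gatherOut
  gatherOut_eq := h.gatherOut_eq

lemma mem_secondSet {st : PartyState P} {k a : Fin n} :
    a ∈ secondSet st k ↔ ∃ B, st.received k .second = some (.set B) ∧ a ∈ B := by
  unfold secondSet PartyState.received
  split
  · rename_i A hA
    simp [hA]
  · rename_i hA
    simp only [Finset.notMem_empty, false_iff, not_exists, not_and]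
    intro B hB
    exact absurd hB (hA B)

/-- The invariants of the DKG phase and of `Gather`. -/
structure PhaseInv (st : PartyState P) : Prop where
  broadcast : BroadcastInv st
  dkg : DkgInv st.input st.dkgShares st.gatherCalled
  gather : GatherInv st.received st.R st.S st.T st.U st.gatherOut

lemma injOn_insert_fst {α β : Type} {s : Finset (α × β)} [DecidableEq (α × β)] [DecidableEq α]
    {a : α} {b : β}
    (h : Set.InjOn Prod.fst (s : Set (α × β))) (ha : a ∉ s.image Prod.fst) :
    Set.InjOn Prod.fst ((insert (a, b) s : Finset (α × β)) : Set (α × β)) := by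
  rw [Finset.coe_insert, Set.injOn_insert]
  · refine ⟨h, ?_⟩
    rwa [← Finset.coe_image, Finset.mem_coe]
  · intro hm
    exact ha (Finset.mem_image_of_mem Prod.fst (Finset.mem_coe.1 hm))

lemma card_insert_fst {α β : Type} {s : Finset (α × β)} [DecidableEq (α × β)] [DecidableEq α]
    {a : α} {b : β} (ha : a ∉ s.image Prod.fst) : (insert (a, b) s).card = s.card + 1 :=
  Finset.card_insert_of_notMem fun hm => ha (Finset.mem_image_of_mem Prod.fst hm)

lemma PhaseInv.init (hf : 3 * f < n) : PhaseInv (PartyState.init P) where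
  broadcast _ tag := RBInv.init (by omega) (loadValid P tag)
  dkg := by constructor <;> simp [PartyState.init]; omega
  gather := by constructor <;> simp [PartyState.init, PartyState.received, RBState.init]; omega

lemma DkgInv.step {φ : P.Phi} {i : Fin n} {st st' : PartyState P}
    (h : DkgInv st.input st.dkgShares st.gatherCalled) (hs : PStep φ i st st') :
    DkgInv st'.input st'.dkgShares st'.gatherCalled := by
  cases hs with
  | start x hn hx =>
    exact ⟨fun y hy => by simp only [startEffect, Option.some.injEq] at hy; exact hy ▸ hx,
      h.verify, h.inj, h.called⟩
  | receive src m hin =>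
    cases m with
    | dkg s =>
      simp only [receiveEffect]
      split
      · exact h
      rename_i hcond
      push Not at hcond
      split
      · exact h
      rename_i x hx
      have hv : ∀ q ∈ insert (src, s) st.dkgShares,
          P.vrf.dkgShVerify (P.vrf.pk q.1) q.2 = true := by
        intro q hq
        rcases Finset.mem_insert.1 hq with rfl | hq
        · simpa using hcond.2
        · exact h.verify q hq
      have hcard := card_insert_fst (b := s) hcond.1
      split
      · rename_i hc
        exact ⟨h.validate, hv, injOn_insert_fst h.inj hcond.1, by simp [hc]⟩
      · rename_i hc
        exact ⟨h.validate, hv, injOn_insert_fst h.inj hcond.1,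
          by dsimp only; rw [h.called]; omega⟩
    | rb d tag m => exact h
    | eval k es ps =>
      simp only [receiveEffect]
      split <;> exact h
  | rule r hr =>
    cases r with
    | gatherInput | gatherSecond | evaluate => exact h
    | gatherThird =>
      simp only [ruleEffect]
      split <;> exact h
    | addShare =>
      simp only [ruleEffect]
      split
      · exact h
      · split <;> exact h
    | output =>
      simp only [ruleEffect]
      split <;> exact h

lemma GatherInv.step {φ : P.Phi} {i : Fin n} {st st' : PartyState P}
    (hb : BroadcastInv st) (h : GatherInv st.received st.R st.S st.T st.U st.gatherOut)
    (hs : PStep φ i st st') :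
    GatherInv st'.received st'.R st'.S st'.T st'.U st'.gatherOut := by
  have hle := hb.rbLe hs
  cases hs with
  | start x hn hx => exact h
  | receive src m hin =>
    cases m with
    | dkg s =>
      simp only [receiveEffect]
      split
      · exact h
      split
      · exact h
      split <;> exact h
    | rb d tag m => exact h.mono fun j tag m => (hle j tag).output m
    | eval k es ps =>
      simp only [receiveEffect]
      split <;> exact h
  | rule r hr =>
    cases r with
    | gatherInput j x d =>
      obtain ⟨-, hj, hjS⟩ := hr
      exact {
        received_of_mem_R := fun k y e hk => by
          rcases Finset.mem_insert.1 hk with e | hk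
          · simp only [Prod.mk.injEq] at e
            obtain ⟨rfl, rfl, rfl⟩ := e
            exact hj
          · exact h.received_of_mem_R k y e hk
        mem_S := fun k => by
          simp only [ruleEffect, Finset.mem_insert, Prod.mk.injEq, h.mem_S]
          constructor
          · rintro (rfl | ⟨y, e, hk⟩)
            · exact ⟨x, d, .inl ⟨rfl, rfl, rfl⟩⟩
            · exact ⟨y, e, .inr hk⟩
          · rintro ⟨y, e, ⟨rfl, -, -⟩ | hk⟩
            · exact .inl rfl
            · exact .inr ⟨y, e, hk⟩
        received_of_mem_T := fun k hk => by
          obtain ⟨A, h1, h2, h3⟩ := h.received_of_mem_T k hk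
          exact ⟨A, h1, h2, h3.trans (Finset.subset_insert _ _)⟩
        received_of_mem_U := h.received_of_mem_U
        inj_U := h.inj_U
        gatherOut := h.gatherOut
        gatherOut_eq := fun X hX =>
          ⟨(h.gatherOut_eq X hX).1.trans (Finset.subset_insert _ _), (h.gatherOut_eq X hX).2⟩ }
    | gatherSecond j A =>
      obtain ⟨-, hj, hA, hAS, hjT⟩ := hr
      exact {
        received_of_mem_R := h.received_of_mem_R
        mem_S := h.mem_S
        received_of_mem_T := fun k hk => by
          rcases Finset.mem_insert.1 hk with rfl | hk
          · exact ⟨A, hj, hA, hAS⟩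
          · exact h.received_of_mem_T k hk
        received_of_mem_U := fun k W hk => by
          obtain ⟨A, h1, h2, h3, h4⟩ := h.received_of_mem_U k W hk
          exact ⟨A, h1, h2, h3.trans (Finset.subset_insert _ _), h4⟩
        inj_U := h.inj_U
        gatherOut := h.gatherOut
        gatherOut_eq := h.gatherOut_eq }
    | gatherThird j A =>
      obtain ⟨-, hj, hA, hAT, hjU⟩ := hr
      have hU : ∀ k W, (k, W) ∈ insert (j, A.biUnion (secondSet st)) st.U →
          ∃ A, st.received k .third = some (.set A) ∧ n - f ≤ A.card ∧ A ⊆ st.T ∧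
            ∀ a, a ∈ W ↔ ∃ k ∈ A, ∃ B, st.received k .second = some (.set B) ∧ a ∈ B := by
        intro k W hk
        rcases Finset.mem_insert.1 hk with e | hk
        · simp only [Prod.mk.injEq] at e
          obtain ⟨rfl, rfl⟩ := e
          exact ⟨A, hj, hA, hAT, fun a => by simp only [Finset.mem_biUnion, mem_secondSet]⟩
        · exact h.received_of_mem_U k W hk
      have hinj := injOn_insert_fst (b := A.biUnion (secondSet st)) h.inj_U hjU
      have hcard := card_insert_fst (b := A.biUnion (secondSet st)) hjU
      simp only [ruleEffect]
      split
      · rename_i hc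
        refine ⟨h.received_of_mem_R, h.mem_S, h.received_of_mem_T, hU, hinj,
          by simp [hc], fun X hX => ?_⟩
        obtain rfl : st.R = X := by simpa using hX
        -- All sets `V_j` are unions of sets contained in `S`, hence contained in the output.
        refine ⟨subset_rfl, (insert (j, A.biUnion (secondSet st)) st.U).image Prod.fst, ?_,
          fun k hk => ?_⟩
        · rw [Finset.card_image_of_injOn hinj, hc]
        · obtain ⟨⟨k', W⟩, hq, rfl⟩ := Finset.mem_image.1 hk
          refine ⟨W, hq, fun a ha => ?_⟩
          obtain ⟨A', -, -, hA', hW⟩ := hU _ _ hq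
          obtain ⟨l, hl, B, hB, haB⟩ := (hW a).1 ha
          obtain ⟨B', hB', -, hBS⟩ := h.received_of_mem_T l (hA' hl)
          have := hB'.symm.trans hB
          simp only [Option.some.injEq, Payload.set.injEq] at this
          obtain ⟨x, d, hm⟩ := (h.mem_S a).1 (hBS (this ▸ haB))
          exact Finset.mem_image.2 ⟨_, hm, rfl⟩
      · rename_i hc
        refine ⟨h.received_of_mem_R, h.mem_S, h.received_of_mem_T, hU, hinj, ?_, fun X hX =>
          ⟨(h.gatherOut_eq X hX).1, (h.gatherOut_eq X hX).2.mono (Finset.subset_insert _ _)⟩⟩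
        rw [h.gatherOut]
        dsimp only
        omega
    | evaluate => exact h
    | addShare =>
      simp only [ruleEffect]
      split
      · exact h
      · split <;> exact h
    | output =>
      simp only [ruleEffect]
      split <;> exact h

lemma PhaseInv.step (hf : 3 * f < n) {φ : P.Phi} {i : Fin n} {st st' : PartyState P}
    (h : PhaseInv st) (hs : PStep φ i st st') : PhaseInv st' :=
  ⟨h.broadcast.step hf hs, h.dkg.step hs, h.gather.step h.broadcast hs⟩

lemma phaseInv (hf : 3 * f < n) (A : Adversary P) (φ : P.Phi) (t : ℕ) (i : Fin n) :
    PhaseInv ((config A φ t).party i) :=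
  party_induction (Q := fun _ st => PhaseInv st) A φ (fun _ => .init hf)
    (fun _ _ _ hs h => h.step hf hs) t i

/-- The state of a party only grows. -/
structure PLe (st st' : PartyState P) : Prop where
  input : ∀ x, st.input = some x → st'.input = some x
  dkgShares : st.dkgShares ⊆ st'.dkgShares
  gatherCalled : st.gatherCalled = true → st'.gatherCalled = true
  rb : ∀ d tag, RBLe (st.rb d tag) (st'.rb d tag)
  R : st.R ⊆ st'.R
  S : st.S ⊆ st'.S
  T : st.T ⊆ st'.T
  U : st.U ⊆ st'.U
  gatherOut : ∀ X, st.gatherOut = some X → st'.gatherOut = some X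
  indicesDone : st.indicesDone ⊆ st'.indicesDone
  startEval : st.startEval ⊆ st'.startEval
  evalMsg : ∀ j k q, st.evalMsg j k = some q → st'.evalMsg j k = some q
  evalDone : st.evalDone ⊆ st'.evalDone
  evalShares : ∀ k, st.evalShares k ⊆ st'.evalShares k
  evals : st.evals ⊆ st'.evals
  out : ∀ q, st.out = some q → st'.out = some q

lemma PLe.refl (st : PartyState P) : PLe st st := by
  constructor <;> intros <;> first | exact subset_rfl | exact RBLe.refl _ | assumption

lemma PLe.trans {a b c : PartyState P} (h : PLe a b) (k : PLe b c) : PLe a c where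
  input x := k.input x ∘ h.input x
  dkgShares := h.dkgShares.trans k.dkgShares
  gatherCalled := k.gatherCalled ∘ h.gatherCalled
  rb d tag := (h.rb d tag).trans (k.rb d tag)
  R := h.R.trans k.R
  S := h.S.trans k.S
  T := h.T.trans k.T
  U := h.U.trans k.U
  gatherOut X := k.gatherOut X ∘ h.gatherOut X
  indicesDone := h.indicesDone.trans k.indicesDone
  startEval := h.startEval.trans k.startEval
  evalMsg i j q := k.evalMsg i j q ∘ h.evalMsg i j q
  evalDone := h.evalDone.trans k.evalDone
  evalShares i := (h.evalShares i).trans (k.evalShares i)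
  evals := h.evals.trans k.evals
  out q := k.out q ∘ h.out q

lemma PLe.received {st st' : PartyState P} (h : PLe st st') {d : Fin n} {tag : Tag} {m : P.Load}
    (hm : st.received d tag = some m) : st'.received d tag = some m :=
  (h.rb d tag).output m hm

lemma PhaseInv.le_step {φ : P.Phi} {i : Fin n} {st st' : PartyState P} (h : PhaseInv st)
    (hs : PStep φ i st st') : PLe st st' := by
  have hrb := h.broadcast.rbLe hs
  have r := PLe.refl st
  cases hs with
  | start x hn hx => exact { r with input := fun y hy => by simp [hn] at hy }
  | receive src m hin =>
    cases m with
    | dkg s =>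
      simp only [receiveEffect]
      split
      · exact r
      split
      · exact r
      split
      · exact { r with dkgShares := Finset.subset_insert _ _, gatherCalled := fun _ => rfl }
      · exact { r with dkgShares := Finset.subset_insert _ _ }
    | rb d tag m => exact { r with rb := hrb }
    | eval k es ps =>
      simp only [receiveEffect]
      split
      · rename_i hn
        refine { r with evalMsg := fun j l q hq => ?_ }
        dsimp only
        by_cases hj : j = src
        · subst hj
          rw [Function.update_self]
          exact update_of_eq_none hn hq
        · rwa [Function.update_of_ne hj]
      · exact r
  | rule rl hr =>
    cases rl with
    | gatherInput =>
      exact { r with R := Finset.subset_insert _ _, S := Finset.subset_insert _ _ }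
    | gatherSecond => exact { r with T := Finset.subset_insert _ _ }
    | gatherThird j A =>
      simp only [ruleEffect]
      have hcard := card_insert_fst (b := A.biUnion (secondSet st)) hr.2.2.2.2
      split
      · rename_i hc
        refine { r with U := Finset.subset_insert _ _, gatherOut := fun X hX => ?_ }
        have := h.gather.gatherOut.1 (by simp [hX])
        omega
      · exact { r with U := Finset.subset_insert _ _ }
    | evaluate =>
      exact { r with startEval := Finset.subset_union_left,
                     indicesDone := Finset.subset_insert _ _ }
    | addShare j k x d =>
      simp only [ruleEffect]
      split
      · exact { r with evalDone := Finset.subset_insert _ _ }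
      · split
        · refine { r with evalDone := Finset.subset_insert _ _, evalShares := fun l => ?_,
                          evals := ?_ }
          · dsimp only
            by_cases hl : l = k
            · subst hl; rw [Function.update_self]; exact Finset.subset_insert _ _
            · rw [Function.update_of_ne hl]
          · dsimp only
            split
            · exact Finset.subset_insert _ _
            · exact subset_rfl
        · exact { r with evalDone := Finset.subset_insert _ _ }
    | output l x =>
      simp only [ruleEffect]
      split
      · exact r
      · exact { r with out := fun q hq => by rw [hr.1] at hq; simp at hq }

lemma party_le (hf : 3 * f < n) (A : Adversary P) (φ : P.Phi) {s t : ℕ} (hst : s ≤ t)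
    (i : Fin n) : PLe ((config A φ s).party i) ((config A φ t).party i) := by
  induction t, hst using Nat.le_induction with
  | base => exact .refl _
  | succ t _ ih =>
    refine ih.trans ?_
    rcases (gstep_config A φ t).party i with e | h
    · rw [e]; exact .refl _
    · exact (phaseInv hf A φ t i).le_step h

lemma config_le (A : Adversary P) (φ : P.Phi) {s t : ℕ} (hst : s ≤ t) :
    (config A φ s).faulty ⊆ (config A φ t).faulty ∧ (config A φ s).sent ⊆ (config A φ t).sent ∧
      (config A φ s).opened ⊆ (config A φ t).opened := by
  induction t, hst using Nat.le_induction with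
  | base => exact ⟨subset_rfl, subset_rfl, subset_rfl⟩
  | succ t _ ih =>
    obtain ⟨h1, h2, h3⟩ := (gstep_config A φ t).le
    exact ⟨ih.1.trans h1, ih.2.1.trans h2, ih.2.2.trans h3⟩

/-! ### The broadcasts of an execution -/

/-- The number of items whose arrival triggers the broadcast with the given tag. -/
def PartyState.count (st : PartyState P) : Tag → ℕ
  | .input => st.dkgShares.card
  | .second => st.S.card
  | .third => st.T.card
  | .indices => st.U.card

lemma PLe.count {st st' : PartyState P} (h : PLe st st') (tag : Tag) :
    st.count tag ≤ st'.count tag := by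
  cases tag
  · exact Finset.card_le_card h.dkgShares
  · exact Finset.card_le_card h.S
  · exact Finset.card_le_card h.T
  · exact Finset.card_le_card h.U

/-- A payload that a party following the protocol may broadcast in the given state. -/
def LoadOk (st : PartyState P) : Tag → P.Load → Prop
  | .input, m => ∃ x d, m = .proposal x d ∧ st.input = some x ∧ P.vrf.dkgVerify d = true
  | .second, m => ∃ A, m = .set A ∧ n - f ≤ A.card ∧ A ⊆ st.S
  | .third, m => ∃ A, m = .set A ∧ n - f ≤ A.card ∧ A ⊆ st.T
  | .indices, m => ∃ X, m = .set (indexSet X) ∧ st.gatherOut = some X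

lemma LoadOk.mono {st st' : PartyState P} {tag : Tag} {m : P.Load} (h : LoadOk st tag m)
    (hle : PLe st st') : LoadOk st' tag m := by
  cases tag
  · obtain ⟨x, d, h1, h2, h3⟩ := h
    exact ⟨x, d, h1, hle.input x h2, h3⟩
  · obtain ⟨A, h1, h2, h3⟩ := h
    exact ⟨A, h1, h2, h3.trans hle.S⟩
  · obtain ⟨A, h1, h2, h3⟩ := h
    exact ⟨A, h1, h2, h3.trans hle.T⟩
  · obtain ⟨X, h1, h2⟩ := h
    exact ⟨X, h1, hle.gatherOut X h2⟩

lemma LoadOk.valid {st : PartyState P} (hst : PhaseInv st) {tag : Tag} {m : P.Load}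
    (h : LoadOk st tag m) : loadValid P tag m = true := by
  cases tag
  · obtain ⟨x, d, rfl, h2, h3⟩ := h
    simp [loadValid, checkValidity, hst.dkg.validate x h2, h3]
  · obtain ⟨A, rfl, -⟩ := h; rfl
  · obtain ⟨A, rfl, -⟩ := h; rfl
  · obtain ⟨A, rfl, -⟩ := h; rfl

/-- The effect of a step of party `i`, as far as broadcasts are concerned, unless the step is the
delivery of a broadcast message: it starts at most one broadcast, whose count has just reached
`n - f`. -/
def StartsBroadcast (i : Fin n) (st : PartyState P) (e : Effect P) : Prop :=
  e.state.rb = st.rb ∧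
  (((∀ k d tag m, (k, Msg.rb d tag m) ∉ e.sends) ∧
      ∀ tag, n - f ≤ e.state.count tag → n - f ≤ st.count tag) ∨
    ∃ tag m, e.sends = rbStart i tag m ∧ st.count tag < n - f ∧ n - f ≤ e.state.count tag ∧
      LoadOk e.state tag m ∧ ∀ tag', tag' ≠ tag → e.state.count tag' = st.count tag')

lemma StartsBroadcast.of_eq {i : Fin n} {st : PartyState P} {e : Effect P}
    (h : e.state.rb = st.rb) (hs : ∀ k d tag m, (k, Msg.rb d tag m) ∉ e.sends)
    (hD : e.state.dkgShares = st.dkgShares) (hS : e.state.S = st.S) (hT : e.state.T = st.T)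
    (hU : e.state.U = st.U) : StartsBroadcast i st e := by
  refine ⟨h, .inl ⟨hs, fun tag => ?_⟩⟩
  cases tag <;> simp [PartyState.count, hD, hS, hT, hU]

lemma startsBroadcast_start (i : Fin n) (x : V) (st : PartyState P) :
    StartsBroadcast i st (startEffect i x st) :=
  .of_eq rfl (by simp [startEffect]) rfl rfl rfl rfl

lemma startsBroadcast_dkg (hf : 3 * f < n) {i src : Fin n} {s : P.vrf.DkgShare}
    {st : PartyState P} (h : PhaseInv st) :
    StartsBroadcast i st (receiveEffect i src st (.dkg s)) := by
  simp only [receiveEffect]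
  split
  · exact .of_eq rfl (by simp) rfl rfl rfl rfl
  rename_i hcond
  push Not at hcond
  split
  · exact .of_eq rfl (by simp) rfl rfl rfl rfl
  rename_i x hx
  have hcard := card_insert_fst (b := s) hcond.1
  split
  · rename_i hc
    refine ⟨rfl, .inr ⟨.input, _, rfl, ?_, ?_, ⟨x, _, rfl, hx, ?_⟩, fun tag ht => ?_⟩⟩
    · simp only [PartyState.count]; omega
    · simp [PartyState.count, hc]
    · have hv : ∀ q ∈ insert (src, s) st.dkgShares,
          P.vrf.dkgShVerify (P.vrf.pk q.1) q.2 = true := by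
        intro q hq
        rcases Finset.mem_insert.1 hq with rfl | hq
        · simpa using hcond.2
        · exact h.dkg.verify q hq
      refine P.vrf.dkgAggregate_correct _ ?_ hv
      rw [Finset.card_image_of_injOn (injOn_insert_fst h.dkg.inj hcond.1), hc]
      omega
    · cases tag <;> first | exact absurd rfl ht | rfl
  · rename_i hc
    refine ⟨rfl, .inl ⟨by simp, fun tag ht => ?_⟩⟩
    cases tag
    · simp only [PartyState.count] at ht ⊢; omega
    all_goals exact ht

lemma startsBroadcast_eval {i src : Fin n} {k : Fin n} {es : P.vrf.EvalShare}
    {ps : P.vrf.ProofShare} {st : PartyState P} :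
    StartsBroadcast i st (receiveEffect i src st (.eval k es ps)) := by
  simp only [receiveEffect]
  split <;> exact .of_eq rfl (by simp) rfl rfl rfl rfl

lemma startsBroadcast_rule {φ : P.Phi} {i : Fin n} {r : Rule P}
    {st : PartyState P} (hr : Enabled st r) :
    StartsBroadcast i st (ruleEffect φ i st r) := by
  cases r with
  | gatherInput j x d =>
    have hcard := Finset.card_insert_of_notMem hr.2.2
    simp only [ruleEffect]
    split
    · rename_i hc
      refine ⟨rfl, .inr ⟨.second, _, rfl, ?_, ?_, ⟨_, rfl, hc.ge, subset_rfl⟩, fun tag ht => ?_⟩⟩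
      · simp only [PartyState.count]; omega
      · exact hc.ge
      · cases tag <;> first | exact absurd rfl ht | rfl
    · refine ⟨rfl, .inl ⟨by simp, fun tag ht => ?_⟩⟩
      cases tag
      case second => simp only [PartyState.count] at ht ⊢; omega
      all_goals exact ht
  | gatherSecond j A =>
    have hcard := Finset.card_insert_of_notMem hr.2.2.2.2
    simp only [ruleEffect]
    split
    · rename_i hc
      refine ⟨rfl, .inr ⟨.third, _, rfl, ?_, ?_, ⟨_, rfl, hc.ge, subset_rfl⟩, fun tag ht => ?_⟩⟩
      · simp only [PartyState.count]; omega
      · exact hc.ge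
      · cases tag <;> first | exact absurd rfl ht | rfl
    · refine ⟨rfl, .inl ⟨by simp, fun tag ht => ?_⟩⟩
      cases tag
      case third => simp only [PartyState.count] at ht ⊢; omega
      all_goals exact ht
  | gatherThird j A =>
    have hcard := card_insert_fst (b := A.biUnion (secondSet st)) hr.2.2.2.2
    simp only [ruleEffect]
    split
    · rename_i hc
      refine ⟨rfl, .inr ⟨.indices, _, rfl, ?_, ?_, ⟨_, rfl, rfl⟩, fun tag ht => ?_⟩⟩
      · simp only [PartyState.count]; omega
      · exact hc.ge
      · cases tag <;> first | exact absurd rfl ht | rfl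
    · refine ⟨rfl, .inl ⟨by simp, fun tag ht => ?_⟩⟩
      cases tag
      case indices => simp only [PartyState.count] at ht ⊢; omega
      all_goals exact ht
  | evaluate j I =>
    refine .of_eq rfl (fun k d tag m => ?_) rfl rfl rfl rfl
    rintro ⟨k, x, d, -, h⟩
    simp at h
  | addShare j k x d =>
    simp only [ruleEffect]
    split
    · exact .of_eq rfl (by simp) rfl rfl rfl rfl
    · split <;> exact .of_eq rfl (by simp) rfl rfl rfl rfl
  | output l x =>
    simp only [ruleEffect]
    split <;> exact .of_eq rfl (by simp) rfl rfl rfl rfl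

/-- The broadcast with dealer `d` and a given tag inside a configuration. -/
def rbNet (d : Fin n) (tag : Tag) (c : Config P) : RBNet P.code where
  state i := (c.party i).rb d tag
  sent := {q | (q.1, q.2.1, Msg.rb d tag q.2.2) ∈ c.sent}
  faulty := c.faulty

/-- A broadcast has been started exactly by the parties whose count has reached `n - f`. -/
structure LoadInv (c : Config P) : Prop where
  started : ∀ i tag, n - f ≤ (c.party i).count tag → ∃ m,
    (∀ k, (i, k, Msg.rb i tag (rbValue P.code m k)) ∈ c.sent) ∧ LoadOk (c.party i) tag m
  not_started : ∀ i tag, (c.party i).count tag < n - f → ∀ d j com F prf,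
    (i, j, Msg.rb d tag (.value com F prf)) ∉ c.sent

lemma mem_rbStart {i k : Fin n} {tag : Tag} {m : P.Load} {x : Msg P} :
    (k, x) ∈ rbStart i tag m ↔ x = .rb i tag (rbValue P.code m k) := Iff.rfl

lemma mem_apply_sent {c : Config P} {i : Fin n} {e : Effect P} {q : Fin n × Fin n × Msg P} :
    q ∈ (c.apply i e).sent ↔ q ∈ c.sent ∨ (q.1 = i ∧ q.2 ∈ e.sends) := Iff.rfl

/-- Steps other than the delivery of a broadcast message preserve the invariant, and start at most
one broadcast. -/
lemma LoadInv.apply {c : Config P} (h : LoadInv c) {i : Fin n} {e : Effect P}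
    (hle : PLe (c.party i) e.state) (he : StartsBroadcast i (c.party i) e) :
    LoadInv (c.apply i e) ∧
      ∀ d tag, RBStep (loadValid P tag) d (rbNet d tag c) (rbNet d tag (c.apply i e)) := by
  have hle' : ∀ j, PLe (c.party j) ((c.apply i e).party j) := fun j => by
    by_cases hj : j = i
    · subst hj; rwa [apply_party_self]
    · rw [apply_party_of_ne c hj]; exact .refl _
  have hsub : c.sent ⊆ (c.apply i e).sent := Set.subset_union_left
  have hstate : ∀ d tag j, ((c.apply i e).party j).rb d tag = (c.party j).rb d tag := by
    intro d tag j
    by_cases hj : j = i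
    · subst hj; rw [apply_party_self, he.1]
    · rw [apply_party_of_ne c hj]
  have old : ∀ j tag, n - f ≤ (c.party j).count tag → ∃ m,
      (∀ k, (j, k, Msg.rb j tag (rbValue P.code m k)) ∈ (c.apply i e).sent) ∧
        LoadOk ((c.apply i e).party j) tag m := fun j tag hj =>
    let ⟨m, h1, h2⟩ := h.started j tag hj
    ⟨m, fun k => hsub (h1 k), h2.mono (hle' j)⟩
  obtain ⟨-, ⟨hs, hc⟩ | ⟨tag₀, m₀, hs, hlt, hge, hok, hne⟩⟩ := he
  · constructor
    · constructor
      · intro j tag hj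
        refine old j tag ?_
        by_cases hji : j = i
        · subst hji; rw [apply_party_self] at hj; exact hc tag hj
        · rwa [apply_party_of_ne c hji] at hj
      · intro j tag hj d k com F prf hm
        refine (mem_apply_sent.1 hm).elim
          (h.not_started j tag (lt_of_le_of_lt ((hle' j).count tag) hj) _ _ _ _ _) ?_
        exact fun hm => hs _ _ _ _ hm.2
    · intro d tag
      have : rbNet d tag (c.apply i e) = rbNet d tag c := by
        unfold rbNet
        congr 1
        · funext j; exact hstate d tag j
        · ext ⟨a, b, x⟩
          simp only [Set.mem_ofPred_eq, mem_apply_sent]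
          exact ⟨fun hx => hx.resolve_right fun hx => hs _ _ _ _ hx.2, .inl⟩
      rw [this]; exact .idle
  · constructor
    · constructor
      · intro j tag hj
        by_cases hji : j = i
        · subst hji
          by_cases ht : tag = tag₀
          · subst ht
            refine ⟨m₀, fun k => mem_apply_sent.2 (.inr ⟨rfl, ?_⟩), ?_⟩
            · rw [hs]; rfl
            · rwa [apply_party_self]
          · refine old j tag ?_
            rwa [apply_party_self, hne tag ht] at hj
        · refine old j tag ?_
          rwa [apply_party_of_ne c hji] at hj
      · intro j tag hj d k com F prf hm₀
        refine (mem_apply_sent.1 hm₀).elim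
          (h.not_started j tag (lt_of_le_of_lt ((hle' j).count tag) hj) _ _ _ _ _) ?_
        rintro ⟨hji, hm⟩
        change j = i at hji
        subst hji
        rw [hs, mem_rbStart] at hm
        simp only [Msg.rb.injEq] at hm
        obtain ⟨-, rfl, -⟩ := hm
        rw [apply_party_self] at hj
        omega
    · intro d tag
      by_cases hdt : d = i ∧ tag = tag₀
      · obtain ⟨rfl, rfl⟩ := hdt
        have : rbNet d tag (c.apply d e) = { rbNet d tag c with
            sent := (rbNet d tag c).sent ∪ {q | q.1 = d ∧ q.2.2 = rbValue P.code m₀ q.2.1} } := by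
          unfold rbNet
          congr 1
          · funext j; exact hstate d tag j
          · ext ⟨a, b, x⟩
            simp only [Set.mem_ofPred_eq, mem_apply_sent, Set.mem_union, hs, mem_rbStart,
              Msg.rb.injEq, true_and]
        rw [this]
        exact .start m₀ fun j com F prf => h.not_started d tag hlt d j com F prf
      · have : rbNet d tag (c.apply i e) = rbNet d tag c := by
          unfold rbNet
          congr 1
          · funext j; exact hstate d tag j
          · ext ⟨a, b, x⟩
            simp only [Set.mem_ofPred_eq, mem_apply_sent]
            refine ⟨fun hx => hx.resolve_right fun hx => hdt ?_, .inl⟩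
            have hx := hx.2
            rw [hs, mem_rbStart] at hx
            simp only [Msg.rb.injEq] at hx
            exact ⟨hx.1, hx.2.1⟩
        rw [this]; exact .idle

/-- The delivery of a broadcast message. -/
lemma LoadInv.deliver {c : Config P} (h : LoadInv c) (hph : ∀ i, PhaseInv (c.party i))
    {i src d : Fin n} {tag : Tag} {m : RBMsg P.code} (hin : (c.party i).input ≠ none) :
    LoadInv (c.apply i (receiveEffect i src (c.party i) (.rb d tag m))) ∧
      (rbNet d tag (c.apply i (receiveEffect i src (c.party i) (.rb d tag m))) =
        (rbNet d tag c).receive (loadValid P tag) d i src m) ∧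
      ∀ d' tag', ¬ (d' = d ∧ tag' = tag) →
        rbNet d' tag' (c.apply i (receiveEffect i src (c.party i) (.rb d tag m))) =
          rbNet d' tag' c := by
  set e := receiveEffect i src (c.party i) (.rb d tag m) with he
  -- The receipt of a message does not involve the random function, so any will do.
  have hle : PLe (c.party i) e.state :=
    (hph i).le_step (φ := fun _ _ => ⟨0, by positivity⟩) (.receive src _ hin)
  have hle' : ∀ j, PLe (c.party j) ((c.apply i e).party j) := fun j => by
    by_cases hj : j = i
    · subst hj; rwa [apply_party_self]
    · rw [apply_party_of_ne c hj]; exact .refl _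
  have hsub : c.sent ⊆ (c.apply i e).sent := Set.subset_union_left
  have hsends : ∀ k x, (k, x) ∈ e.sends ↔ ∃ m',
      (rbReceive P.code (loadValid P tag) i d src ((c.party i).rb d tag) m).2 = some m' ∧
        x = .rb d tag m' := by
    intro k x
    rw [he]
    simp only [receiveEffect]
    split
    · rename_i hr; simp [hr]
    · rename_i m' hr; simp [hr, toAll]
  have hcount : ∀ j tag', ((c.apply i e).party j).count tag' = (c.party j).count tag' := by
    intro j tag'
    by_cases hj : j = i
    · subst hj; rw [apply_party_self]; cases tag' <;> rfl
    · rw [apply_party_of_ne c hj]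
  refine ⟨⟨fun j tag' hj => ?_, fun j tag' hj d' k com F prf hm => ?_⟩, ?_, ?_⟩
  · rw [hcount] at hj
    obtain ⟨m, h1, h2⟩ := h.started j tag' hj
    exact ⟨m, fun k => hsub (h1 k), h2.mono (hle' j)⟩
  · rw [hcount] at hj
    refine (mem_apply_sent.1 hm).elim (h.not_started j tag' hj _ _ _ _ _) ?_
    rintro ⟨rfl, hm⟩
    obtain ⟨m', h1, h2⟩ := (hsends _ _).1 hm
    simp only [Msg.rb.injEq] at h2
    obtain ⟨rfl, rfl, rfl⟩ := h2
    exact rbReceive_ne_value h1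
  · unfold rbNet RBNet.receive
    congr 1
    · funext j
      by_cases hj : j = i
      · subst hj
        simp only [apply_party_self, Function.update_self]
        rw [he, received_update, if_pos ⟨rfl, rfl⟩]
      · simp only [apply_party_of_ne c hj, Function.update_of_ne hj]
    · ext ⟨a, b, x⟩
      simp only [Set.mem_ofPred_eq, mem_apply_sent, Set.mem_union, hsends, Msg.rb.injEq, true_and]
      exact or_congr_right (and_congr_right fun _ => ⟨fun ⟨m', h1, h2⟩ => h2 ▸ h1,
        fun h1 => ⟨x, h1, rfl⟩⟩)
  · intro d' tag' hne
    unfold rbNet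
    congr 1
    · funext j
      by_cases hj : j = i
      · subst hj
        rw [apply_party_self, he, received_update, if_neg hne]
      · rw [apply_party_of_ne c hj]
    · ext ⟨a, b, x⟩
      simp only [Set.mem_ofPred_eq, mem_apply_sent, hsends, Msg.rb.injEq]
      refine ⟨fun hx => hx.resolve_right ?_, .inl⟩
      rintro ⟨-, m', -, h1, h2, -⟩
      exact hne ⟨h1, h2⟩

lemma LoadInv.step (hf : 3 * f < n) {φ : P.Phi} {c c' : Config P} (h : LoadInv c)
    (hph : ∀ i, PhaseInv (c.party i)) (hs : GStep φ c c') :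
    LoadInv c' ∧ ∀ d tag, RBStep (loadValid P tag) d (rbNet d tag c) (rbNet d tag c') := by
  cases hs with
  | idle => exact ⟨h, fun _ _ => .idle⟩
  | corrupt i hi =>
    exact ⟨⟨h.started, h.not_started⟩, fun d tag => .corrupt (c := rbNet d tag c) i hi⟩
  | start i x hi hn hx =>
    exact h.apply ((hph i).le_step (φ := φ) (.start x hn hx)) (startsBroadcast_start i x _)
  | deliver src i m hi hin hm =>
    cases m with
    | dkg s =>
      exact h.apply ((hph i).le_step (φ := φ) (.receive src _ hin)) (startsBroadcast_dkg hf (hph i))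
    | rb d tag m =>
      obtain ⟨h1, h2, h3⟩ := h.deliver hph (src := src) (d := d) (tag := tag) (m := m) hin
      refine ⟨h1, fun d' tag' => ?_⟩
      by_cases hdt : d' = d ∧ tag' = tag
      · obtain ⟨rfl, rfl⟩ := hdt
        rw [h2]
        exact .receive i src m hm
      · rw [h3 _ _ hdt]
        exact .idle
    | eval k es ps =>
      exact h.apply ((hph i).le_step (φ := φ) (.receive src _ hin)) startsBroadcast_eval
  | rule i r hi hr =>
    exact h.apply ((hph i).le_step (.rule r hr)) (startsBroadcast_rule hr)

lemma loadInv (hf : 3 * f < n) (A : Adversary P) (φ : P.Phi) (t : ℕ) :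
    LoadInv (config A φ t) := by
  induction t with
  | zero =>
    constructor
    · intro i tag h
      have : (config A φ 0).party i = PartyState.init P := rfl
      rw [this] at h
      cases tag <;> simp [PartyState.count, PartyState.init] at h <;> omega
    · intro i tag _ d j com F prf hm
      exact hm
  | succ t ih => exact (ih.step hf (phaseInv hf A φ t) (gstep_config A φ t)).1

lemma config_succ_deliver {A : Adversary P} {φ : P.Phi} {t : ℕ} {i j : Fin n} {m : Msg P}
    (ha : action A φ t = .deliver i j m) (hl : Legal (config A φ t) (.deliver i j m)) :
    config A φ (t + 1) =
      (config A φ t).apply j (receiveEffect j i ((config A φ t).party j) m) := by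
  rw [config_succ, ha]; exact if_pos hl

lemma config_succ_local {A : Adversary P} {φ : P.Phi} {t : ℕ} {i : Fin n} {r : Rule P}
    (ha : action A φ t = .local i r) (hl : Legal (config A φ t) (.local i r)) :
    config A φ (t + 1) =
      (config A φ t).apply i (ruleEffect φ i ((config A φ t).party i) r) := by
  rw [config_succ, ha]; exact if_pos hl

/-- Every broadcast of a fair execution is a fair run of the broadcast network. -/
theorem rbRun (hf : 3 * f < n) {A : Adversary P} {φ : P.Phi} (hA : Fair A φ) (d : Fin n)
    (tag : Tag) :
    RBRun (loadValid P tag) d (fun t => rbNet d tag (config A φ t)) where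
  init := rfl
  step t := ((loadInv hf A φ t).step hf (phaseInv hf A φ t) (gstep_config A φ t)).2 d tag
  fair i j m t hi hj hm := by
    obtain ⟨t', ht', hl⟩ := hA.delivers i j (.rb d tag m) t hi hj hm
    refine ⟨t', ?_⟩
    rw [config_succ_deliver ht' hl]
    exact ((loadInv hf A φ t').deliver (phaseInv hf A φ t') hl.2.1).2.1

/-! ### Progress of `Gather` -/

/-- The never corrupted parties. -/
def nonfaulty (A : Adversary P) (φ : P.Phi) : Finset (Fin n) :=
  neverIn fun t => (config A φ t).faulty

lemma mem_nonfaulty {A : Adversary P} {φ : P.Phi} {i : Fin n} :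
    i ∈ nonfaulty A φ ↔ Nonfaulty A φ i := mem_neverIn

/-- Induction along an execution. -/
lemma config_induction (hf : 3 * f < n) {Q : Config P → Prop} (A : Adversary P) (φ : P.Phi)
    (h₀ : Q (Config.init P))
    (hs : ∀ c c', (∀ i, PhaseInv (c.party i)) → GStep φ c c' → Q c → Q c') (t : ℕ) :
    Q (config A φ t) := by
  induction t with
  | zero => exact h₀
  | succ t ih => exact hs _ _ (phaseInv hf A φ t) (gstep_config A φ t) ih

lemma card_faulty_le (hf : 3 * f < n) (A : Adversary P) (φ : P.Phi) (t : ℕ) :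
    (config A φ t).faulty.card ≤ f := by
  refine config_induction hf (Q := fun c => c.faulty.card ≤ f) A φ (Nat.zero_le _)
    (fun c c' _ hs h => ?_) t
  cases hs with
  | idle | start | deliver | rule => exact h
  | corrupt i h => exact (Finset.card_insert_le _ _).trans h

lemma le_card_nonfaulty (hf : 3 * f < n) (A : Adversary P) (φ : P.Phi) :
    n - f ≤ (nonfaulty A φ).card :=
  le_card_neverIn (fun t => (config_le A φ (Nat.le_succ t)).1) (card_faulty_le hf A φ)

lemma receiveEffect_input (i src : Fin n) (st : PartyState P) (m : Msg P) :
    (receiveEffect i src st m).state.input = st.input := by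
  cases m <;> simp only [receiveEffect] <;> (repeat' split) <;> rfl

lemma ruleEffect_input (φ : P.Phi) (i : Fin n) (st : PartyState P) (r : Rule P) :
    (ruleEffect φ i st r).state.input = st.input := by
  cases r <;> simp only [ruleEffect] <;> (repeat' split) <;> rfl

section Fair

variable {A : Adversary P} {φ : P.Phi}

/-- A stable property of a party that holds once holds from then on. -/
lemma eventually_party (hf : 3 * f < n) {i : Fin n} {D : PartyState P → Prop}
    (hD : ∀ a b, PLe a b → D a → D b) {t₀ : ℕ} (h : D ((config A φ t₀).party i)) :
    ∀ᶠ t in atTop, D ((config A φ t).party i) :=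
  eventually_atTop.2 ⟨t₀, fun _ ht => hD _ _ (party_le hf A φ ht i) h⟩

/-- An internal step that stays enabled until it is done gets done. -/
lemma eventually_of_rule (hf : 3 * f < n) (hA : Fair A φ) {i : Fin n} (hi : Nonfaulty A φ i)
    (r : Rule P) {D : PartyState P → Prop} (hD : ∀ a b, PLe a b → D a → D b)
    (he : ∀ᶠ t in atTop, D ((config A φ t).party i) ∨ Enabled ((config A φ t).party i) r)
    (hr : ∀ st, Enabled st r → D (ruleEffect φ i st r).state) :
    ∀ᶠ t in atTop, D ((config A φ t).party i) := by
  obtain ⟨t₀, ht₀⟩ := eventually_atTop.1 he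
  by_cases hex : ∃ t, D ((config A φ t).party i)
  · obtain ⟨t, ht⟩ := hex
    exact eventually_party hf hD ht
  push Not at hex
  obtain ⟨t, ht, h⟩ := hA.progress i r t₀ hi ((ht₀ t₀ le_rfl).resolve_left (hex _))
  have hen := (ht₀ t ht).resolve_left (hex _)
  have ha := h.resolve_right (not_not_intro hen)
  refine absurd (hr _ hen) ?_
  have := hex (t + 1)
  rwa [config_succ_local ha ⟨hi t, hen⟩, apply_party_self] at this

lemma received_agree (hf : 3 * f < n) (hA : Fair A φ) {s t : ℕ} {i j d : Fin n} {tag : Tag}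
    {m m' : P.Load} (h : ((config A φ s).party i).received d tag = some m)
    (h' : ((config A φ t).party j).received d tag = some m') : m = m' :=
  (rbRun hf hA d tag).agreement hf h h'

lemma eventually_received (hf : 3 * f < n) (hA : Fair A φ) {s : ℕ} {i j d : Fin n} {tag : Tag}
    {m : P.Load} (h : ((config A φ s).party j).received d tag = some m) (hi : Nonfaulty A φ i) :
    ∀ᶠ t in atTop, ((config A φ t).party i).received d tag = some m :=
  (rbRun hf hA d tag).totality hf h (mem_nonfaulty.2 hi)

/-- The broadcasts of a never corrupted party reach all never corrupted parties. -/
lemma exists_load_received (hf : 3 * f < n) (hA : Fair A φ) {d : Fin n} {tag : Tag}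
    (hd : Nonfaulty A φ d)
    (h : ∀ᶠ t in atTop, n - f ≤ ((config A φ t).party d).count tag) :
    ∃ s m, LoadOk ((config A φ s).party d) tag m ∧ ∀ i, Nonfaulty A φ i →
      ∀ᶠ t in atTop, ((config A φ t).party i).received d tag = some m := by
  obtain ⟨s, hs⟩ := h.exists
  obtain ⟨m, h1, h2⟩ := (loadInv hf A φ s).started d tag hs
  exact ⟨s, m, h2, fun i hi => (rbRun hf hA d tag).validity hf (mem_nonfaulty.2 hd)
    (h2.valid (phaseInv hf A φ s d)) h1 (mem_nonfaulty.2 hi)⟩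

lemma dkg_sent (hf : 3 * f < n) (A : Adversary P) (φ : P.Phi) (t : ℕ) (i : Fin n)
    (h : ((config A φ t).party i).input ≠ none) (k : Fin n) :
    (i, k, Msg.dkg (P.vrf.dkgSh (P.vrf.sk i) (P.dkgCoin i k))) ∈ (config A φ t).sent := by
  refine config_induction hf (Q := fun c => (c.party i).input ≠ none →
    (i, k, Msg.dkg (P.vrf.dkgSh (P.vrf.sk i) (P.dkgCoin i k))) ∈ c.sent) A φ
    (fun h => absurd rfl h) (fun c c' _ hs h h' => ?_) t h
  have hsub := hs.le.2.1
  cases hs with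
  | idle => exact h h'
  | corrupt => exact h h'
  | start j x hj hn hx =>
    by_cases hij : i = j
    · subst hij
      exact mem_apply_sent.2 (.inr ⟨rfl, rfl⟩)
    · rw [apply_party_of_ne c hij] at h'
      exact hsub (h h')
  | deliver src j m hj hn hm =>
    by_cases hij : i = j
    · subst hij
      rw [apply_party_self, receiveEffect_input] at h'
      exact hsub (h h')
    · rw [apply_party_of_ne c hij] at h'
      exact hsub (h h')
  | rule j r hj hr =>
    by_cases hij : i = j
    · subst hij
      rw [apply_party_self, ruleEffect_input] at h'
      exact hsub (h h')
    · rw [apply_party_of_ne c hij] at h'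
      exact hsub (h h')

lemma mem_dkgShares_receive {i src : Fin n} {st : PartyState P} {s : P.vrf.DkgShare}
    (h : st.input ≠ none) (hv : P.vrf.dkgShVerify (P.vrf.pk src) s = true) :
    src ∈ (receiveEffect i src st (.dkg s)).state.dkgShares.image Prod.fst := by
  simp only [receiveEffect]
  split
  · rename_i hc
    exact hc.resolve_right (by simp [hv])
  · split
    · contradiction
    · split <;> simp

lemma eventually_gatherCalled (hf : 3 * f < n) (hA : Fair A φ) {i : Fin n}
    (hi : Nonfaulty A φ i) :
    ∀ᶠ t in atTop, ((config A φ t).party i).gatherCalled = true := by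
  have h : ∀ᶠ t in atTop, ∀ j ∈ nonfaulty A φ,
      j ∈ ((config A φ t).party i).dkgShares.image Prod.fst := by
    refine (eventually_all_finset _).2 fun j hj => ?_
    obtain ⟨t₀, ht₀⟩ := hA.starts j (mem_nonfaulty.1 hj)
    obtain ⟨t, ha, hl⟩ := hA.delivers j i _ t₀ (mem_nonfaulty.1 hj) hi (dkg_sent hf A φ t₀ j ht₀ i)
    refine eventually_party hf (D := fun st => j ∈ st.dkgShares.image Prod.fst)
      (fun a b hab h => Finset.image_subset_image hab.dkgShares h) (t₀ := t + 1) ?_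
    rw [config_succ_deliver ha hl, apply_party_self]
    exact mem_dkgShares_receive hl.2.1 (P.vrf.dkgSh_correct _ _)
  filter_upwards [h] with t ht
  rw [(phaseInv hf A φ t i).dkg.called]
  exact (le_card_nonfaulty hf A φ).trans ((Finset.card_le_card ht).trans Finset.card_image_le)

lemma eventually_mem_S_of_received (hf : 3 * f < n) (hA : Fair A φ) {j : Fin n} {x : V}
    {d : P.vrf.Dkg} {i : Fin n} (hi : Nonfaulty A φ i)
    (h : ∀ᶠ t in atTop,
      ((config A φ t).party i).received j .input = some (.proposal x d)) :
    ∀ᶠ t in atTop, j ∈ ((config A φ t).party i).S := by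
  refine eventually_of_rule hf hA hi (.gatherInput j x d) (D := fun st => j ∈ st.S)
    (fun a b hab h => hab.S h) ?_ fun st _ => Finset.mem_insert_self _ _
  filter_upwards [eventually_gatherCalled hf hA hi, h] with t h1 h2
  exact or_iff_not_imp_left.2 fun h3 => ⟨h1, h2, h3⟩

lemma eventually_mem_S (hf : 3 * f < n) (hA : Fair A φ) {s : ℕ} {i j k : Fin n}
    (h : j ∈ ((config A φ s).party k).S) (hi : Nonfaulty A φ i) :
    ∀ᶠ t in atTop, j ∈ ((config A φ t).party i).S := by
  obtain ⟨x, d, hR⟩ := ((phaseInv hf A φ s k).gather.mem_S j).1 h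
  exact eventually_mem_S_of_received hf hA hi
    (eventually_received hf hA ((phaseInv hf A φ s k).gather.received_of_mem_R j x d hR) hi)

lemma eventually_subset_S (hf : 3 * f < n) (hA : Fair A φ) {s : ℕ} {i k : Fin n}
    {I : Finset (Fin n)} (h : I ⊆ ((config A φ s).party k).S) (hi : Nonfaulty A φ i) :
    ∀ᶠ t in atTop, I ⊆ ((config A φ t).party i).S :=
  (eventually_all_finset I).2 fun _ hj => eventually_mem_S hf hA (h hj) hi

lemma eventually_nonfaulty_subset_S (hf : 3 * f < n) (hA : Fair A φ) {i : Fin n}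
    (hi : Nonfaulty A φ i) :
    ∀ᶠ t in atTop, nonfaulty A φ ⊆ ((config A φ t).party i).S := by
  refine (eventually_all_finset (nonfaulty A φ)).2 fun j hj => ?_
  rw [mem_nonfaulty] at hj
  obtain ⟨s, m, ⟨x, d, rfl, -⟩, h⟩ := exists_load_received (tag := .input) hf hA hj <| by
    filter_upwards [eventually_gatherCalled hf hA hj] with t ht
    exact (phaseInv hf A φ t j).dkg.called.1 ht
  exact eventually_mem_S_of_received hf hA hi (h i hi)

lemma eventually_mem_T_of_received (hf : 3 * f < n) (hA : Fair A φ) {i j : Fin n}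
    {I : Finset (Fin n)} (hi : Nonfaulty A φ i) (hc : n - f ≤ I.card)
    (h : ∀ᶠ t in atTop, ((config A φ t).party i).received j .second = some (.set I))
    (hS : ∀ᶠ t in atTop, I ⊆ ((config A φ t).party i).S) :
    ∀ᶠ t in atTop, j ∈ ((config A φ t).party i).T := by
  refine eventually_of_rule hf hA hi (.gatherSecond j I) (D := fun st => j ∈ st.T)
    (fun a b hab h => hab.T h) ?_ fun st _ => Finset.mem_insert_self _ _
  filter_upwards [eventually_gatherCalled hf hA hi, h, hS] with t h1 h2 h3
  exact or_iff_not_imp_left.2 fun h4 => ⟨h1, h2, hc, h3, h4⟩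

lemma eventually_subset_T (hf : 3 * f < n) (hA : Fair A φ) {s : ℕ} {i k : Fin n}
    {I : Finset (Fin n)} (h : I ⊆ ((config A φ s).party k).T) (hi : Nonfaulty A φ i) :
    ∀ᶠ t in atTop, I ⊆ ((config A φ t).party i).T := by
  refine (eventually_all_finset I).2 fun j hj => ?_
  obtain ⟨J, h1, h2, h3⟩ := (phaseInv hf A φ s k).gather.received_of_mem_T j (h hj)
  exact eventually_mem_T_of_received hf hA hi h2 (eventually_received hf hA h1 hi)
    (eventually_subset_S hf hA h3 hi)

lemma eventually_nonfaulty_subset_T (hf : 3 * f < n) (hA : Fair A φ) {i : Fin n}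
    (hi : Nonfaulty A φ i) :
    ∀ᶠ t in atTop, nonfaulty A φ ⊆ ((config A φ t).party i).T := by
  refine (eventually_all_finset (nonfaulty A φ)).2 fun j hj => ?_
  rw [mem_nonfaulty] at hj
  obtain ⟨s, m, ⟨I, rfl, h1, h2⟩, h⟩ := exists_load_received (tag := .second) hf hA hj <| by
    filter_upwards [eventually_nonfaulty_subset_S hf hA hj] with t ht
    exact (le_card_nonfaulty hf A φ).trans (Finset.card_le_card ht)
  exact eventually_mem_T_of_received hf hA hi h1 (h i hi) (eventually_subset_S hf hA h2 hi)

lemma eventually_mem_U_of_received (hf : 3 * f < n) (hA : Fair A φ) {i j : Fin n}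
    {I : Finset (Fin n)} (hi : Nonfaulty A φ i) (hc : n - f ≤ I.card)
    (h : ∀ᶠ t in atTop, ((config A φ t).party i).received j .third = some (.set I))
    (hT : ∀ᶠ t in atTop, I ⊆ ((config A φ t).party i).T) :
    ∀ᶠ t in atTop, j ∈ ((config A φ t).party i).U.image Prod.fst := by
  refine eventually_of_rule hf hA hi (.gatherThird j I) (D := fun st => j ∈ st.U.image Prod.fst)
    (fun a b hab h => Finset.image_subset_image hab.U h) ?_ fun st _ => ?_
  · filter_upwards [eventually_gatherCalled hf hA hi, h, hT] with t h1 h2 h3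
    exact or_iff_not_imp_left.2 fun h4 => ⟨h1, h2, hc, h3, h4⟩
  · simp only [ruleEffect]
    split <;> simp

/-- The entries of the sets `U` of any two parties are consistent. -/
lemma eq_of_mem_U (hf : 3 * f < n) (hA : Fair A φ) {s t : ℕ} {i j k : Fin n}
    {W W' : Finset (Fin n)} (h : (j, W) ∈ ((config A φ s).party i).U)
    (h' : (j, W') ∈ ((config A φ t).party k).U) : W = W' := by
  have g := (phaseInv hf A φ s i).gather
  have g' := (phaseInv hf A φ t k).gather
  obtain ⟨I, h1, -, h2, h3⟩ := g.received_of_mem_U j W h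
  obtain ⟨I', h1', -, h2', h3'⟩ := g'.received_of_mem_U j W' h'
  have := received_agree hf hA h1 h1'
  simp only [Payload.set.injEq] at this
  subst this
  ext a
  rw [h3, h3']
  refine exists_congr fun l => and_congr_right fun hl => ?_
  obtain ⟨B, hB, -⟩ := g.received_of_mem_T l (h2 hl)
  obtain ⟨B', hB', -⟩ := g'.received_of_mem_T l (h2' hl)
  rw [hB, hB', received_agree hf hA hB hB']

lemma eventually_mem_U (hf : 3 * f < n) (hA : Fair A φ) {s : ℕ} {i j k : Fin n}
    {W : Finset (Fin n)} (h : (j, W) ∈ ((config A φ s).party k).U) (hi : Nonfaulty A φ i) :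
    ∀ᶠ t in atTop, (j, W) ∈ ((config A φ t).party i).U := by
  obtain ⟨I, h1, h2, h3, -⟩ := (phaseInv hf A φ s k).gather.received_of_mem_U j W h
  filter_upwards [eventually_mem_U_of_received hf hA hi h2 (eventually_received hf hA h1 hi)
    (eventually_subset_T hf hA h3 hi)] with t ht
  obtain ⟨⟨j', W'⟩, hq, rfl⟩ := Finset.mem_image.1 ht
  rwa [eq_of_mem_U hf hA h hq]

/-- If `GatherVerify` terminates for one party, it terminates for all. -/
lemma eventually_gatherVerify (hf : 3 * f < n) (hA : Fair A φ) {s : ℕ} {i k : Fin n}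
    {I : Finset (Fin n)} (h : GatherVerify ((config A φ s).party k) I) (hi : Nonfaulty A φ i) :
    ∀ᶠ t in atTop, GatherVerify ((config A φ t).party i) I := by
  obtain ⟨⟨Q, h1, h2⟩, h3⟩ := gatherVerify_iff.1 h
  have h4 : ∀ᶠ t in atTop, ∀ j ∈ Q, ∃ W, (j, W) ∈ ((config A φ t).party i).U ∧ W ⊆ I := by
    refine (eventually_all_finset Q).2 fun j hj => ?_
    obtain ⟨W, hW, hWI⟩ := h2 j hj
    exact (eventually_mem_U hf hA hW hi).mono fun t ht => ⟨W, ht, hWI⟩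
  filter_upwards [h4, eventually_subset_S hf hA h3 hi] with t h5 h6
  exact gatherVerify_iff.2 ⟨⟨Q, h1, h5⟩, h6⟩

lemma eventually_gatherOut (hf : 3 * f < n) (hA : Fair A φ) {i : Fin n}
    (hi : Nonfaulty A φ i) : ∀ᶠ t in atTop, ((config A φ t).party i).gatherOut ≠ none := by
  have h : ∀ᶠ t in atTop, ∀ j ∈ nonfaulty A φ,
      j ∈ ((config A φ t).party i).U.image Prod.fst := by
    refine (eventually_all_finset (nonfaulty A φ)).2 fun j hj => ?_
    rw [mem_nonfaulty] at hj
    obtain ⟨s, m, ⟨I, rfl, h1, h2⟩, h⟩ := exists_load_received (tag := .third) hf hA hj <| by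
      filter_upwards [eventually_nonfaulty_subset_T hf hA hj] with t ht
      exact (le_card_nonfaulty hf A φ).trans (Finset.card_le_card ht)
    exact eventually_mem_U_of_received hf hA hi h1 (h i hi) (eventually_subset_T hf hA h2 hi)
  filter_upwards [h] with t ht
  rw [(phaseInv hf A φ t i).gather.gatherOut]
  exact (le_card_nonfaulty hf A φ).trans ((Finset.card_le_card ht).trans Finset.card_image_le)

/-- The output of `Gather` passes `GatherVerify`. -/
lemma PhaseInv.gatherVerify {st : PartyState P} (h : PhaseInv st) {X : Finset P.Tuple}
    (hX : st.gatherOut = some X) : GatherVerify st (indexSet X) := by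
  obtain ⟨h1, h2⟩ := h.gather.gatherOut_eq X hX
  refine gatherVerify_iff.2 ⟨h2, fun k hk => ?_⟩
  obtain ⟨⟨k', x, d⟩, hq, rfl⟩ := Finset.mem_image.1 hk
  exact (h.gather.mem_S _).2 ⟨x, d, h1 hq⟩

/-- The tuples of any two parties are consistent. -/
lemma eq_of_mem_R (hf : 3 * f < n) (hA : Fair A φ) {s t : ℕ} {i j k : Fin n} {x x' : V}
    {d d' : P.vrf.Dkg} (h : (k, x, d) ∈ ((config A φ s).party i).R)
    (h' : (k, x', d') ∈ ((config A φ t).party j).R) : x = x' ∧ d = d' := by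
  have := received_agree hf hA ((phaseInv hf A φ s i).gather.received_of_mem_R _ _ _ h)
    ((phaseInv hf A φ t j).gather.received_of_mem_R _ _ _ h')
  simpa using this

lemma PhaseInv.valid_of_mem_R {st : PartyState P} (h : PhaseInv st) {k : Fin n} {x : V}
    {d : P.vrf.Dkg} (hR : (k, x, d) ∈ st.R) :
    P.validate x = true ∧ P.vrf.dkgVerify d = true := by
  have h2 := ((h.broadcast k .input).output_ready _ (h.gather.received_of_mem_R _ _ _ hR)).2.1
  simpa [loadValid, checkValidity] using h2

lemma PhaseInv.eq_of_mem_R {st : PartyState P} (h : PhaseInv st) {k : Fin n} {x x' : V}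
    {d d' : P.vrf.Dkg} (hR : (k, x, d) ∈ st.R) (hR' : (k, x', d') ∈ st.R) : x = x' ∧ d = d' := by
  have := (h.gather.received_of_mem_R _ _ _ hR).symm.trans (h.gather.received_of_mem_R _ _ _ hR')
  simpa using this

end Fair

/-! ### The evaluation phase -/

/-- The tuple `(l, _, d)` has the maximal evaluation among those in `X`; ties are broken in favour
of the smallest index. -/
def Best (φ : P.Phi) (X : Finset P.Tuple) (l : Fin n) (d : P.vrf.Dkg) : Prop :=
  ∀ q ∈ X, φ q.2.2 q.1 < φ d l ∨ (φ q.2.2 q.1 = φ d l ∧ l ≤ q.1)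

/-- The condition of `PEVerify` for the index set of `X` and the proposal `x` of `l`, with the
values of the random function in place of the evaluations found by the party. In this form it is
plainly stable, and the same for all parties. -/
structure Verifies (φ : P.Phi) (st : PartyState P) (X : Finset P.Tuple) (l : Fin n) (x : V)
    (d : P.vrf.Dkg) : Prop where
  subset : X ⊆ st.startEval
  evals : ∀ q ∈ X, ∃ e, (q.1, e) ∈ st.evals
  gatherVerify : GatherVerify st (indexSet X)
  mem : (l, x, d) ∈ X
  best : Best φ X l d

lemma gatherVerify_mono {st st' : PartyState P} (h : PLe st st') {I : Finset (Fin n)}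
    (hI : GatherVerify st I) : GatherVerify st' I := by
  rw [gatherVerify_iff] at hI ⊢
  exact ⟨hI.1.mono h.U, hI.2.trans h.S⟩

lemma Verifies.mono {φ : P.Phi} {st st' : PartyState P} {X : Finset P.Tuple} {l : Fin n} {x : V}
    {d : P.vrf.Dkg} (hv : Verifies φ st X l x d) (h : PLe st st') : Verifies φ st' X l x d :=
  ⟨hv.subset.trans h.startEval, fun q hq => (hv.evals q hq).imp fun _ he => h.evals he,
    gatherVerify_mono h hv.gatherVerify, hv.mem, hv.best⟩

/-- Invariants of the evaluation phase. -/
structure EvalInv (φ : P.Phi) (st : PartyState P) : Prop where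
  startEval_subset : st.startEval ⊆ st.R
  startEval_from : ∀ q ∈ st.startEval, ∃ j I, st.received j .indices = some (.set I) ∧
    GatherVerify st I ∧ q.1 ∈ I
  gatherOut : st.startEval.Nonempty → st.gatherOut ≠ none
  indicesDone : ∀ j ∈ st.indicesDone, ∃ I, st.received j .indices = some (.set I) ∧ I ⊆ st.S ∧
    ∀ q ∈ st.R, q.1 ∈ I → q ∈ st.startEval
  evalDone : ∀ j k, (j, k) ∈ st.evalDone → ∃ es ps x d, st.evalMsg j k = some (es, ps) ∧
    (k, x, d) ∈ st.startEval ∧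
    (P.vrf.evalShVerify d (P.vrf.pk j) k es ps = true → (j, es, ps) ∈ st.evalShares k)
  evalShares : ∀ k q, q ∈ st.evalShares k → (q.1, k) ∈ st.evalDone ∧ ∃ x d,
    (k, x, d) ∈ st.startEval ∧ P.vrf.evalShVerify d (P.vrf.pk q.1) k q.2.1 q.2.2 = true
  inj_evalShares : ∀ k, Set.InjOn Prod.fst
    (st.evalShares k : Set (Fin n × P.vrf.EvalShare × P.vrf.ProofShare))
  exists_eval : ∀ k, n - f ≤ (st.evalShares k).card → ∃ e, (k, e) ∈ st.evals
  evals_eq : ∀ k e, (k, e) ∈ st.evals → ∃ x d, (k, x, d) ∈ st.startEval ∧ e = φ d k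
  out : ∀ x π, st.out = some (x, π) → ∃ X l d, indexSet X = π ∧ Verifies φ st X l x d

/-- The evaluation computed from `n - f` verifying shares is the value of the random function. -/
lemma eval_eq (hf : 3 * f < n) (φ : P.Phi) {d : P.vrf.Dkg} (hd : P.vrf.dkgVerify d = true)
    {k : Fin n} {F : Finset (Fin n × P.vrf.EvalShare × P.vrf.ProofShare)}
    (hinj : Set.InjOn Prod.fst (F : Set (Fin n × P.vrf.EvalShare × P.vrf.ProofShare)))
    (hF : ∀ q ∈ F, P.vrf.evalShVerify d (P.vrf.pk q.1) k q.2.1 q.2.2 = true)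
    (hc : F.card = n - f) : (P.vrf.eval φ d k F).1 = φ d k := by
  refine (P.vrf.uniqueness φ d k _ hd).1 ⟨_, P.vrf.eval_correct φ d k F hd ?_ hF⟩
  rw [Finset.card_image_of_injOn hinj, hc]
  omega

lemma EvalInv.eval_eq_of_mem {φ : P.Phi} {st : PartyState P} (h : EvalInv φ st) (hp : PhaseInv st)
    {k : Fin n} {x : V} {d : P.vrf.Dkg} (hR : (k, x, d) ∈ st.R) {e : Fin (2 ^ lam)}
    (he : (k, e) ∈ st.evals) : (k, x, d) ∈ st.startEval ∧ e = φ d k := by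
  obtain ⟨x', d', h1, rfl⟩ := h.evals_eq k e he
  obtain ⟨rfl, rfl⟩ := hp.eq_of_mem_R hR (h.startEval_subset h1)
  exact ⟨h1, rfl⟩

lemma EvalInv.isArgmax_iff {φ : P.Phi} {st : PartyState P} (h : EvalInv φ st) (hp : PhaseInv st)
    {X : Finset P.Tuple} (hX : X ⊆ st.R) (he : ∀ q ∈ X, ∃ e, (q.1, e) ∈ st.evals) {l : Fin n}
    {x : V} {d : P.vrf.Dkg} (hl : (l, x, d) ∈ X) :
    IsArgmax st.evals (indexSet X) l ↔ Best φ X l d := by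
  obtain ⟨e, hel⟩ := he _ hl
  obtain ⟨-, rfl⟩ := h.eval_eq_of_mem hp (hX hl) hel
  constructor
  · rintro ⟨-, e, he', hbest⟩ ⟨k, y, c⟩ hq
    obtain ⟨-, rfl⟩ := h.eval_eq_of_mem hp (hX hl) he'
    obtain ⟨e, hek⟩ := he _ hq
    obtain ⟨-, rfl⟩ := h.eval_eq_of_mem hp (hX hq) hek
    exact hbest k (Finset.mem_image_of_mem Prod.fst hq) _ hek
  · intro hbest
    refine ⟨Finset.mem_image_of_mem Prod.fst hl, _, hel, fun k hk e' he' => ?_⟩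
    obtain ⟨⟨k', y, c⟩, hq, rfl⟩ := Finset.mem_image.1 hk
    obtain ⟨-, rfl⟩ := h.eval_eq_of_mem hp (hX hq) he'
    exact hbest _ hq

/-- `X` is the set of the tuples in `startEval` with an index in `π`. -/
lemma EvalInv.peVerify_iff {φ : P.Phi} {st : PartyState P} (h : EvalInv φ st) (hp : PhaseInv st)
    {x : V} {π : Finset (Fin n)} :
    PEVerify st x π ↔ ∃ X l d, indexSet X = π ∧ Verifies φ st X l x d := by
  constructor
  · rintro ⟨h1, h2, l, h3, d, h4⟩
    have hX : indexSet (st.startEval.filter fun q => q.1 ∈ π) = π := by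
      ext k
      simp only [indexSet, Finset.mem_image, Finset.mem_filter]
      constructor
      · rintro ⟨q, ⟨-, hq⟩, rfl⟩; exact hq
      · intro hk
        obtain ⟨y, c, hm⟩ := (h1 k hk).2
        exact ⟨_, ⟨hm, hk⟩, rfl⟩
    have hsub : (st.startEval.filter fun q => q.1 ∈ π) ⊆ st.startEval := Finset.filter_subset _ _
    have hl : (l, x, d) ∈ st.startEval.filter fun q => q.1 ∈ π :=
      Finset.mem_filter.2 ⟨h4, h3.1⟩
    have he : ∀ q ∈ st.startEval.filter fun q => q.1 ∈ π, ∃ e, (q.1, e) ∈ st.evals :=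
      fun q hq => (h1 _ (Finset.mem_filter.1 hq).2).1
    refine ⟨_, l, d, hX, hsub, he, by rwa [hX], hl, ?_⟩
    rw [← h.isArgmax_iff hp (hsub.trans h.startEval_subset) he hl, hX]
    exact h3
  · rintro ⟨X, l, d, rfl, hv⟩
    refine ⟨fun k hk => ?_, hv.gatherVerify, l, ?_, d, hv.subset hv.mem⟩
    · obtain ⟨⟨k', y, c⟩, hq, rfl⟩ := Finset.mem_image.1 hk
      exact ⟨hv.evals _ hq, y, c, hv.subset hq⟩
    · rw [h.isArgmax_iff hp (hv.subset.trans h.startEval_subset) hv.evals hv.mem]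
      exact hv.best

lemma EvalInv.init (hf : 3 * f < n) (φ : P.Phi) : EvalInv φ (PartyState.init P) := by
  constructor <;> simp [PartyState.init]
  omega

/-- The invariant is preserved when only the fields of the earlier phases change. A tuple may be
added to `R` only for a new index, because otherwise an index set that has been handled would
acquire a tuple that is not evaluated. -/
lemma EvalInv.mono {φ : P.Phi} {st st' : PartyState P} (h : EvalInv φ st) (hle : PLe st st')
    (hR : ∀ q ∈ st'.R, q ∈ st.R ∨ q.1 ∉ st.S)
    (h1 : st'.startEval = st.startEval) (h2 : st'.indicesDone = st.indicesDone)
    (h3 : st'.evalDone = st.evalDone) (h4 : st'.evalShares = st.evalShares)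
    (h5 : st'.evals = st.evals) (h6 : st'.out = st.out) : EvalInv φ st' where
  startEval_subset := by rw [h1]; exact h.startEval_subset.trans hle.R
  startEval_from q hq := by
    rw [h1] at hq
    obtain ⟨j, I, h7, h8, h9⟩ := h.startEval_from q hq
    exact ⟨j, I, hle.received h7, gatherVerify_mono hle h8, h9⟩
  gatherOut hne := by
    rw [h1] at hne
    obtain ⟨X, hX⟩ := Option.ne_none_iff_exists'.1 (h.gatherOut hne)
    simp [hle.gatherOut X hX]
  indicesDone j hj := by
    rw [h2] at hj
    obtain ⟨I, h7, h8, h9⟩ := h.indicesDone j hj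
    refine ⟨I, hle.received h7, h8.trans hle.S, fun q hq hI => ?_⟩
    rw [h1]
    exact h9 q ((hR q hq).resolve_right (not_not_intro (h8 hI))) hI
  evalDone j k hjk := by
    rw [h3] at hjk
    obtain ⟨es, ps, x, d, h7, h8, h9⟩ := h.evalDone j k hjk
    exact ⟨es, ps, x, d, hle.evalMsg _ _ _ h7, h1 ▸ h8, h4 ▸ h9⟩
  evalShares k q := by rw [h1, h3, h4]; exact h.evalShares k q
  inj_evalShares := by rw [h4]; exact h.inj_evalShares
  exists_eval := by rw [h4, h5]; exact h.exists_eval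
  evals_eq := by rw [h1, h5]; exact h.evals_eq
  out x π hx := by
    rw [h6] at hx
    obtain ⟨X, l, d, h7, h8⟩ := h.out x π hx
    exact ⟨X, l, d, h7, h8.mono hle⟩

/-- A new verifying share comes from a new party, and is for the same transcript as the others. -/
lemma EvalInv.insert_share {φ : P.Phi} {st : PartyState P} (h : EvalInv φ st) (hp : PhaseInv st)
    {j k : Fin n} {x : V} {d : P.vrf.Dkg} (h2 : (k, x, d) ∈ st.startEval)
    (h3 : (j, k) ∉ st.evalDone) {es : P.vrf.EvalShare} {ps : P.vrf.ProofShare}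
    (hv : P.vrf.evalShVerify d (P.vrf.pk j) k es ps = true) :
    j ∉ (st.evalShares k).image Prod.fst ∧
    Set.InjOn Prod.fst ((insert (j, es, ps) (st.evalShares k) :
      Finset (Fin n × P.vrf.EvalShare × P.vrf.ProofShare)) :
        Set (Fin n × P.vrf.EvalShare × P.vrf.ProofShare)) ∧
    ∀ q ∈ insert (j, es, ps) (st.evalShares k),
      P.vrf.evalShVerify d (P.vrf.pk q.1) k q.2.1 q.2.2 = true := by
  have hnew : j ∉ (st.evalShares k).image Prod.fst := by
    intro hm
    obtain ⟨q, hq, rfl⟩ := Finset.mem_image.1 hm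
    exact h3 (h.evalShares k q hq).1
  refine ⟨hnew, injOn_insert_fst (h.inj_evalShares k) hnew, fun q hq => ?_⟩
  rcases Finset.mem_insert.1 hq with rfl | hq
  · exact hv
  · obtain ⟨-, x', d', h5, h6⟩ := h.evalShares k q hq
    obtain ⟨-, rfl⟩ := hp.eq_of_mem_R (h.startEval_subset h2) (h.startEval_subset h5)
    exact h6

lemma EvalInv.step (hf : 3 * f < n) {φ : P.Phi} {i : Fin n} {st st' : PartyState P}
    (hp : PhaseInv st) (h : EvalInv φ st) (hs : PStep φ i st st') : EvalInv φ st' := by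
  have hle := hp.le_step hs
  cases hs with
  | start x hn hx => exact h.mono hle (fun q => .inl) rfl rfl rfl rfl rfl rfl
  | receive src m hin =>
    revert hle
    cases m with
    | dkg s =>
      simp only [receiveEffect]
      split
      · exact fun _ => h
      split
      · exact fun _ => h
      split <;> exact fun hle => h.mono hle (fun q => .inl) rfl rfl rfl rfl rfl rfl
    | rb d tag m => exact fun hle => h.mono hle (fun q => .inl) rfl rfl rfl rfl rfl rfl
    | eval k es ps =>
      simp only [receiveEffect]
      split <;> exact fun hle => h.mono hle (fun q => .inl) rfl rfl rfl rfl rfl rfl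
  | rule r hr =>
    revert hle
    cases r with
    | gatherInput j x d =>
      refine fun hle => h.mono hle (fun q hq => ?_) rfl rfl rfl rfl rfl rfl
      rcases Finset.mem_insert.1 hq with rfl | hq
      · exact .inr hr.2.2
      · exact .inl hq
    | gatherSecond j I => exact fun hle => h.mono hle (fun q => .inl) rfl rfl rfl rfl rfl rfl
    | gatherThird j I =>
      simp only [ruleEffect]
      split <;> exact fun hle => h.mono hle (fun q => .inl) rfl rfl rfl rfl rfl rfl
    | evaluate j I =>
      intro hle
      obtain ⟨h1, h2, h3, h4⟩ := hr
      have hsub : gatherVerifyOut st I ⊆ st.R := Finset.filter_subset _ _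
      exact {
        startEval_subset := Finset.union_subset h.startEval_subset hsub
        startEval_from := fun q hq => by
          rcases Finset.mem_union.1 hq with hq | hq
          · exact h.startEval_from q hq
          · exact ⟨j, I, h1, h2, (Finset.mem_filter.1 hq).2⟩
        gatherOut := fun _ => h3
        indicesDone := fun k hk => by
          rcases Finset.mem_insert.1 hk with rfl | hk
          · exact ⟨I, h1, h2.2, fun q hq hI =>
              Finset.mem_union_right _ (Finset.mem_filter.2 ⟨hq, hI⟩)⟩
          · obtain ⟨I', h5, h6, h7⟩ := h.indicesDone k hk
            exact ⟨I', h5, h6, fun q hq hI => Finset.mem_union_left _ (h7 q hq hI)⟩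
        evalDone := fun k l hkl => by
          obtain ⟨es, ps, x, d, h5, h6, h7⟩ := h.evalDone k l hkl
          exact ⟨es, ps, x, d, h5, Finset.mem_union_left _ h6, h7⟩
        evalShares := fun k q hq => by
          obtain ⟨h5, x, d, h6, h7⟩ := h.evalShares k q hq
          exact ⟨h5, x, d, Finset.mem_union_left _ h6, h7⟩
        inj_evalShares := h.inj_evalShares
        exists_eval := h.exists_eval
        evals_eq := fun k e hk => by
          obtain ⟨x, d, h5, h6⟩ := h.evals_eq k e hk
          exact ⟨x, d, Finset.mem_union_left _ h5, h6⟩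
        out := fun x π hx => by
          obtain ⟨X, l, d, h7, h8⟩ := h.out x π hx
          exact ⟨X, l, d, h7, h8.mono hle⟩ }
    | addShare j k x d =>
      obtain ⟨h1, h2, h3⟩ := hr
      obtain ⟨⟨es, ps⟩, hmsg⟩ := Option.ne_none_iff_exists'.1 h1
      simp only [ruleEffect, hmsg]
      have hR := h.startEval_subset h2
      split
      · rename_i hv
        intro hle
        obtain ⟨hnew, hinj, hF⟩ := h.insert_share hp h2 h3 hv
        have hcard := card_insert_fst (b := (es, ps)) hnew
        have hshares : ∀ l, Function.update st.evalShares k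
            (insert (j, es, ps) (st.evalShares k)) l =
            if l = k then insert (j, es, ps) (st.evalShares k) else st.evalShares l := fun l => by
          rw [Function.update_apply]
        refine {
          startEval_subset := h.startEval_subset
          startEval_from := h.startEval_from
          gatherOut := h.gatherOut
          indicesDone := h.indicesDone
          evalDone := fun a l hal => ?_
          evalShares := fun l q hq => ?_
          inj_evalShares := fun l => ?_
          exists_eval := fun l hl => ?_
          evals_eq := fun l e hl => ?_
          out := fun x π hx => ?_ }
        · rcases Finset.mem_insert.1 hal with e | hal
          · simp only [Prod.mk.injEq] at e
            obtain ⟨rfl, rfl⟩ := e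
            exact ⟨es, ps, x, d, hmsg, h2, fun _ => by simp⟩
          · obtain ⟨es', ps', x', d', h5, h6, h7⟩ := h.evalDone a l hal
            exact ⟨es', ps', x', d', h5, h6, fun hv => hle.evalShares l (h7 hv)⟩
        · dsimp only at hq ⊢
          rw [hshares] at hq
          split at hq
          · rename_i hl
            subst hl
            refine ⟨?_, x, d, h2, hF q hq⟩
            rcases Finset.mem_insert.1 hq with rfl | hq
            · exact Finset.mem_insert_self _ _
            · exact Finset.mem_insert_of_mem (h.evalShares l q hq).1
          · obtain ⟨h5, h6⟩ := h.evalShares l q hq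
            exact ⟨Finset.mem_insert_of_mem h5, h6⟩
        · dsimp only
          rw [hshares]
          split
          · exact hinj
          · exact h.inj_evalShares l
        · dsimp only at hl ⊢
          rw [hshares] at hl
          split at hl
          · rename_i hlk
            subst hlk
            split
            · exact ⟨_, Finset.mem_insert_self _ _⟩
            · exact h.exists_eval l (by omega)
          · obtain ⟨e, he⟩ := h.exists_eval l hl
            exact ⟨e, hle.evals he⟩
        · dsimp only at hl
          split at hl
          · rename_i hc
            rcases Finset.mem_insert.1 hl with e' | hl
            · simp only [Prod.mk.injEq] at e'
              obtain ⟨rfl, rfl⟩ := e'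
              exact ⟨x, d, h2, eval_eq hf φ (hp.valid_of_mem_R hR).2 hinj hF hc⟩
            · exact h.evals_eq l e hl
          · exact h.evals_eq l e hl
        · obtain ⟨X, l, d, h7, h8⟩ := h.out x π hx
          exact ⟨X, l, d, h7, h8.mono hle⟩
      · rename_i hv
        intro hle
        exact {
          startEval_subset := h.startEval_subset
          startEval_from := h.startEval_from
          gatherOut := h.gatherOut
          indicesDone := h.indicesDone
          evalDone := fun a l hal => by
            rcases Finset.mem_insert.1 hal with e | hal
            · simp only [Prod.mk.injEq] at e
              obtain ⟨rfl, rfl⟩ := e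
              exact ⟨es, ps, x, d, hmsg, h2, fun hv' => absurd hv' hv⟩
            · exact h.evalDone a l hal
          evalShares := fun l q hq => by
            obtain ⟨h5, h6⟩ := h.evalShares l q hq
            exact ⟨Finset.mem_insert_of_mem h5, h6⟩
          inj_evalShares := h.inj_evalShares
          exists_eval := h.exists_eval
          evals_eq := h.evals_eq
          out := fun x π hx => by
            obtain ⟨X, l, d, h7, h8⟩ := h.out x π hx
            exact ⟨X, l, d, h7, h8.mono hle⟩ }
    | output l x =>
      obtain ⟨-, X, hX, -, he, harg, d, hl⟩ := hr
      simp only [ruleEffect, hX]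
      intro hle
      refine ⟨h.1, h.2, fun _ => by simp, h.4, h.5, h.6, h.7, h.8, h.9, fun y π hy => ?_⟩
      simp only [Option.some.injEq, Prod.mk.injEq] at hy
      obtain ⟨rfl, rfl⟩ := hy
      have hXR := (hp.gather.gatherOut_eq X hX).1
      refine ⟨X, l, d, rfl, fun q hq => ?_, he, hp.gatherVerify hX, hl,
        (h.isArgmax_iff hp hXR he hl).1 harg⟩
      obtain ⟨e, heq⟩ := he q hq
      exact (h.eval_eq_of_mem hp (x := q.2.1) (d := q.2.2) (hXR hq) heq).1

lemma evalInv (hf : 3 * f < n) (A : Adversary P) (φ : P.Phi) (t : ℕ) (i : Fin n) :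
    EvalInv φ ((config A φ t).party i) :=
  (party_induction (Q := fun _ st => PhaseInv st ∧ EvalInv φ st) A φ
    (fun _ => ⟨.init hf, .init hf φ⟩)
    (fun _ _ _ hs h => ⟨h.1.step hf hs, h.2.step hf h.1 hs⟩) t i).2

/-! ### Progress of the evaluation phase -/

/-- The message with the evaluation share of party `i` for `(k, _, d)`. -/
def evalMessage (i k : Fin n) (d : P.vrf.Dkg) : Msg P :=
  .eval k (P.vrf.evalSh d (P.vrf.sk i) k (P.evalCoin i d k)).1
    (P.vrf.evalSh d (P.vrf.sk i) k (P.evalCoin i d k)).2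

/-- The evaluation shares that have been sent, and the points that have been opened, are those of
the tuples in the sets `startEval`. -/
structure EvalSent (c : Config P) : Prop where
  of_sent : ∀ i j k es ps, (i, j, Msg.eval k es ps) ∈ c.sent →
    ∃ x d, (k, x, d) ∈ (c.party i).startEval ∧ Msg.eval k es ps = evalMessage (P := P) i k d
  sent : ∀ i j k x d, (k, x, d) ∈ (c.party i).startEval → (i, j, evalMessage i k d) ∈ c.sent
  evalMsg : ∀ i j k es ps, (c.party i).evalMsg j k = some (es, ps) →
    j ∈ c.faulty ∨ (j, i, Msg.eval k es ps) ∈ c.sent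
  opened : ∀ d k, (d, k) ∈ c.opened ↔ ∃ i x, (k, x, d) ∈ (c.party i).startEval

/-- The effect does not start any evaluation. -/
def NoEval (st : PartyState P) (e : Effect P) : Prop :=
  e.state.startEval = st.startEval ∧ (∀ j k es ps, (j, Msg.eval k es ps) ∉ e.sends) ∧
    e.evaluates = ∅

lemma noEval_start (i : Fin n) (x : V) (st : PartyState P) : NoEval st (startEffect i x st) :=
  ⟨rfl, by simp [startEffect], rfl⟩

lemma noEval_receive (i src : Fin n) (st : PartyState P) (m : Msg P) :
    NoEval st (receiveEffect i src st m) := by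
  cases m <;> simp only [receiveEffect] <;> (repeat' split) <;>
    refine ⟨rfl, ?_, rfl⟩ <;> simp [rbStart, toAll]

lemma noEval_rule {φ : P.Phi} (i : Fin n) (st : PartyState P) {r : Rule P}
    (hr : ∀ j I, r ≠ .evaluate j I) : NoEval st (ruleEffect φ i st r) := by
  cases r with
  | evaluate j I => exact absurd rfl (hr j I)
  | gatherInput | gatherSecond =>
    refine ⟨rfl, ?_, rfl⟩
    simp only [ruleEffect]
    split <;> simp [rbStart]
  | gatherThird =>
    simp only [ruleEffect]
    split <;> refine ⟨rfl, ?_, rfl⟩ <;> simp [rbStart]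
  | addShare =>
    simp only [ruleEffect]
    (repeat' split) <;> refine ⟨rfl, ?_, rfl⟩ <;> simp
  | output =>
    simp only [ruleEffect]
    split <;> refine ⟨rfl, ?_, rfl⟩ <;> simp

lemma ruleEffect_evalMsg (φ : P.Phi) (i : Fin n) (st : PartyState P) (r : Rule P) :
    (ruleEffect φ i st r).state.evalMsg = st.evalMsg := by
  cases r <;> simp only [ruleEffect] <;> (repeat' split) <;> rfl

lemma receiveEffect_evalMsg {i src : Fin n} {st : PartyState P} {m : Msg P} {j k : Fin n}
    {es : P.vrf.EvalShare} {ps : P.vrf.ProofShare}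
    (h : (receiveEffect i src st m).state.evalMsg j k = some (es, ps)) :
    st.evalMsg j k = some (es, ps) ∨ (j = src ∧ m = .eval k es ps) := by
  cases m with
  | dkg s =>
    left
    simp only [receiveEffect] at h
    repeat' split at h
    all_goals exact h
  | rb => exact .inl h
  | eval l es' ps' =>
    simp only [receiveEffect] at h
    split at h
    · dsimp only at h
      by_cases hj : j = src
      · subst hj
        rw [Function.update_self] at h
        by_cases hk : k = l
        · subst hk
          rw [Function.update_self] at h
          simp only [Option.some.injEq, Prod.mk.injEq] at h
          obtain ⟨rfl, rfl⟩ := h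
          exact .inr ⟨rfl, rfl⟩
        · rw [Function.update_of_ne hk] at h
          exact .inl h
      · rw [Function.update_of_ne hj] at h
        exact .inl h
    · exact .inl h

lemma evalMsg_ne_none_receive {i src k : Fin n} {st : PartyState P} {es : P.vrf.EvalShare}
    {ps : P.vrf.ProofShare} :
    (receiveEffect i src st (.eval k es ps)).state.evalMsg src k ≠ none := by
  simp only [receiveEffect]
  split
  · simp
  · assumption

lemma EvalSent.apply {c : Config P} (h : EvalSent c) {i : Fin n} {e : Effect P}
    (he : NoEval (c.party i) e)
    (hm : ∀ j k es ps, e.state.evalMsg j k = some (es, ps) →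
      (c.party i).evalMsg j k = some (es, ps) ∨ j ∈ c.faulty ∨
        (j, i, Msg.eval k es ps) ∈ c.sent) : EvalSent (c.apply i e) := by
  have hse : ∀ j, ((c.apply i e).party j).startEval = (c.party j).startEval := fun j => by
    by_cases hj : j = i
    · subst hj; rw [apply_party_self, he.1]
    · rw [apply_party_of_ne c hj]
  refine ⟨fun a j k es ps hx => ?_, fun a j k x d hx => ?_, fun a j k es ps hx => ?_,
    fun d k => ?_⟩
  · rw [hse]
    exact h.of_sent a j k es ps
      ((mem_apply_sent.1 hx).resolve_right fun hx => he.2.1 _ _ _ _ hx.2)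
  · rw [hse] at hx
    exact mem_apply_sent.2 (.inl (h.sent a j k x d hx))
  · have old : (c.party a).evalMsg j k = some (es, ps) →
        j ∈ (c.apply i e).faulty ∨ (j, a, Msg.eval k es ps) ∈ (c.apply i e).sent := fun hx =>
      (h.evalMsg a j k es ps hx).imp id fun h => mem_apply_sent.2 (.inl h)
    by_cases ha : a = i
    · subst ha
      rw [apply_party_self] at hx
      exact (hm j k es ps hx).elim old fun h => h.imp id fun h => mem_apply_sent.2 (.inl h)
    · rw [apply_party_of_ne c ha] at hx
      exact old hx
  · simp only [hse]
    rw [← h.opened]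
    simp [Config.apply, he.2.2]

lemma EvalSent.step {φ : P.Phi} {c c' : Config P} (h : EvalSent c)
    (hs : GStep φ c c') : EvalSent c' := by
  cases hs with
  | idle => exact h
  | corrupt i hi =>
    exact ⟨h.of_sent, h.sent, fun a j k es ps hx =>
      (h.evalMsg a j k es ps hx).imp_left Finset.mem_insert_of_mem, h.opened⟩
  | start i x hi hn hx => exact h.apply (noEval_start i x _) fun j k es ps hx => .inl hx
  | deliver src i m hi hin hm =>
    refine h.apply (noEval_receive i src _ m) fun j k es ps hx =>
      (receiveEffect_evalMsg hx).imp id ?_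
    rintro ⟨rfl, rfl⟩
    exact hm
  | rule i r hi hr =>
    by_cases hev : ∀ j I, r ≠ .evaluate j I
    · refine h.apply (noEval_rule i _ hev) fun j k es ps hx => .inl ?_
      rwa [ruleEffect_evalMsg] at hx
    push Not at hev
    obtain ⟨j, I, rfl⟩ := hev
    have hse : ∀ a q,
        q ∈ ((c.apply i (ruleEffect φ i (c.party i) (.evaluate j I))).party a).startEval ↔
        q ∈ (c.party a).startEval ∨
          (a = i ∧ q ∈ gatherVerifyOut (c.party i) I \ (c.party i).startEval) := fun a q => by
      by_cases ha : a = i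
      · subst ha
        rw [apply_party_self]
        simp only [ruleEffect, Finset.mem_union, true_and, Finset.mem_sdiff]
        tauto
      · rw [apply_party_of_ne c ha]
        simp [ha]
    refine ⟨fun a b k es ps hx => ?_, fun a b k x d hx => ?_, fun a b k es ps hx => ?_,
      fun d k => ?_⟩
    · rcases mem_apply_sent.1 hx with hx | ⟨e, hx⟩
      · obtain ⟨x, d, h1, h2⟩ := h.of_sent a b k es ps hx
        exact ⟨x, d, (hse _ _).2 (.inl h1), h2⟩
      · change a = i at e
        subst e
        obtain ⟨k', x, d, h1, h2⟩ := hx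
        have h3 : Msg.eval k es ps = evalMessage (P := P) a k' d := h2
        have hk : k = k' := by
          simp only [evalMessage, Msg.eval.injEq] at h3
          exact h3.1
        subst hk
        exact ⟨x, d, (hse _ _).2 (.inr ⟨rfl, h1⟩), h3⟩
    · rcases (hse _ _).1 hx with hx | ⟨rfl, hx⟩
      · exact mem_apply_sent.2 (.inl (h.sent a b k x d hx))
      · exact mem_apply_sent.2 (.inr ⟨rfl, k, x, d, hx, rfl⟩)
    · have hx' : (c.party a).evalMsg b k = some (es, ps) := by
        by_cases ha : a = i
        · subst ha
          rwa [apply_party_self, ruleEffect_evalMsg] at hx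
        · rwa [apply_party_of_ne c ha] at hx
      exact (h.evalMsg a b k es ps hx').imp id fun h => mem_apply_sent.2 (.inl h)
    · simp only [hse]
      constructor
      · rintro (hx | ⟨x, hx⟩)
        · obtain ⟨a, x, hx⟩ := (h.opened d k).1 hx
          exact ⟨a, x, .inl hx⟩
        · exact ⟨i, x, .inr ⟨rfl, hx⟩⟩
      · rintro ⟨a, x, hx | ⟨rfl, hx⟩⟩
        · exact .inl ((h.opened d k).2 ⟨a, x, hx⟩)
        · exact .inr ⟨x, hx⟩

lemma evalSent (hf : 3 * f < n) (A : Adversary P) (φ : P.Phi) (t : ℕ) :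
    EvalSent (config A φ t) := by
  refine config_induction hf A φ ⟨?_, ?_, ?_, ?_⟩ (fun c c' _ hs h => h.step hs) t <;>
    simp [Config.init, PartyState.init]

section Fair

variable {A : Adversary P} {φ : P.Phi}

lemma eventually_indicesDone (hf : 3 * f < n) (hA : Fair A φ) {i j : Fin n}
    {I : Finset (Fin n)} (hi : Nonfaulty A φ i)
    (h : ∀ᶠ t in atTop, ((config A φ t).party i).received j .indices = some (.set I))
    (hv : ∀ᶠ t in atTop, GatherVerify ((config A φ t).party i) I) :
    ∀ᶠ t in atTop, j ∈ ((config A φ t).party i).indicesDone := by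
  refine eventually_of_rule hf hA hi (.evaluate j I) (D := fun st => j ∈ st.indicesDone)
    (fun a b hab h => hab.indicesDone h) ?_ fun st _ => Finset.mem_insert_self _ _
  filter_upwards [h, hv, eventually_gatherOut hf hA hi] with t h1 h2 h3
  exact or_iff_not_imp_left.2 fun h4 => ⟨h1, h2, h3, h4⟩

/-- If one party evaluates a tuple, every never corrupted party does. -/
lemma eventually_startEval (hf : 3 * f < n) (hA : Fair A φ) {s : ℕ} {i j : Fin n}
    {q : P.Tuple} (h : q ∈ ((config A φ s).party j).startEval) (hi : Nonfaulty A φ i) :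
    ∀ᶠ t in atTop, q ∈ ((config A φ t).party i).startEval := by
  have hev := evalInv hf A φ s j
  obtain ⟨l, I, h1, h2, h3⟩ := hev.startEval_from q h
  filter_upwards [eventually_indicesDone hf hA hi (eventually_received hf hA h1 hi)
    (eventually_gatherVerify hf hA h2 hi)] with t ht
  obtain ⟨I', h4, h5, h6⟩ := (evalInv hf A φ t i).indicesDone l ht
  have := received_agree hf hA h1 h4
  simp only [Payload.set.injEq] at this
  subst this
  obtain ⟨x, d, hR⟩ := ((phaseInv hf A φ t i).gather.mem_S q.1).1 (h5 h3)
  obtain ⟨k, x', d'⟩ := q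
  obtain ⟨rfl, rfl⟩ := eq_of_mem_R hf hA (hev.startEval_subset h) hR
  exact h6 _ hR h3

/-- If one party evaluates a tuple, every never corrupted party obtains its evaluation. -/
lemma eventually_evals (hf : 3 * f < n) (hA : Fair A φ) {s : ℕ} {i j k : Fin n} {x : V}
    {d : P.vrf.Dkg} (h : (k, x, d) ∈ ((config A φ s).party j).startEval)
    (hi : Nonfaulty A φ i) :
    ∀ᶠ t in atTop, ∃ e, (k, e) ∈ ((config A φ t).party i).evals := by
  have hR := (evalInv hf A φ s j).startEval_subset h
  have hd := ((phaseInv hf A φ s j).valid_of_mem_R hR).2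
  have hdone : ∀ᶠ t in atTop, ∀ l ∈ nonfaulty A φ,
      (l, k) ∈ ((config A φ t).party i).evalDone := by
    refine (eventually_all_finset (nonfaulty A φ)).2 fun l hl => ?_
    rw [mem_nonfaulty] at hl
    obtain ⟨t₀, ht₀⟩ := (eventually_startEval hf hA h hl).exists
    obtain ⟨t₁, ha, hl₁⟩ := hA.delivers l i _ t₀ hl hi ((evalSent hf A φ t₀).sent l i k x d ht₀)
    have hmsg : ∀ᶠ t in atTop, ((config A φ t).party i).evalMsg l k ≠ none := by
      refine eventually_party hf (D := fun st => st.evalMsg l k ≠ none) (fun a b hab h => ?_)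
        (t₀ := t₁ + 1) ?_
      · obtain ⟨q, hq⟩ := Option.ne_none_iff_exists'.1 h
        simp [hab.evalMsg _ _ _ hq]
      · rw [config_succ_deliver ha hl₁, apply_party_self]
        exact evalMsg_ne_none_receive
    refine eventually_of_rule hf hA hi (.addShare l k x d) (D := fun st => (l, k) ∈ st.evalDone)
      (fun a b hab h => hab.evalDone h) ?_ fun st _ => ?_
    · filter_upwards [hmsg, eventually_startEval hf hA h hi] with t h1 h2
      exact or_iff_not_imp_left.2 fun h3 => ⟨h1, h2, h3⟩
    · simp only [ruleEffect]
      (repeat' split) <;> simp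
  filter_upwards [hdone] with t ht
  refine (evalInv hf A φ t i).exists_eval k ((le_card_nonfaulty hf A φ).trans
    ((Finset.card_le_card (t := (((config A φ t).party i).evalShares k).image Prod.fst)
      fun l hl => ?_).trans Finset.card_image_le))
  -- The recorded share of `l` was sent by `l`, and is for the same transcript, so it verifies.
  obtain ⟨es, ps, x₁, d₁, h1, h2, h3⟩ := (evalInv hf A φ t i).evalDone l k (ht l hl)
  have h4 := ((evalSent hf A φ t).evalMsg i l k es ps h1).resolve_left (mem_nonfaulty.1 hl t)
  obtain ⟨x₂, d₂, h5, h6⟩ := (evalSent hf A φ t).of_sent l i k es ps h4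
  obtain ⟨rfl, rfl⟩ := eq_of_mem_R hf hA hR ((evalInv hf A φ t i).startEval_subset h2)
  obtain ⟨rfl, rfl⟩ := eq_of_mem_R hf hA hR ((evalInv hf A φ t l).startEval_subset h5)
  simp only [evalMessage, Msg.eval.injEq, true_and] at h6
  refine Finset.mem_image.2 ⟨(l, es, ps), h3 ?_, rfl⟩
  rw [h6.1, h6.2]
  exact P.vrf.evalSh_correct d l k _ hd

lemma eventually_verifies (hf : 3 * f < n) (hA : Fair A φ) {s : ℕ} {i j : Fin n}
    {X : Finset P.Tuple} {l : Fin n} {x : V} {d : P.vrf.Dkg}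
    (h : Verifies φ ((config A φ s).party j) X l x d) (hi : Nonfaulty A φ i) :
    ∀ᶠ t in atTop, Verifies φ ((config A φ t).party i) X l x d := by
  have h1 : ∀ᶠ t in atTop, ∀ q ∈ X, q ∈ ((config A φ t).party i).startEval :=
    (eventually_all_finset X).2 fun q hq => eventually_startEval hf hA (h.subset hq) hi
  have h2 : ∀ᶠ t in atTop, ∀ q ∈ X, ∃ e, (q.1, e) ∈ ((config A φ t).party i).evals :=
    (eventually_all_finset X).2 fun q hq =>
      eventually_evals (x := q.2.1) (d := q.2.2) hf hA (h.subset hq) hi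
  filter_upwards [h1, h2, eventually_gatherVerify hf hA h.gatherVerify hi] with t h3 h4 h5
  exact ⟨h3, h4, h5, h.mem, h.best⟩

lemma PhaseInv.nonempty_of_mem_U {st : PartyState P} (h : PhaseInv st) (hf : f < n) {j : Fin n}
    {W : Finset (Fin n)} (hW : (j, W) ∈ st.U) : W.Nonempty := by
  obtain ⟨I, -, h1, h2, h3⟩ := h.gather.received_of_mem_U j W hW
  obtain ⟨k, hk⟩ := Finset.card_pos.1 (lt_of_lt_of_le (Nat.sub_pos_of_lt hf) h1)
  obtain ⟨B, h4, h5, -⟩ := h.gather.received_of_mem_T k (h2 hk)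
  obtain ⟨a, ha⟩ := Finset.card_pos.1 (lt_of_lt_of_le (Nat.sub_pos_of_lt hf) h5)
  exact ⟨a, (h3 a).2 ⟨k, hk, B, h4, ha⟩⟩

lemma exists_best (φ : P.Phi) {X : Finset P.Tuple} (hX : X.Nonempty) :
    ∃ l x d, (l, x, d) ∈ X ∧ Best φ X l d := by
  -- The order of the indices is reversed, so that ties go to the smallest one.
  obtain ⟨⟨l, x, d⟩, h1, h2⟩ := Finset.exists_max_image X
    (fun q => toLex (φ q.2.2 q.1, OrderDual.toDual q.1)) hX
  refine ⟨l, x, d, h1, fun q hq => ?_⟩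
  exact Prod.Lex.toLex_le_toLex.1 (h2 q hq)

/-- Every never corrupted party outputs a pair. -/
theorem exists_output (hf : 3 * f < n) (hA : Fair A φ) {i : Fin n} (hi : Nonfaulty A φ i) :
    ∃ t x π, ((config A φ t).party i).out = some (x, π) := by
  have hg := eventually_gatherOut hf hA hi
  obtain ⟨s, m, ⟨X, rfl, hX⟩, hrec⟩ := exists_load_received (tag := .indices) hf hA hi <| by
    filter_upwards [hg] with t ht
    exact (phaseInv hf A φ t i).gather.gatherOut.1 ht
  have hph := phaseInv hf A φ s i
  have hXe : ∀ᶠ t in atTop, ((config A φ t).party i).gatherOut = some X :=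
    eventually_party hf (D := fun st => st.gatherOut = some X) (fun a b hab => hab.gatherOut X) hX
  -- The party receives the index set that it has broadcast itself, and evaluates its tuples.
  have hse : ∀ᶠ t in atTop, X ⊆ ((config A φ t).party i).startEval := by
    filter_upwards [eventually_indicesDone hf hA hi (hrec i hi)
      (eventually_gatherVerify hf hA (hph.gatherVerify hX) hi), hrec i hi, hXe] with t h1 h2 h3
    obtain ⟨I, h4, -, h5⟩ := (evalInv hf A φ t i).indicesDone i h1
    have := h2.symm.trans h4
    simp only [Option.some.injEq, Payload.set.injEq] at this
    subst this
    exact fun q hq => h5 q (((phaseInv hf A φ t i).gather.gatherOut_eq X h3).1 hq)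
      (Finset.mem_image_of_mem Prod.fst hq)
  obtain ⟨t₀, ht₀⟩ := hse.exists
  have hev : ∀ᶠ t in atTop, ∀ q ∈ X, ∃ e, (q.1, e) ∈ ((config A φ t).party i).evals :=
    (eventually_all_finset X).2 fun q hq =>
      eventually_evals (x := q.2.1) (d := q.2.2) hf hA (ht₀ hq) hi
  have hne : X.Nonempty := by
    obtain ⟨-, Q, hQ, hQ'⟩ := hph.gather.gatherOut_eq X hX
    obtain ⟨j, hj⟩ := Finset.card_pos.1 (lt_of_lt_of_le (Nat.sub_pos_of_lt (by omega)) hQ)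
    obtain ⟨W, hW, hWX⟩ := hQ' j hj
    exact Finset.image_nonempty.1 ((hph.nonempty_of_mem_U (by omega) hW).mono hWX)
  obtain ⟨l, x, d, hl, hbest⟩ := exists_best φ hne
  have hout : ∀ᶠ t in atTop, ((config A φ t).party i).out ≠ none := by
    refine eventually_of_rule hf hA hi (.output l x) (D := fun st => st.out ≠ none)
      (fun a b hab h => ?_) ?_ fun st hst => ?_
    · obtain ⟨q, hq⟩ := Option.ne_none_iff_exists'.1 h
      simp [hab.out q hq]
    · filter_upwards [hXe, hse, hev] with t h1 h2 h3
      refine or_iff_not_imp_left.2 fun h4 => ⟨not_not.1 h4, X, h1, hne.ne_empty, h3, ?_, d, hl⟩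
      exact ((evalInv hf A φ t i).isArgmax_iff (phaseInv hf A φ t i)
        ((phaseInv hf A φ t i).gather.gatherOut_eq X h1).1 h3 hl).2 hbest
    · obtain ⟨-, Y, hY, -⟩ := hst
      simp only [ruleEffect, hY]
      simp
  obtain ⟨t, ht⟩ := hout.exists
  obtain ⟨⟨y, π⟩, hq⟩ := Option.ne_none_iff_exists'.1 ht
  exact ⟨t, y, π, hq⟩

lemma exists_verifiedAt_of_verifies (hf : 3 * f < n) (hA : Fair A φ) {s : ℕ} {i j : Fin n}
    {X : Finset P.Tuple} {l : Fin n} {x : V} {d : P.vrf.Dkg}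
    (h : Verifies φ ((config A φ s).party j) X l x d) (hi : Nonfaulty A φ i) :
    ∃ t, VerifiedAt A φ t i x (indexSet X) := by
  obtain ⟨t, ht⟩ := (eventually_verifies hf hA h hi).exists
  exact ⟨t, hi t, ((evalInv hf A φ t i).peVerify_iff (phaseInv hf A φ t i)).2
    ⟨X, l, d, rfl, ht⟩⟩

lemma VerifiedAt.verifies (hf : 3 * f < n) {s : ℕ} {i : Fin n} {x : V} {π : Finset (Fin n)}
    (h : VerifiedAt A φ s i x π) :
    ∃ X l d, indexSet X = π ∧ Verifies φ ((config A φ s).party i) X l x d :=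
  ((evalInv hf A φ s i).peVerify_iff (phaseInv hf A φ s i)).1 h.2

theorem completeness (hf : 3 * f < n) (hA : Fair A φ) {i j : Fin n} {s : ℕ} {x : V}
    {π : Finset (Fin n)} (hi : Nonfaulty A φ i)
    (h : ((config A φ s).party j).out = some (x, π)) : ∃ t, VerifiedAt A φ t i x π := by
  obtain ⟨X, l, d, rfl, hv⟩ := (evalInv hf A φ s j).out x π h
  exact exists_verifiedAt_of_verifies hf hA hv hi

theorem agreement_on_verification (hf : 3 * f < n) (hA : Fair A φ) {i j : Fin n} {s : ℕ} {x : V}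
    {π : Finset (Fin n)} (h : VerifiedAt A φ s i x π) (hj : Nonfaulty A φ j) :
    ∃ t, VerifiedAt A φ t j x π := by
  obtain ⟨X, l, d, rfl, hv⟩ := h.verifies hf
  exact exists_verifiedAt_of_verifies hf hA hv hj

theorem external_validity (hf : 3 * f < n) {i : Fin n} {s : ℕ} {x : V} {π : Finset (Fin n)}
    (h : VerifiedAt A φ s i x π) : P.validate x = true := by
  obtain ⟨X, l, d, rfl, hv⟩ := h.verifies hf
  exact ((phaseInv hf A φ s i).valid_of_mem_R
    ((evalInv hf A φ s i).startEval_subset (hv.subset hv.mem))).1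

end Fair

/-! ### Dependence of an execution on the random function -/

/-- A step of a party uses only the values at the points in its set `startEval`: the evaluation of
shares is the only algorithm that involves the random function. -/
lemma ruleEffect_congr (hf : 3 * f < n) {φ φ' : P.Phi} {i : Fin n} {st : PartyState P}
    (hp : PhaseInv st) (h : EvalInv φ st)
    (hφ : ∀ k x d, (k, x, d) ∈ st.startEval → φ d k = φ' d k) {r : Rule P} (hr : Enabled st r) :
    ruleEffect φ i st r = ruleEffect φ' i st r := by
  cases r with
  | addShare j k x d =>
    obtain ⟨h1, h2, h3⟩ := hr
    obtain ⟨⟨es, ps⟩, hmsg⟩ := Option.ne_none_iff_exists'.1 h1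
    simp only [ruleEffect, hmsg]
    split
    · rename_i hv
      obtain ⟨-, hinj, hF⟩ := h.insert_share hp h2 h3 hv
      have hd := (hp.valid_of_mem_R (h.startEval_subset h2)).2
      split
      · rename_i hc
        rw [eval_eq hf φ hd hinj hF hc, eval_eq hf φ' hd hinj hF hc, hφ k x d h2]
      · rfl
    · rfl
  | _ => rfl

/-- An execution depends only on the values of the random function at the opened points: the
adversary sees no others, and the parties use no others. -/
lemma exec_succ_congr (hf : 3 * f < n) {A : Adversary P} {φ φ' : P.Phi} {t : ℕ}
    (h : ∀ d k, (d, k) ∈ (config A φ t).opened → φ d k = φ' d k) :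
    ∀ s ≤ t + 1, exec A φ s = exec A φ' s := by
  intro s hs
  induction s with
  | zero => rfl
  | succ s ih =>
    have ih := ih (by omega)
    have hop : ∀ d k, (d, k) ∈ (exec A φ s).1.opened → φ d k = φ' d k := fun d k hdk =>
      h d k ((config_le A φ (by omega : s ≤ t)).2.2 hdk)
    have hrev : reveal φ (exec A φ s).1 = reveal φ' (exec A φ s).1 := by
      funext d k
      unfold reveal
      split
      · rename_i hdk; rw [hop d k hdk]
      · rfl
    have hstep : ∀ a, (exec A φ s).1.step φ a = (exec A φ s).1.step φ' a := by
      intro a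
      unfold Config.step
      split
      · rename_i hl
        rcases a with i | ⟨i, x⟩ | ⟨i, j, m⟩ | ⟨i, r⟩
        pick_goal 4
        · dsimp only
          have := ruleEffect_congr hf (i := i) (phaseInv hf A φ s i) (evalInv hf A φ s i)
            (φ' := φ') (fun k x d hm => hop d k (((evalSent hf A φ s).opened d k).2 ⟨i, x, hm⟩))
            hl.2
          exact congrArg _ this
        all_goals rfl
      · rfl
    simp only [exec]
    rw [← ih, ← hrev, ← hstep]

/-- For every index at most one point is ever opened. -/
lemma opened_unique (hf : 3 * f < n) {A : Adversary P} {φ : P.Phi} (hA : Fair A φ) {s t : ℕ}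
    {d d' : P.vrf.Dkg} {k : Fin n} (h : (d, k) ∈ (config A φ s).opened)
    (h' : (d', k) ∈ (config A φ t).opened) : d = d' := by
  obtain ⟨i, x, h1⟩ := ((evalSent hf A φ s).opened d k).1 h
  obtain ⟨j, y, h2⟩ := ((evalSent hf A φ t).opened d' k).1 h'
  exact (eq_of_mem_R hf hA ((evalInv hf A φ s i).startEval_subset h1)
    ((evalInv hf A φ t j).startEval_subset h2)).2

/-! ### The common core -/

/-- `B` is contained in the sets `V_j` of `f + 1` pairs `(j, V_j)` in `U`. -/
def IsCore (f : ℕ) (U : Finset (Fin n × Finset (Fin n))) (B : Finset (Fin n)) : Prop :=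
  ∃ J : Finset (Fin n), f + 1 ≤ J.card ∧ ∀ j ∈ J, ∃ W, (j, W) ∈ U ∧ B ⊆ W

/-- When `Gather` gives an output, there is a core of `n - f` indices: by double counting, some
party is contained in more than `f` of the sets received in the third round, and the set of its
second round is contained in the corresponding sets `V_j`. -/
lemma exists_isCore (hf : 3 * f < n) {st : PartyState P} (h : PhaseInv st)
    (hg : st.gatherOut ≠ none) :
    ∃ B : Finset (Fin n), n - f ≤ B.card ∧ B ⊆ st.S ∧ IsCore f st.U B := by
  have hU := h.gather.gatherOut.1 hg
  have hex : ∀ q ∈ st.U, ∃ I : Finset (Fin n), n - f ≤ I.card ∧ I ⊆ st.T ∧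
      ∀ k ∈ I, ∀ B, st.received k .second = some (.set B) → B ⊆ q.2 := by
    rintro ⟨j, W⟩ hq
    obtain ⟨I, -, h1, h2, h3⟩ := h.gather.received_of_mem_U j W hq
    exact ⟨I, h1, h2, fun k hk B hB a ha => (h3 a).2 ⟨k, hk, B, hB, ha⟩⟩
  choose! I hI using hex
  have hsum : ∑ k : Fin n, f < ∑ k : Fin n, (st.U.filter fun q => k ∈ I q).card := by
    have h1 : ∑ q ∈ st.U, (I q).card = ∑ k : Fin n, (st.U.filter fun q => k ∈ I q).card := by
      simpa [Finset.bipartiteAbove, Finset.bipartiteBelow] using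
        Finset.sum_card_bipartiteAbove_eq_sum_card_bipartiteBelow (s := st.U)
          (t := Finset.univ) fun q k => k ∈ I q
    rw [← h1]
    have h2 : (n - f) * (n - f) ≤ ∑ q ∈ st.U, (I q).card :=
      (Nat.mul_le_mul_right _ hU).trans (by
        simpa using Finset.card_nsmul_le_sum st.U _ _ fun q hq => (hI q hq).1)
    refine lt_of_lt_of_le ?_ h2
    -- `n * f < (n - f) ^ 2`
    obtain ⟨m, rfl⟩ : ∃ m, n = 3 * f + 1 + m := ⟨n - (3 * f + 1), by omega⟩
    have : 3 * f + 1 + m - f = 2 * f + 1 + m := by omega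
    simp only [Finset.sum_const, Finset.card_univ, Fintype.card_fin, smul_eq_mul, this]
    nlinarith
  obtain ⟨k, -, hk⟩ := Finset.exists_lt_of_sum_lt hsum
  obtain ⟨q, hq⟩ := Finset.card_pos.1 (lt_of_le_of_lt (Nat.zero_le _) hk)
  obtain ⟨hqU, hqk⟩ := Finset.mem_filter.1 hq
  obtain ⟨B, hB, hBc, hBS⟩ := h.gather.received_of_mem_T k ((hI q hqU).2.1 hqk)
  refine ⟨B, hBc, hBS, (st.U.filter fun q => k ∈ I q).image Prod.fst, ?_, fun j hj => ?_⟩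
  · rw [Finset.card_image_of_injOn (h.gather.inj_U.mono
      (Finset.coe_subset.2 (Finset.filter_subset _ _)))]
    exact hk
  · obtain ⟨⟨j', W⟩, hm, rfl⟩ := Finset.mem_image.1 hj
    obtain ⟨hm, hkm⟩ := Finset.mem_filter.1 hm
    exact ⟨W, hm, (hI _ hm).2.2 k hkm B hB⟩

/-- Every index set that passes `GatherVerify`, for any party and at any time, contains the
core. -/
lemma IsCore.subset (hf : 3 * f < n) {A : Adversary P} {φ : P.Phi} (hA : Fair A φ) {s t : ℕ}
    {i j : Fin n} {B I : Finset (Fin n)} (h : IsCore f ((config A φ s).party i).U B)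
    (hI : GatherVerify ((config A φ t).party j) I) : B ⊆ I := by
  obtain ⟨J, hJ, hJ'⟩ := h
  obtain ⟨⟨Q, hQ, hQ'⟩, -⟩ := gatherVerify_iff.1 hI
  -- The `f + 1` pairs of the core and the `n - f` pairs of the verification overlap.
  have h1 := Finset.card_union_add_card_inter J Q
  have h2 : (J ∪ Q).card ≤ n := by simpa using Finset.card_le_univ (J ∪ Q)
  obtain ⟨l, hl⟩ := Finset.card_pos.1 (show 0 < (J ∩ Q).card by omega)
  obtain ⟨W, hW, hBW⟩ := hJ' l (Finset.mem_inter.1 hl).1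
  obtain ⟨W', hW', hWI⟩ := hQ' l (Finset.mem_inter.1 hl).2
  rw [eq_of_mem_U hf hA hW hW'] at hBW
  exact hBW.trans hWI

/-- The tuple of a party that has not been corrupted contains the input of that party. -/
lemma input_eq_of_mem_R (hf : 3 * f < n) {A : Adversary P} {φ : P.Phi} (hA : Fair A φ) {t : ℕ}
    {i l : Fin n} {x : V} {d : P.vrf.Dkg} (hl : l ∉ (config A φ t).faulty)
    (h : (l, x, d) ∈ ((config A φ t).party i).R) :
    ((config A φ t).party l).input = some x := by
  have hrec := (phaseInv hf A φ t i).gather.received_of_mem_R _ _ _ h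
  obtain ⟨j, com, F, prf, hs, -⟩ := ((rbRun hf hA l .input).safe hf t).integrity hf hl hrec
  have hc : n - f ≤ ((config A φ t).party l).count .input := by
    by_contra hc
    exact (loadInv hf A φ t).not_started l .input (not_le.1 hc) l j com F prf hs
  obtain ⟨m, h1, y, c, rfl, h2, -⟩ := (loadInv hf A φ t).started l .input hc
  have := (rbRun hf hA l .input).output_eq hf (t := t) (t₀ := t) hl (h1 l) hrec
  simp only [Payload.proposal.injEq] at this
  rw [h2, this.1]

lemma startedWith_of_input (hf : 3 * f < n) {A : Adversary P} {φ : P.Phi} {t : ℕ} {l : Fin n}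
    {x : V} (hl : l ∉ (config A φ t).faulty)
    (h : ((config A φ t).party l).input = some x) : StartedWith A φ l x := by
  induction t with
  | zero => exact absurd h (by simp [config, exec, Config.init, PartyState.init])
  | succ t ih =>
    have hl' : l ∉ (config A φ t).faulty := fun hm => hl ((config_le A φ (Nat.le_succ t)).1 hm)
    rcases hin : ((config A φ t).party l).input with _ | y
    · exact ⟨t, hl', hin, h⟩
    · have := (party_le hf A φ (Nat.le_succ t) l).input y hin
      rw [this] at h
      exact ih hl' (hin.trans h)

/-- There is a time at which the configuration does not yet depend on the random function, and
some party has completed `Gather`. -/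
lemma exists_time (hf : 3 * f < n) {A : Adversary P} (hA : ∀ φ : P.Phi, Fair A φ) (φ₀ : P.Phi) :
    ∃ t i, (∀ φ, config A φ t = config A φ₀ t) ∧
      ((config A φ₀ t).party i).gatherOut ≠ none := by
  have hex : ∃ t, (config A φ₀ t).opened.Nonempty := by
    obtain ⟨i, hi⟩ := Finset.card_pos.1
      (lt_of_lt_of_le (Nat.sub_pos_of_lt (by omega)) (le_card_nonfaulty hf A φ₀))
    obtain ⟨t, x, π, ht⟩ := exists_output hf (hA φ₀) (mem_nonfaulty.1 hi)
    obtain ⟨X, l, d, -, hv⟩ := (evalInv hf A φ₀ t i).out x π ht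
    exact ⟨t, (d, l), ((evalSent hf A φ₀ t).opened d l).2 ⟨i, x, hv.subset hv.mem⟩⟩
  -- At the first time when a point is open, the configuration is still the same for all random
  -- functions, since there was no open point before. Who opened the point has completed `Gather`.
  obtain ⟨t, ht⟩ : ∃ t, Nat.find hex = t := ⟨_, rfl⟩
  have hspec := Nat.find_spec hex
  rw [ht] at hspec
  obtain ⟨⟨d, k⟩, hdk⟩ := hspec
  obtain ⟨i, x, hi⟩ := ((evalSent hf A φ₀ t).opened d k).1 hdk
  refine ⟨t, i, fun φ => ?_, (evalInv hf A φ₀ t i).gatherOut ⟨_, hi⟩⟩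
  cases t with
  | zero => rfl
  | succ t =>
    have hemp : ¬ (config A φ₀ t).opened.Nonempty := Nat.find_min hex (by omega)
    exact congrArg Prod.fst (exec_succ_congr hf
      (fun d k hm => absurd ⟨_, hm⟩ hemp) (t + 1) le_rfl).symm

end Protocol

/-! ### Adaptively selected values of a random function -/

section Counting

variable {n N : ℕ} {D : Type} [Fintype D]

/-- The number of functions with prescribed values at one point of every column. -/
lemma card_fiber (s : Fin n → D) (w : Fin n → Fin N) :
    (Finset.univ.filter fun φ : D → Fin n → Fin N => ∀ k, φ (s k) k = w k).card =
      (N ^ (Fintype.card D - 1)) ^ n := by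
  have e : (Finset.univ.filter fun φ : D → Fin n → Fin N => ∀ k, φ (s k) k = w k) =
      Fintype.piFinset fun d => Fintype.piFinset fun k =>
        if d = s k then {w k} else (Finset.univ : Finset (Fin N)) := by
    ext φ
    simp only [Finset.mem_filter, Finset.mem_univ, true_and, Fintype.mem_piFinset]
    constructor
    · intro h d k
      split
      · rename_i hd; rw [hd, h k]; exact Finset.mem_singleton_self _
      · exact Finset.mem_univ _
    · intro h k
      simpa using h (s k) k
  rw [e, Fintype.card_piFinset]
  simp only [Fintype.card_piFinset]
  rw [Finset.prod_comm]
  have : ∀ k : Fin n, ∏ d : D, (if d = s k then {w k} else (Finset.univ : Finset (Fin N))).card =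
      N ^ (Fintype.card D - 1) := by
    intro k
    rw [← Finset.mul_prod_erase _ _ (Finset.mem_univ (s k))]
    simp only [if_true, Finset.card_singleton, one_mul]
    rw [Finset.prod_congr rfl (g := fun _ => N)]
    · rw [Finset.prod_const, Finset.card_erase_of_mem (Finset.mem_univ _), Finset.card_univ]
    · intro d hd
      rw [if_neg (Finset.ne_of_mem_erase hd), Finset.card_univ, Fintype.card_fin]
  simp [this]

/-- Let one point `(sel φ k, k)` of every column `k` be selected in such a way that the selection
depends only on the values at the selected points. Then the selected values are uniformly
distributed: the outcome `w` occurs if and only if `φ` has the values `w` at the points that are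
selected when all values in column `k` are `w k`. -/
lemma card_selected (sel : (D → Fin n → Fin N) → Fin n → D)
    (hsel : ∀ φ φ', (∀ k, φ (sel φ k) k = φ' (sel φ k) k) → sel φ' = sel φ)
    (W : Finset (Fin n → Fin N)) :
    (Finset.univ.filter fun φ : D → Fin n → Fin N => (fun k => φ (sel φ k) k) ∈ W).card =
      W.card * (N ^ (Fintype.card D - 1)) ^ n := by
  refine (Finset.card_eq_sum_card_fiberwise
    (f := fun (φ : D → Fin n → Fin N) k => φ (sel φ k) k) (t := W)
    (fun φ hφ => (Finset.mem_filter.1 (Finset.mem_coe.1 hφ)).2)).trans ?_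
  refine Finset.sum_const_nat fun w hw => ?_
  rw [← card_fiber (sel fun _ => w) w]
  congr 1
  ext φ
  simp only [Finset.mem_filter, Finset.mem_univ, true_and]
  constructor
  · rintro ⟨-, h⟩ k
    have : sel (fun _ => w) = sel φ := hsel φ _ fun k => congrFun h k
    rw [this]
    exact congrFun h k
  · intro h
    have hs : sel φ = sel fun _ => w := hsel _ φ fun k => (h k).symm
    have hw' : (fun k => φ (sel φ k) k) = w := by
      funext k; rw [hs]; exact h k
    exact ⟨hw'.symm ▸ hw, hw'⟩

/-- The functions that have their strict maximum at `l`, counted by the value `v` of the maximum. -/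
lemma card_strict_max (l : Fin n) :
    (Finset.univ.filter fun w : Fin n → Fin N => ∀ k, k ≠ l → w k < w l).card =
      ∑ v ∈ Finset.range N, v ^ (n - 1) := by
  rw [Finset.card_eq_sum_card_fiberwise (f := fun w => w l) (t := Finset.univ)
    (fun _ _ => Finset.mem_univ _), ← Fin.sum_univ_eq_sum_range (fun v => v ^ (n - 1)) N]
  refine Finset.sum_congr rfl fun v _ => ?_
  have e : ((Finset.univ.filter fun w : Fin n → Fin N => ∀ k, k ≠ l → w k < w l).filter
      fun w => w l = v) = Fintype.piFinset fun k => if k = l then {v} else Finset.Iio v := by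
    ext w
    simp only [Finset.mem_filter, Finset.mem_univ, true_and, Fintype.mem_piFinset]
    constructor
    · rintro ⟨h, rfl⟩ k
      split
      · rename_i hk; rw [hk]; exact Finset.mem_singleton_self _
      · rename_i hk; exact Finset.mem_Iio.2 (h k hk)
    · intro h
      have hl : w l = v := by simpa using h l
      refine ⟨fun k hk => ?_, hl⟩
      have := h k
      rw [if_neg hk] at this
      rw [hl]; exact Finset.mem_Iio.1 this
  rw [e, Fintype.card_piFinset, ← Finset.mul_prod_erase _ _ (Finset.mem_univ l)]
  simp only [if_true, Finset.card_singleton, one_mul]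
  rw [Finset.prod_congr rfl (g := fun _ => (v : ℕ))]
  · rw [Finset.prod_const, Finset.card_erase_of_mem (Finset.mem_univ _), Finset.card_univ,
      Fintype.card_fin]
  · intro k hk
    rw [if_neg (Finset.ne_of_mem_erase hk), Fin.card_Iio]

lemma card_exists_strict_max (L : Finset (Fin n)) :
    (Finset.univ.filter fun w : Fin n → Fin N => ∃ l ∈ L, ∀ k, k ≠ l → w k < w l).card =
      L.card * ∑ v ∈ Finset.range N, v ^ (n - 1) := by
  have e : (Finset.univ.filter fun w : Fin n → Fin N => ∃ l ∈ L, ∀ k, k ≠ l → w k < w l) =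
      L.biUnion fun l => Finset.univ.filter fun w : Fin n → Fin N => ∀ k, k ≠ l → w k < w l := by
    ext w; simp
  rw [e, Finset.card_biUnion]
  · exact Finset.sum_const_nat fun l _ => card_strict_max l
  · intro l _ l' _ hll'
    refine Finset.disjoint_left.2 fun w hw hw' => ?_
    have h1 := (Finset.mem_filter.1 hw).2 l' hll'.symm
    have h2 := (Finset.mem_filter.1 hw').2 l hll'
    exact lt_asymm h1 h2

/-- Bernoulli's inequality `(1 - 1 / (N + 1)) ^ (m + 1) ≥ 1 - (m + 1) / (N + 1)`, without
denominators. -/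
lemma pow_mul_sub_le_pow (m N : ℕ) : ((N : ℝ) + 1) ^ m * (N - m) ≤ (N : ℝ) ^ (m + 1) := by
  have hN : (0 : ℝ) < N + 1 := by positivity
  have hb := one_add_mul_le_pow (a := -(1 / (N + 1 : ℝ))) (by
    have : 1 / (N + 1 : ℝ) ≤ 1 := by
      rw [div_le_one hN]; linarith [(Nat.cast_nonneg N : (0 : ℝ) ≤ N)]
    linarith) (m + 1)
  have h1 : 1 + -(1 / (N + 1 : ℝ)) = N / (N + 1) := by field_simp; ring
  rw [h1, div_pow, le_div_iff₀ (by positivity)] at hb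
  refine le_of_eq_of_le ?_ hb
  push_cast; rw [pow_succ]; field_simp; ring

lemma pow_le_mul_sum_pow (m N : ℕ) : (N : ℝ) ^ (m + 1) ≤
    (m + 1) * (∑ v ∈ Finset.range (N + 1), (v : ℝ) ^ m) := by
  induction N with
  | zero =>
    simp
    positivity
  | succ N ih =>
    rw [Finset.sum_range_succ, mul_add]
    have hb := pow_mul_sub_le_pow m N
    have h1 : ((N : ℝ) + 1) ^ m * (N - m) =
        (N + 1 : ℝ) ^ (m + 1) - (m + 1) * (N + 1 : ℝ) ^ m := by ring
    push_cast
    linarith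

/-- If `N ≥ n ^ 3`, then with probability at least `1/3` the maximum of `n` independent uniform
values is attained once, in a given set of more than `n / 3` positions. -/
lemma pow_le_three_mul {f : ℕ} (hf : 3 * f < n) (hN : n ^ 3 ≤ N) {a : ℕ} (ha : n - 2 * f ≤ a) :
    N ^ n ≤ 3 * (a * ∑ v ∈ Finset.range N, v ^ (n - 1)) := by
  obtain ⟨m, rfl⟩ : ∃ m, n = m + 1 := ⟨n - 1, by omega⟩
  have ha' : m + 3 ≤ 3 * a := by omega
  rcases Nat.eq_zero_or_pos m with rfl | hm
  · simp only [zero_add, pow_one, Nat.sub_self, pow_zero, Finset.sum_const, Finset.card_range,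
      smul_eq_mul, mul_one]
    nlinarith
  obtain ⟨N, rfl⟩ : ∃ N', N = N' + 1 :=
    ⟨N - 1, by have := Nat.pos_of_ne_zero (n := (m + 1) ^ 3) (by positivity); omega⟩
  have key := pow_le_mul_sum_pow m N
  have hb := pow_mul_sub_le_pow m N
  have hNr : ((m : ℝ) + 1) ^ 3 ≤ N + 1 := by exact_mod_cast hN
  have har : (m : ℝ) + 3 ≤ 3 * a := by exact_mod_cast ha'
  have hmr : (1 : ℝ) ≤ m := by exact_mod_cast hm
  have hS : 0 ≤ ∑ v ∈ Finset.range (N + 1), (v : ℝ) ^ m := by positivity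
  -- `(m + 1) (N + 1) ≤ (m + 3) (N - m)` holds because `(m + 1) (m + 3) ≤ 2 (N + 1)`.
  have hlin : ((m : ℝ) + 1) * (N + 1) ≤ (m + 3) * (N - m) := by
    have : 0 ≤ ((m : ℝ) + 1) * (2 * m ^ 2 + 3 * m - 1) :=
      mul_nonneg (by positivity) (by nlinarith)
    nlinarith
  have hfin : ((N : ℝ) + 1) ^ (m + 1) ≤
      3 * (a * ∑ v ∈ Finset.range (N + 1), (v : ℝ) ^ m) := by
    have hm0 : (0 : ℝ) < m + 1 := by positivity
    refine le_of_mul_le_mul_left ?_ hm0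
    calc ((m : ℝ) + 1) * ((N : ℝ) + 1) ^ (m + 1)
        = ((N : ℝ) + 1) ^ m * ((m + 1) * (N + 1)) := by ring
      _ ≤ ((N : ℝ) + 1) ^ m * ((m + 3) * (N - m)) :=
          mul_le_mul_of_nonneg_left hlin (by positivity)
      _ = (m + 3) * (((N : ℝ) + 1) ^ m * (N - m)) := by ring
      _ ≤ (m + 3) * ((m + 1) * ∑ v ∈ Finset.range (N + 1), (v : ℝ) ^ m) :=
          mul_le_mul_of_nonneg_left (hb.trans key) (by positivity)
      _ ≤ (3 * a) * ((m + 1) * ∑ v ∈ Finset.range (N + 1), (v : ℝ) ^ m) :=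
          mul_le_mul_of_nonneg_right har (by positivity)
      _ = (m + 1) * (3 * (a * ∑ v ∈ Finset.range (N + 1), (v : ℝ) ^ m)) := by ring
  simp only [Nat.add_sub_cancel]
  exact_mod_cast hfin

end Counting

/-! ### Binding -/

lemma one_third_le_uniform {α : Type} [Fintype α] [Nonempty α] {E : Set α}
    (h : Nat.card α ≤ 3 * E.ncard) :
    1 / 3 ≤ (PMF.uniformOfFintype α).toOuterMeasure E := by
  rw [PMF.toOuterMeasure_uniformOfFintype_apply, ← Nat.card_eq_fintype_card,
    ← Nat.card_eq_fintype_card, Nat.card_coe_set_eq]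
  have h0 : ((Nat.card α : ℕ) : ENNReal) ≠ 0 := Nat.cast_ne_zero.2 Nat.card_pos.ne'
  rw [ENNReal.le_div_iff_mul_le (Or.inl h0) (Or.inl (ENNReal.natCast_ne_top _)), one_div,
    ENNReal.inv_mul_le_iff (by norm_num) (by norm_num)]
  exact_mod_cast h

section Protocol

variable {n f lam : ℕ} {V : Type} {P : Setup n f lam V}

/-- The transcript of the only point in column `k` that is opened in the execution (that of an
empty set of shares if there is none). -/
def openedAt (A : Adversary P) (φ : P.Phi) (k : Fin n) : P.vrf.Dkg :=
  if h : ∃ d t, (d, k) ∈ (config A φ t).opened then h.choose else P.vrf.dkgAggregate ∅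

lemma openedAt_eq (hf : 3 * f < n) {A : Adversary P} {φ : P.Phi} (hA : Fair A φ) {t : ℕ}
    {d : P.vrf.Dkg} {k : Fin n} (h : (d, k) ∈ (config A φ t).opened) : openedAt A φ k = d := by
  have hex : ∃ d t, (d, k) ∈ (config A φ t).opened := ⟨d, t, h⟩
  rw [openedAt, dif_pos hex]
  exact opened_unique hf hA hex.choose_spec.choose_spec h

/-- The opened points depend only on the values of the random function at the opened points. -/
lemma openedAt_congr (hf : 3 * f < n) {A : Adversary P} {φ φ' : P.Phi} (hA : Fair A φ)
    (h : ∀ k, φ (openedAt A φ k) k = φ' (openedAt A φ k) k) :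
    openedAt A φ' = openedAt A φ := by
  have hc : config A φ' = config A φ := by
    funext t
    refine congrArg Prod.fst (exec_succ_congr hf (t := t) (fun d k hdk => ?_) t
      (Nat.le_succ t)).symm
    rw [← openedAt_eq hf hA hdk]
    exact h k
  unfold openedAt
  rw [hc]

/-- If the evaluation of an index `l` of the core is larger than all other evaluations, then
`PEVerify` accepts only the proposal of `l`. -/
lemma IsCore.eq_of_verifiedAt (hf : 3 * f < n) {A : Adversary P} {φ : P.Phi} (hA : Fair A φ)
    {s t : ℕ} {i j l : Fin n} {B : Finset (Fin n)}
    (hB : IsCore f ((config A φ s).party i).U B) (hl : l ∈ B) {y : V} {d : P.vrf.Dkg}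
    (hy : (l, y, d) ∈ ((config A φ s).party i).R)
    (hmax : ∀ k, k ≠ l → φ (openedAt A φ k) k < φ (openedAt A φ l) l)
    {x : V} {π : Finset (Fin n)} (hv : VerifiedAt A φ t j x π) : x = y := by
  obtain ⟨X, l', d', -, hv⟩ := hv.verifies hf
  have hX : ∀ {k z c}, (k, z, c) ∈ X → openedAt A φ k = c := fun {k z c} hm =>
    openedAt_eq hf hA (((evalSent hf A φ t).opened c k).2 ⟨j, z, hv.subset hm⟩)
  obtain ⟨⟨l₀, z, c⟩, hm, rfl⟩ := Finset.mem_image.1 (hB.subset hf hA hv.gatherVerify hl)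
  have hll' : l' = l₀ := by
    by_contra hne
    have h1 := hmax l' hne
    rw [hX hv.mem, hX hm] at h1
    rcases hv.best _ hm with h2 | h2
    · exact lt_asymm h1 h2
    · exact h1.ne' h2.1
  subst hll'
  exact (eq_of_mem_R hf hA
    ((evalInv hf A φ t j).startEval_subset (hv.subset hv.mem)) hy).1

/-- When a party completes `Gather` before any evaluation share has been computed, the core at
that time does not depend on the random function. With probability at least `1/3`, the largest
evaluation is attained only at an index of the core that is nonfaulty at that time, and then all
verified proposals are the input of this party. -/
theorem exists_binding (hf : 3 * f < n) (hlam : n ^ 3 ≤ 2 ^ lam) {A : Adversary P}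
    (hA : ∀ φ : P.Phi, Fair A φ) :
    ∃ xstar : P.Phi → Option V,
      (∀ φ y, xstar φ = some y → ∀ i t x π, VerifiedAt A φ t i x π → x = y) ∧
      1 / 3 ≤ prob P {φ | ∃ i y, xstar φ = some y ∧ StartedWith A φ i y} := by
  have hpos : 0 < 2 ^ lam := by positivity
  let φ₀ : P.Phi := fun _ _ => ⟨0, hpos⟩
  obtain ⟨T, i, hT, hg⟩ := exists_time hf hA φ₀
  obtain ⟨B, hBc, hBS, hB⟩ := exists_isCore hf (phaseInv hf A φ₀ T i) hg
  let L : Finset (Fin n) := B \ (config A φ₀ T).faulty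
  have hLc : n - 2 * f ≤ L.card := by
    have h1 : B.card - (config A φ₀ T).faulty.card ≤ L.card := Finset.le_card_sdiff _ B
    have h2 := card_faulty_le hf A φ₀ T
    omega
  have hinput : ∀ l ∈ L, ∃ y d, (l, y, d) ∈ ((config A φ₀ T).party i).R ∧
      ∀ φ, StartedWith A φ l y := by
    intro l hl
    obtain ⟨hlB, hlF⟩ := Finset.mem_sdiff.1 hl
    obtain ⟨y, d, hm⟩ := (phaseInv hf A φ₀ T i).gather.mem_S l |>.1 (hBS hlB)
    have hin := input_eq_of_mem_R hf (hA φ₀) hlF hm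
    exact ⟨y, d, hm, fun φ => startedWith_of_input hf (t := T) (by rwa [hT φ]) (by rwa [hT φ])⟩
  -- The binding value is the input of a nonfaulty party that all verifications agree with, if
  -- there is one.
  let xstar : P.Phi → Option V := fun φ =>
    if h : ∃ y, (∃ i, StartedWith A φ i y) ∧ ∀ i t x π, VerifiedAt A φ t i x π → x = y
    then some h.choose else none
  have hx : ∀ φ y, xstar φ = some y → (∃ i, StartedWith A φ i y) ∧
      ∀ i t x π, VerifiedAt A φ t i x π → x = y := by
    intro φ y h
    by_cases hex : ∃ y, (∃ i, StartedWith A φ i y) ∧ ∀ i t x π, VerifiedAt A φ t i x π → x = y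
    · simp only [xstar, dif_pos hex, Option.some.injEq] at h
      exact h ▸ hex.choose_spec
    · simp [xstar, dif_neg hex] at h
  refine ⟨xstar, fun φ y h => (hx φ y h).2, ?_⟩
  -- `E` is the event that the largest evaluation is attained at one index only, and that this
  -- index is in `L`.
  let W : Finset (Fin n → Fin (2 ^ lam)) :=
    Finset.univ.filter fun w => ∃ l ∈ L, ∀ k, k ≠ l → w k < w l
  let E : Set P.Phi := {φ | (fun k => φ (openedAt A φ k) k) ∈ W}
  have hE : E ⊆ {φ | ∃ i y, xstar φ = some y ∧ StartedWith A φ i y} := by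
    intro φ hφ
    have hW : (fun k => φ (openedAt A φ k) k) ∈ W := hφ
    obtain ⟨-, l, hl, hmax⟩ := Finset.mem_filter.1 hW
    obtain ⟨y, d, hy, hst⟩ := hinput l hl
    have hex : ∃ y, (∃ i, StartedWith A φ i y) ∧
        ∀ i t x π, VerifiedAt A φ t i x π → x = y := by
      refine ⟨y, ⟨l, hst φ⟩, fun j t x π hv => ?_⟩
      rw [← hT φ] at hB hy
      exact hB.eq_of_verifiedAt hf (hA φ) (Finset.mem_sdiff.1 hl).1 hy hmax hv
    have hs : xstar φ = some hex.choose := dif_pos hex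
    obtain ⟨⟨j, hj⟩, -⟩ := hx φ _ hs
    exact ⟨j, _, hs, hj⟩
  refine le_trans ?_ ((PMF.uniformOfFintype P.Phi).toOuterMeasure.mono hE)
  refine one_third_le_uniform ?_
  have : Fintype P.vrf.Dkg := Fintype.ofFinite _
  have hcard := card_selected (openedAt A)
    (fun φ φ' h => openedAt_congr hf (hA φ) h)
  have hEc : E.ncard = W.card * ((2 ^ lam) ^ (Fintype.card P.vrf.Dkg - 1)) ^ n := by
    rw [← hcard W, ← Set.ncard_coe_finset]
    congr 1
    ext φ
    simp [E]
  have hD : 0 < Fintype.card P.vrf.Dkg :=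
    Fintype.card_pos_iff.2 ⟨P.vrf.dkgAggregate ∅⟩
  have hPhi : Nat.card P.Phi =
      (2 ^ lam) ^ n * ((2 ^ lam) ^ (Fintype.card P.vrf.Dkg - 1)) ^ n := by
    obtain ⟨m, hm⟩ : ∃ m, Fintype.card P.vrf.Dkg = m + 1 := ⟨_, (Nat.succ_pred hD.ne').symm⟩
    rw [Nat.card_fun, Nat.card_fun, Nat.card_eq_fintype_card, Nat.card_eq_fintype_card,
      Nat.card_eq_fintype_card, Fintype.card_fin, Fintype.card_fin, hm, Nat.add_sub_cancel]
    ring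
  have hW : W.card = L.card * ∑ v ∈ Finset.range (2 ^ lam), v ^ (n - 1) :=
    card_exists_strict_max L
  rw [hEc, hPhi, hW, ← mul_assoc 3]
  exact Nat.mul_le_mul_right _ (pow_le_three_mul hf hlam hLc)

end Protocol

end ProposalElection

end

theorem mainTheorem3 (n f lam : ℕ) (V : Type) (hf : 3 * f < n) (hlam : n ^ 3 ≤ 2 ^ lam)
    (P : ProposalElection.Setup n f lam V) (A : ProposalElection.Adversary P)
    (hA : ∀ φ : P.Phi, ProposalElection.Fair A φ) :
    ProposalElection.IsVerifiableProposalElection A (1 / 3) where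
  termination φ _ hi := ProposalElection.exists_output hf (hA φ) hi
  completeness φ _ _ _ _ _ hi _ h := ProposalElection.completeness hf (hA φ) hi h
  agreement φ _ _ _ _ _ h hj := ProposalElection.agreement_on_verification hf (hA φ) h hj
  externalValidity _ _ _ _ _ h := ProposalElection.external_validity hf h
  binding := ProposalElection.exists_binding hf hlam hA
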